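/- Let $Q=Q(b_1,b_2,b_3,b_4)\subset\mathbb{R}^2\cong\mathbb{C}$ be a Pitot quadrilateral, i.e. the (convex or concave) open region bounded by a quadrilateral with vertices $b_1,b_2,b_3,b_4$ in counterclockwise order, of positive area, with $|b_1-b_2|+|b_3-b_4|=|b_2-b_3|+|b_4-b_1|$. Let $\mathbb{D}$ be the open unit disk. Then there is $p\in(0,\pi)$ such that the Poisson extension $$f(z)=\frac1{2\pi}\int_0^{2\pi}\frac{1-|z|^2}{|e^{i\theta}-z|^2}\,F(\theta)\,d\theta,\qquad z\in\mathbb{D},$$ of the step function $F$ equal to $b_4,b_1,b_2,b_3$ on $[0,p),[p,\pi),[\pi,\pi+p),[\pi+p,2\pi)$ respectively is a (harmonic) diffeomorphism of $\mathbb{D}$ onto $Q$, and, writing $f=h+\overline g$ with $h,g$ holomorphic in $\mathbb{D}$ and $g(0)=0$, the following hold. One has $h'\neq0$ in $\mathbb{D}$, and there is a Möbius automorphism $\mathbf q(z)=X\frac{z-a}{1-\bar a z}$ ($|X|=1$, $|a|<1$) of $\mathbb{D}$ with $\mathbf q^2=g'/h'$ such that, with $\mathbf p=h'$ and $$T(z)=2\,\operatorname{Im}\int_0^z\mathbf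 p(\zeta)\,\mathbf q(\zeta)\,d\zeta ,$$ the surface $\Sigma=\{(\operatorname{Re}f(z),\operatorname{Im}f(z),T(z)):z\in\mathbb{D}\}$ is a minimal graph over $Q$, namely the graph $\Sigma^\diamond$ of the function $\mathbf f^\diamond=T\circ f^{-1}:Q\to\mathbb{R}$, which is smooth and solves the minimal surface equation in $Q$. The upward unit normal of $\Sigma$ at $(f(z),T(z))$ is $$\frac{1}{1+|\mathbf q(z)|^2}\bigl(-2\operatorname{Im}\mathbf q(z),\,-2\operatorname{Re}\mathbf q(z),\,1-|\mathbf q(z)|^2\bigr),$$ i.e. it is the point with coordinate $-i\,\overline{\mathbf q(z)}$ under stereographic projection from the south pole; in particular the Gauss map is a diffeomorphism of $\Sigma$ onto the open upper hemisphere of $\mathbb{S}^2$. Moreover, as $(u,v)\in Q$ tends to a point of the open sides $(b_1,b_2)\cup(b_3,b_4)$, $\mathbf f^\diamond(u,v)\to+\infty$, and as $(u,v)\in Q$ tends to a point of the open sides $(b_4,b_1)\cup(b_2,b_3)$, $\mathbf f^\diamond(u,v)\to-\infty$. -/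

import Mathlib

open scoped ContDiff ComplexConjugate Topology

noncomputable section

namespace PitotGraph

/-! The plane `ℝ²` is identified with `ℂ` (`u + i v ↔ (u, v)`), and `ℝ³` is
`EuclideanSpace ℝ (Fin 3)`. -/

/-- The open unit disk. -/
def disk : Set ℂ := Metric.ball 0 1

/-! ### Quadrilaterals -/

/-- The closed polygonal line `b₁ b₂ b₃ b₄ b₁`. -/
def quadBoundary (b₁ b₂ b₃ b₄ : ℂ) : Set ℂ :=
  (Polygon.mk ![b₁, b₂, b₃, b₄]).boundary ℝ

theorem quadBoundary_eq (b₁ b₂ b₃ b₄ : ℂ) :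
    quadBoundary b₁ b₂ b₃ b₄ =
      segment ℝ b₁ b₂ ∪ segment ℝ b₂ b₃ ∪ segment ℝ b₃ b₄ ∪ segment ℝ b₄ b₁ := by
  have e0 : finRotate 4 0 = 1 := by decide
  have e1 : finRotate 4 1 = 2 := by decide
  have e2 : finRotate 4 2 = 3 := by decide
  have e3 : finRotate 4 3 = 0 := by decide
  ext x
  simp only [quadBoundary, Polygon.boundary, Polygon.edgeSet, affineSegment_eq_segment,
    Set.mem_iUnion, Fin.exists_fin_succ, Set.mem_union]
  simp [e0, e1, e2, e3, or_assoc]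

/-- The open region enclosed by the quadrilateral: the points off the polygonal line whose
connected component in the complement of the line is bounded. -/
def quadRegion (b₁ b₂ b₃ b₄ : ℂ) : Set ℂ :=
  {w | w ∈ (quadBoundary b₁ b₂ b₃ b₄)ᶜ ∧
    Bornology.IsBounded (connectedComponentIn (quadBoundary b₁ b₂ b₃ b₄)ᶜ w)}

/-- A Pitot quadrilateral: the vertices are in counterclockwise order (the shoelace expression,
which is twice the signed area, is positive) and the two pairs of opposite sides have the same
total length.  These two conditions already force the vertices to be distinct and the polygonal
line to be free of self-intersections; convexity is not required. -/
structure IsPitotQuadrilateral (b₁ b₂ b₃ b₄ : ℂ) : Prop where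
  counterclockwise :
    0 < (conj b₁ * b₂).im + (conj b₂ * b₃).im + (conj b₃ * b₄).im + (conj b₄ * b₁).im
  side_condition : dist b₁ b₂ + dist b₃ b₄ = dist b₂ b₃ + dist b₄ b₁

/-! ### Poisson extension of a step function -/

/-- The step function equal to `b₄, b₁, b₂, b₃` on `[0, p)`, `[p, π)`, `[π, π + p)`,
`[π + p, 2π)` respectively. -/
def stepFunction (b₁ b₂ b₃ b₄ : ℂ) (p θ : ℝ) : ℂ :=
  if θ < p then b₄ else if θ < Real.pi then b₁ else if θ < Real.pi + p then b₂ else b₃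

/-- The Poisson extension
`P[F](z) = (1 / 2π) ∫₀^{2π} (1 - |z|²) / |e^{iθ} - z|² F(θ) dθ` to the unit disk. -/
def poissonExtension (F : ℝ → ℂ) (z : ℂ) : ℂ :=
  (1 / (2 * Real.pi) : ℝ) •
    ∫ θ in (0 : ℝ)..(2 * Real.pi),
      ((1 - ‖z‖ ^ 2) / ‖Complex.exp (Complex.I * θ) - z‖ ^ 2) • F θ

/-- `f = h + conj g` on the disk, with `h`, `g` holomorphic in the disk and `g 0 = 0`. -/
structure IsCanonicalDecomposition (f h g : ℂ → ℂ) : Prop where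
  h_holo : DifferentiableOn ℂ h disk
  g_holo : DifferentiableOn ℂ g disk
  g_zero : g 0 = 0
  eq : ∀ z ∈ disk, f z = h z + conj (g z)

/-- `q` is (on the disk) a Möbius automorphism of the unit disk. -/
def IsDiskAutomorphism (q : ℂ → ℂ) : Prop :=
  ∃ X a : ℂ, ‖X‖ = 1 ∧ ‖a‖ < 1 ∧ ∀ z ∈ disk, q z = X * ((z - a) / (1 - z * conj a))

/-! ### Smooth maps between subsets of Euclidean spaces -/

/-- A map is smooth on a subset `A` if near every point of `A` it agrees on `A` with a smooth map
defined on an open set of the ambient space. -/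
def SmoothOnSubset {E F : Type*} [NormedAddCommGroup E] [NormedSpace ℝ E]
    [NormedAddCommGroup F] [NormedSpace ℝ F] (φ : E → F) (A : Set E) : Prop :=
  ∀ x ∈ A, ∃ U : Set E, IsOpen U ∧ x ∈ U ∧
    ∃ Φ : E → F, ContDiffOn ℝ ∞ Φ U ∧ Set.EqOn Φ φ (U ∩ A)

/-- `φ` restricts to a diffeomorphism of the subset `A` onto the subset `B`. -/
def IsDiffeomorphismOnto {E F : Type*} [NormedAddCommGroup E] [NormedSpace ℝ E]
    [NormedAddCommGroup F] [NormedSpace ℝ F] (φ : E → F) (A : Set E) (B : Set F) : Prop :=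
  ∃ ψ : F → E, Set.MapsTo φ A B ∧ Set.MapsTo ψ B A ∧ Set.InvOn ψ φ A B ∧
    SmoothOnSubset φ A ∧ SmoothOnSubset ψ B

/-! ### Graphs in space -/

/-- The partial derivative with respect to the first coordinate `u`. -/
def partialU (k : ℂ → ℝ) (w : ℂ) : ℝ := fderiv ℝ k w 1

/-- The partial derivative with respect to the second coordinate `v`. -/
def partialV (k : ℂ → ℝ) (w : ℂ) : ℝ := fderiv ℝ k w Complex.I

/-- `k` is smooth on the open set `U` and satisfies there the minimal surface equation
`(1 + k_v²) k_uu - 2 k_u k_v k_uv + (1 + k_u²) k_vv = 0`, i.e. its graph has vanishing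
mean curvature. -/
structure IsMinimalGraph (k : ℂ → ℝ) (U : Set ℂ) : Prop where
  isOpen : IsOpen U
  smooth : ContDiffOn ℝ ∞ k U
  equation : ∀ w ∈ U,
    (1 + partialV k w ^ 2) * partialU (partialU k) w
      - 2 * partialU k w * partialV k w * partialV (partialU k) w
      + (1 + partialU k w ^ 2) * partialV (partialV k) w = 0

/-- The graph `{(u, v, k(u, v)) : (u, v) ∈ U}`. -/
def graphOver (k : ℂ → ℝ) (U : Set ℂ) : Set (EuclideanSpace ℝ (Fin 3)) :=
  (fun w => !₂[w.re, w.im, k w]) '' U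

/-- The upward unit normal `(-k_u, -k_v, 1) / √(1 + k_u² + k_v²)` of the graph of `k`
at the point above `w`. -/
def upwardNormal (k : ℂ → ℝ) (w : ℂ) : EuclideanSpace ℝ (Fin 3) :=
  (1 / √(1 + partialU k w ^ 2 + partialV k w ^ 2)) • !₂[-partialU k w, -partialV k w, 1]

/-- The Gauss map of the graph of `k`: a point `(u, v, t)` of the graph goes to the upward unit
normal there. -/
def gaussMap (k : ℂ → ℝ) (x : EuclideanSpace ℝ (Fin 3)) : EuclideanSpace ℝ (Fin 3) :=
  upwardNormal k ⟨x 0, x 1⟩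

/-- The open upper hemisphere of the unit sphere. -/
def upperHemisphere : Set (EuclideanSpace ℝ (Fin 3)) := {x | ‖x‖ = 1 ∧ 0 < x 2}

/-- Inverse of the stereographic projection from the south pole `(0, 0, -1)` onto the equatorial
plane; it maps the unit disk onto the open upper hemisphere. -/
def invStereo (ζ : ℂ) : EuclideanSpace ℝ (Fin 3) :=
  (1 / (1 + ‖ζ‖ ^ 2)) • !₂[2 * ζ.re, 2 * ζ.im, 1 - ‖ζ‖ ^ 2]

/-! ### Enneper–Weierstrass form -/

/-- The height `T(z) = 2 Im ∫₀^z p q dζ`, integrated along the segment from `0` to `z`. -/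
def weierstrassHeight (p q : ℂ → ℂ) (z : ℂ) : ℝ :=
  2 * (∫ t in (0 : ℝ)..1, p (t * z) * q (t * z) * z).im

/-- The parametrized surface `{(Re f(z), Im f(z), T(z)) : |z| < 1}`. -/
def parametrizedSurface (f : ℂ → ℂ) (T : ℂ → ℝ) : Set (EuclideanSpace ℝ (Fin 3)) :=
  (fun z => !₂[(f z).re, (f z).im, T z]) '' disk

end PitotGraph

end

noncomputable section

namespace PitotGraph

/-! ### Geometry of Pitot quadrilaterals -/

/-- The planar cross product. -/
def cross (x y : ℂ) : ℝ := x.re * y.im - x.im * y.re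

theorem conj_mul_im (x y : ℂ) : (conj x * y).im = cross x y := by
  simp [cross]; ring

theorem IsPitotQuadrilateral.rotate {b₁ b₂ b₃ b₄ : ℂ} (h : IsPitotQuadrilateral b₁ b₂ b₃ b₄) :
    IsPitotQuadrilateral b₂ b₃ b₄ b₁ where
  counterclockwise := by linarith [h.counterclockwise]
  side_condition := by linarith [h.side_condition]

theorem quadBoundary_rotate (b₁ b₂ b₃ b₄ : ℂ) :
    quadBoundary b₂ b₃ b₄ b₁ = quadBoundary b₁ b₂ b₃ b₄ := by
  simp only [quadBoundary_eq]
  ext x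
  simp only [Set.mem_union]
  tauto

/-- Opposite sides of a Pitot quadrilateral do not cross. -/
theorem IsPitotQuadrilateral.not_crossing {b₁ b₂ b₃ b₄ : ℂ}
    (h : IsPitotQuadrilateral b₁ b₂ b₃ b₄)
    (hA : cross (b₂ - b₁) (b₃ - b₁) ≤ 0) (hB : cross (b₃ - b₂) (b₄ - b₂) ≤ 0) : False := by
  have hc := h.counterclockwise
  simp only [conj_mul_im] at hc
  set A₁ := cross (b₂ - b₁) (b₃ - b₁) with hA₁
  set B₁ := cross (b₃ - b₂) (b₄ - b₂) with hB₁
  set A₂ := cross (b₄ - b₃) (b₁ - b₃) with hA₂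
  set B₂ := cross (b₁ - b₄) (b₂ - b₄) with hB₂
  have e1 : A₁ + A₂ = cross b₁ b₂ + cross b₂ b₃ + cross b₃ b₄ + cross b₄ b₁ := by
    simp only [hA₁, hA₂, cross, Complex.sub_re, Complex.sub_im]; ring
  have e2 : B₁ + B₂ = cross b₁ b₂ + cross b₂ b₃ + cross b₃ b₄ + cross b₄ b₁ := by
    simp only [hB₁, hB₂, cross, Complex.sub_re, Complex.sub_im]; ring
  have hA2 : 0 < A₂ := by linarith
  have hB2 : 0 < B₂ := by linarith
  set s := A₂ / (A₂ - B₁) with hs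
  set t := B₂ / (B₂ - A₁) with ht
  have hWpos : 0 < A₂ - B₁ := by linarith
  have hWpos' : 0 < B₂ - A₁ := by linarith
  have hs0 : 0 < s := by positivity
  have ht0 : 0 < t := by positivity
  have hs1 : s ≤ 1 := by rw [hs, div_le_one hWpos]; linarith
  have ht1 : t ≤ 1 := by rw [ht, div_le_one hWpos']; linarith
  have key : AffineMap.lineMap b₁ b₂ s = AffineMap.lineMap b₄ b₃ t := by
    rw [hs, ht]
    have : (B₂ - A₁) = A₂ - B₁ := by linarith
    rw [this]
    simp only [AffineMap.lineMap_apply, vsub_eq_sub, vadd_eq_add]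
    have hne := hWpos.ne'
    have hne' : ((A₂ - B₁ : ℝ) : ℂ) ≠ 0 := by exact_mod_cast hne
    apply Complex.ext
    · simp only [Complex.real_smul, Complex.add_re, Complex.mul_re, Complex.sub_re, Complex.sub_im,
        Complex.ofReal_re, Complex.ofReal_im]
      field_simp
      simp only [hB₁, hA₂, hB₂, cross, Complex.sub_re, Complex.sub_im]; ring
    · simp only [Complex.real_smul, Complex.add_im, Complex.mul_im, Complex.sub_re, Complex.sub_im,
        Complex.ofReal_re, Complex.ofReal_im]
      field_simp
      simp only [hB₁, hA₂, hB₂, cross, Complex.sub_re, Complex.sub_im]; ring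
  set x : ℂ := AffineMap.lineMap b₁ b₂ s with hx
  have w1 : Wbtw ℝ b₁ x b₂ := ⟨s, ⟨hs0.le, hs1⟩, rfl⟩
  have w2 : Wbtw ℝ b₄ x b₃ := ⟨t, ⟨ht0.le, ht1⟩, key.symm⟩
  have l1 := w1.dist_add_dist
  have l2 := w2.dist_add_dist
  have hp := h.side_condition
  have t1 := dist_triangle b₂ x b₃
  have t2 := dist_triangle b₄ x b₁
  have t3 : dist b₄ x + dist x b₁ = dist b₄ b₁ := by
    rw [dist_comm b₃ b₄, dist_comm b₂ b₃] at hp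
    rw [dist_comm b₂ x, dist_comm b₂ b₃] at t1
    rw [dist_comm b₁ x] at l1
    linarith
  have w3 : Wbtw ℝ b₄ x b₁ := dist_add_dist_eq_iff.mp t3
  obtain ⟨r, -, hr⟩ := w3
  have c1 : cross (x - b₄) (b₁ - b₄) = 0 := by
    rw [← hr, AffineMap.lineMap_apply]
    simp [cross]; ring
  have c2 : cross (x - b₄) (b₁ - b₄) = - (s * B₂) := by
    rw [hx, AffineMap.lineMap_apply]
    simp [cross, hB₂]; ring
  nlinarith [mul_pos hs0 hB2]

theorem IsPitotQuadrilateral.exists_diagonal {b₁ b₂ b₃ b₄ : ℂ}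
    (h : IsPitotQuadrilateral b₁ b₂ b₃ b₄) :
    (0 < cross (b₂ - b₁) (b₃ - b₁) ∧ 0 < cross (b₄ - b₃) (b₁ - b₃)) ∨
    (0 < cross (b₃ - b₂) (b₄ - b₂) ∧ 0 < cross (b₁ - b₄) (b₂ - b₄)) := by
  by_contra hcon
  have h1 := h.not_crossing
  have h2 := h.rotate.not_crossing
  have h3 := h.rotate.rotate.not_crossing
  have h4 := h.rotate.rotate.rotate.not_crossing
  simp only [not_or, not_and_or, not_lt] at hcon
  tauto

/-- `ν`, centred at `c`, is a gauge of the quadrilateral: the polygonal line is the unit sphere of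
the positively homogeneous function `ν`. -/
structure IsGauge (c : ℂ) (ν : ℂ → ℝ) (S : Set ℂ) : Prop where
  continuous : Continuous ν
  homogeneous : ∀ s : ℝ, 0 ≤ s → ∀ y, ν (s * y) = s * ν y
  bound : ∃ M : ℝ, 0 < M ∧ ∀ y, ‖y‖ ≤ M * ν y
  unit_sphere : S = {w | ν (w - c) = 1}

/-- Coordinates in the basis `e, d`. -/
theorem eq_coordinates {e d : ℂ} (h : cross e d ≠ 0) (y : ℂ) :
    y = ((cross y d / cross e d : ℝ) : ℂ) * e + ((cross e y / cross e d : ℝ) : ℂ) * d := by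
  apply Complex.ext
  · simp only [Complex.add_re, Complex.mul_re, Complex.ofReal_re, Complex.ofReal_im]
    field_simp
    simp only [cross]; ring
  · simp only [Complex.add_im, Complex.mul_im, Complex.ofReal_re, Complex.ofReal_im]
    field_simp
    simp only [cross]; ring

theorem continuous_cross_left (d : ℂ) : Continuous fun y => cross y d := by
  unfold cross; fun_prop

theorem continuous_cross_right (d : ℂ) : Continuous fun y => cross d y := by
  unfold cross; fun_prop

/-- The gauge of the triangle with vertices `e, d, -e`. -/
def triangleGauge (e d y : ℂ) : ℝ := |cross y d / cross e d| + cross e y / cross e d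

theorem continuous_triangleGauge (e d : ℂ) : Continuous (triangleGauge e d) :=
  ((continuous_cross_left d).div_const _).abs.add ((continuous_cross_right e).div_const _)

theorem triangleGauge_smul (e d y : ℂ) {s : ℝ} (hs : 0 ≤ s) :
    triangleGauge e d (s * y) = s * triangleGauge e d y := by
  have h1 : cross (s * y) d / cross e d = s * (cross y d / cross e d) := by
    simp [cross]; ring
  have h2 : cross e (s * y) / cross e d = s * (cross e y / cross e d) := by
    simp [cross]; ring
  rw [triangleGauge, h1, h2, abs_mul, abs_of_nonneg hs, triangleGauge]; ring

theorem norm_le_triangleGauge {e d : ℂ} (h : cross e d ≠ 0) {y : ℂ}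
    (hy : 0 ≤ cross e y / cross e d) :
    ‖y‖ ≤ (‖e‖ + ‖d‖) * triangleGauge e d y := by
  conv_lhs => rw [eq_coordinates h y]
  refine (norm_add_le _ _).trans ?_
  rw [norm_mul, norm_mul, Complex.norm_real, Complex.norm_real, Real.norm_eq_abs, Real.norm_eq_abs,
    abs_of_nonneg hy, triangleGauge]
  have := abs_nonneg (cross y d / cross e d)
  nlinarith [norm_nonneg e, norm_nonneg d, mul_nonneg this (norm_nonneg d),
    mul_nonneg hy (norm_nonneg e)]

/-- Two sides of a triangle as part of the unit sphere of its gauge. -/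
theorem mem_sides_iff {e d c : ℂ} (h : cross e d ≠ 0) (w : ℂ) :
    w ∈ segment ℝ (c + e) (c + d) ∪ segment ℝ (c + d) (c - e) ↔
      0 ≤ cross e (w - c) / cross e d ∧ triangleGauge e d (w - c) = 1 := by
  constructor
  · rintro (⟨a, b, ha, hb, hab, rfl⟩ | ⟨a, b, ha, hb, hab, rfl⟩)
    · have e0 : a • (c + e) + b • (c + d) - c = a * e + b * d := by
        have : (a : ℂ) + b = 1 := by exact_mod_cast hab
        simp only [Complex.real_smul]; linear_combination c * this
      have e1 : cross (a * e + b * d) d / cross e d = a := by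
        rw [div_eq_iff h]; simp [cross]; ring
      have e2 : cross e (a * e + b * d) / cross e d = b := by
        rw [div_eq_iff h]; simp [cross]; ring
      rw [e0, triangleGauge, e1, e2, abs_of_nonneg ha]
      exact ⟨hb, hab⟩
    · have e0 : a • (c + d) + b • (c - e) - c = -b * e + a * d := by
        have : (a : ℂ) + b = 1 := by exact_mod_cast hab
        simp only [Complex.real_smul]; linear_combination c * this
      have e1 : cross (-b * e + a * d) d / cross e d = -b := by
        rw [div_eq_iff h]; simp [cross]; ring
      have e2 : cross e (-b * e + a * d) / cross e d = a := by
        rw [div_eq_iff h]; simp [cross]; ring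
      rw [e0, triangleGauge, e1, e2, abs_neg, abs_of_nonneg hb]
      exact ⟨ha, by linarith⟩
  · rintro ⟨h1, h2⟩
    have hw := eq_coordinates h (w - c)
    rw [triangleGauge] at h2
    set s := cross (w - c) d / cross e d
    set t := cross e (w - c) / cross e d
    rcases le_total 0 s with hs | hs
    · rw [abs_of_nonneg hs] at h2
      refine Or.inl ⟨s, t, hs, h1, h2, ?_⟩
      have : (s : ℂ) + t = 1 := by exact_mod_cast h2
      simp only [Complex.real_smul]
      linear_combination c * this - hw
    · rw [abs_of_nonpos hs] at h2
      refine Or.inr ⟨t, -s, h1, by linarith, by linarith, ?_⟩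
      have : -(s : ℂ) + t = 1 := by exact_mod_cast h2
      simp only [Complex.real_smul]
      push_cast
      linear_combination c * this - hw

/-- Two triangles with the common side `[-e, e]`. -/
theorem isGauge_two_triangles {c e d d' : ℂ} (hed : 0 < cross e d) (hed' : cross e d' < 0) :
    IsGauge c (fun y => if 0 ≤ cross e y then triangleGauge e d y else triangleGauge e d' y)
      (quadBoundary (c - e) (c + d') (c + e) (c + d)) := by
  have agree : ∀ y, 0 = cross e y → triangleGauge e d y = triangleGauge e d' y := by
    intro y hy
    have a1 := eq_coordinates hed.ne' y
    rw [triangleGauge, triangleGauge, ← hy, zero_div, zero_div, add_zero, add_zero]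
    rw [← hy, zero_div] at a1
    generalize cross y d / cross e d = s at a1 ⊢
    have : cross y d' / cross e d' = s := by
      rw [a1, div_eq_iff hed'.ne]; simp [cross]; ring
    rw [this]
  refine ⟨?_, ?_, ?_, ?_⟩
  · exact (continuous_triangleGauge e d).if_le (continuous_triangleGauge e d') continuous_const
      (continuous_cross_right e) agree
  · intro s hs y
    have hsy : cross e (s * y) = s * cross e y := by simp [cross]; ring
    rcases hs.eq_or_lt with rfl | hs'
    · simp [triangleGauge, cross]
    · have : 0 ≤ cross e (s * y) ↔ 0 ≤ cross e y := by rw [hsy, mul_nonneg_iff_of_pos_left hs']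
      simp only [this, triangleGauge_smul _ _ _ hs, mul_ite]
  · refine ⟨‖e‖ + ‖d‖ + (‖e‖ + ‖d'‖) + 1, by positivity, fun y => ?_⟩
    split_ifs with hy
    · have h := norm_le_triangleGauge hed.ne' (y := y) (div_nonneg hy hed.le)
      have h0 : 0 ≤ triangleGauge e d y := add_nonneg (abs_nonneg _) (div_nonneg hy hed.le)
      nlinarith [mul_nonneg h0 (norm_nonneg e), mul_nonneg h0 (norm_nonneg d')]
    · push Not at hy
      have h := norm_le_triangleGauge hed'.ne (y := y) (div_nonneg_of_nonpos hy.le hed'.le)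
      have h0 : 0 ≤ triangleGauge e d' y :=
        add_nonneg (abs_nonneg _) (div_nonneg_of_nonpos hy.le hed'.le)
      nlinarith [mul_nonneg h0 (norm_nonneg e), mul_nonneg h0 (norm_nonneg d)]
  · rw [quadBoundary_eq]
    ext w
    have s1 := mem_sides_iff (c := c) hed.ne' w
    have s2 := mem_sides_iff (c := c) hed'.ne w
    rw [le_div_iff₀ hed, zero_mul, Set.mem_union] at s1
    rw [le_div_iff_of_neg hed', zero_mul, Set.mem_union, segment_symm ℝ (c + e) (c + d'), segment_symm ℝ (c + d') (c - e)] at s2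
    have perm : ∀ A B C D : Prop, (((A ∨ B) ∨ C) ∨ D) ↔ ((C ∨ D) ∨ (B ∨ A)) := by tauto
    rw [Set.mem_union, Set.mem_union, Set.mem_union, perm, s1, s2]
    change _ ↔ (if 0 ≤ cross e (w - c) then _ else _) = (1 : ℝ)
    clear s1 s2 perm
    split_ifs with hy
    · constructor
      · rintro (h | h)
        · exact h.2
        · rw [agree _ (le_antisymm hy h.1)]; exact h.2
      · exact fun h => Or.inl ⟨hy, h⟩
    · constructor
      · rintro (h | h)
        · exact absurd h.1 hy
        · exact h.2
      · exact fun h => Or.inr ⟨(not_le.mp hy).le, h⟩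

theorem exists_isGauge_of_diagonal {b₁ b₂ b₃ b₄ : ℂ}
    (h₁ : 0 < cross (b₂ - b₁) (b₃ - b₁)) (h₂ : 0 < cross (b₄ - b₃) (b₁ - b₃)) :
    ∃ c ν, IsGauge c ν (quadBoundary b₁ b₂ b₃ b₄) := by
  have hed : 0 < cross ((b₃ - b₁) / 2) (b₄ - (b₁ + b₃) / 2) := by
    have : cross ((b₃ - b₁) / 2) (b₄ - (b₁ + b₃) / 2) = cross (b₄ - b₃) (b₁ - b₃) / 2 := by
      simp [cross]; ring
    rw [this]; positivity
  have hed' : cross ((b₃ - b₁) / 2) (b₂ - (b₁ + b₃) / 2) < 0 := by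
    have : cross ((b₃ - b₁) / 2) (b₂ - (b₁ + b₃) / 2) = - cross (b₂ - b₁) (b₃ - b₁) / 2 := by
      simp [cross]; ring
    rw [this]; linarith
  have h := isGauge_two_triangles (c := (b₁ + b₃) / 2) hed hed'
  rw [show (b₁ + b₃) / 2 - (b₃ - b₁) / 2 = b₁ by ring,
    show (b₁ + b₃) / 2 + (b₃ - b₁) / 2 = b₃ by ring, add_sub_cancel, add_sub_cancel] at h
  exact ⟨_, _, h⟩

theorem IsPitotQuadrilateral.exists_isGauge {b₁ b₂ b₃ b₄ : ℂ}
    (h : IsPitotQuadrilateral b₁ b₂ b₃ b₄) : ∃ c ν, IsGauge c ν (quadBoundary b₁ b₂ b₃ b₄) := by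
  rcases h.exists_diagonal with h' | h'
  · exact exists_isGauge_of_diagonal h'.1 h'.2
  · rw [← quadBoundary_rotate]
    exact exists_isGauge_of_diagonal h'.1 h'.2

/-- The last two open sides avoid the other closed sides. -/
theorem openSegment_disjoint_of_diagonal {b₁ b₂ b₃ b₄ : ℂ}
    (h₁ : 0 < cross (b₂ - b₁) (b₃ - b₁)) (h₂ : 0 < cross (b₄ - b₃) (b₁ - b₃)) :
    (∀ w ∈ openSegment ℝ b₃ b₄,
      w ∉ segment ℝ b₁ b₂ ∧ w ∉ segment ℝ b₂ b₃ ∧ w ∉ segment ℝ b₄ b₁) ∧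
    (∀ w ∈ openSegment ℝ b₄ b₁,
      w ∉ segment ℝ b₁ b₂ ∧ w ∉ segment ℝ b₂ b₃ ∧ w ∉ segment ℝ b₃ b₄) := by
  have f1 : ∀ w ∈ segment ℝ b₁ b₂, cross (b₃ - b₁) (w - b₁) ≤ 0 := by
    rintro _ ⟨s, t, hs, ht, hst, rfl⟩
    have : cross (b₃ - b₁) (s • b₁ + t • b₂ - b₁) = - t * cross (b₂ - b₁) (b₃ - b₁) := by
      obtain rfl : s = 1 - t := by linarith
      simp [cross]; ring
    rw [this]; nlinarith
  have f2 : ∀ w ∈ segment ℝ b₂ b₃, cross (b₃ - b₁) (w - b₁) ≤ 0 := by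
    rintro _ ⟨s, t, hs, ht, hst, rfl⟩
    have : cross (b₃ - b₁) (s • b₂ + t • b₃ - b₁) = - s * cross (b₂ - b₁) (b₃ - b₁) := by
      obtain rfl : s = 1 - t := by linarith
      simp [cross]; ring
    rw [this]; nlinarith
  have g3 : ∀ s t : ℝ, s + t = 1 →
      cross (b₃ - b₁) (s • b₃ + t • b₄ - b₁) = t * cross (b₄ - b₃) (b₁ - b₃) := by
    intro s t hst
    obtain rfl : s = 1 - t := by linarith
    simp [cross]; ring
  have g4 : ∀ s t : ℝ, s + t = 1 →
      cross (b₃ - b₁) (s • b₄ + t • b₁ - b₁) = s * cross (b₄ - b₃) (b₁ - b₃) := by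
    intro s t hst
    obtain rfl : s = 1 - t := by linarith
    simp [cross]; ring
  have k3 : ∀ s t : ℝ, s + t = 1 →
      cross (s • b₃ + t • b₄ - b₁) (b₄ - b₁) = s * cross (b₄ - b₃) (b₁ - b₃) := by
    intro s t hst
    obtain rfl : s = 1 - t := by linarith
    simp [cross]; ring
  have k4 : ∀ s t : ℝ, s + t = 1 →
      cross (s • b₄ + t • b₁ - b₁) (b₄ - b₁) = 0 := by
    intro s t hst
    obtain rfl : s = 1 - t := by linarith
    simp [cross]; ring
  have k5 : ∀ s t : ℝ, s + t = 1 →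
      cross (s • b₄ + t • b₁ - b₃) (b₄ - b₃) = - t * cross (b₄ - b₃) (b₁ - b₃) := by
    intro s t hst
    obtain rfl : s = 1 - t := by linarith
    simp [cross]; ring
  have k6 : ∀ s t : ℝ, s + t = 1 →
      cross (s • b₃ + t • b₄ - b₃) (b₄ - b₃) = 0 := by
    intro s t hst
    obtain rfl : s = 1 - t := by linarith
    simp [cross]; ring
  constructor
  · rintro w ⟨s, t, hs, ht, hst, rfl⟩
    have p1 := g3 s t hst
    have p2 := mul_pos ht h₂
    refine ⟨fun h => ?_, fun h => ?_, ?_⟩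
    · linarith [f1 _ h]
    · linarith [f2 _ h]
    · rintro ⟨s', t', hs', ht', hst', he⟩
      have p3 := k4 s' t' hst'
      rw [he, k3 s t hst] at p3
      exact (mul_pos hs h₂).ne' p3
  · rintro w ⟨s, t, hs, ht, hst, rfl⟩
    have p1 := g4 s t hst
    have p2 := mul_pos hs h₂
    refine ⟨fun h => ?_, fun h => ?_, ?_⟩
    · linarith [f1 _ h]
    · linarith [f2 _ h]
    · rintro ⟨s', t', hs', ht', hst', he⟩
      have p3 := k6 s' t' hst'
      rw [he, k5 s t hst] at p3
      nlinarith [mul_pos ht h₂]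

theorem IsPitotQuadrilateral.openSegment_disjoint {b₁ b₂ b₃ b₄ : ℂ}
    (h : IsPitotQuadrilateral b₁ b₂ b₃ b₄) :
    ∀ w ∈ openSegment ℝ b₄ b₁,
      w ∉ segment ℝ b₁ b₂ ∧ w ∉ segment ℝ b₂ b₃ ∧ w ∉ segment ℝ b₃ b₄ := by
  rcases h.exists_diagonal with h' | h'
  · exact (openSegment_disjoint_of_diagonal h'.1 h'.2).2
  · have := (openSegment_disjoint_of_diagonal h'.1 h'.2).1
    intro w hw
    have := this w hw
    tauto

namespace IsGauge

variable {c : ℂ} {ν : ℂ → ℝ} {b₁ b₂ b₃ b₄ : ℂ} {S : Set ℂ}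

theorem zero (h : IsGauge c ν S) : ν 0 = 0 := by
  simpa using h.homogeneous 0 le_rfl 0

theorem nonneg (h : IsGauge c ν S) (y : ℂ) : 0 ≤ ν y := by
  obtain ⟨M, hM, hb⟩ := h.bound
  exact nonneg_of_mul_nonneg_right ((norm_nonneg y).trans (hb y)) hM

theorem isBounded (h : IsGauge c ν S) : Bornology.IsBounded {w | ν (w - c) < 1} := by
  obtain ⟨M, hM, hb⟩ := h.bound
  refine (Metric.isBounded_closedBall (x := c) (r := M)).subset fun w hw => ?_
  rw [Metric.mem_closedBall, dist_eq_norm]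
  have : ν (w - c) < 1 := hw
  nlinarith [hb (w - c)]

theorem isOpen_inner (h : IsGauge c ν S) : IsOpen {w | ν (w - c) < 1} :=
  isOpen_lt (h.continuous.comp (by fun_prop)) continuous_const

theorem starConvex (h : IsGauge c ν S) : StarConvex ℝ c {w | ν (w - c) < 1} := by
  intro w hw a b ha hb hab
  have e : a • c + b • w - c = b * (w - c) := by
    have : (a : ℂ) + b = 1 := by exact_mod_cast hab
    simp only [Complex.real_smul]; linear_combination c * this
  change ν _ < 1
  rw [e, h.homogeneous b hb]
  have : ν (w - c) < 1 := hw
  have h0 := h.nonneg (w - c)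
  nlinarith

theorem center_mem (h : IsGauge c ν S) : c ∈ {w | ν (w - c) < 1} := by
  simp [h.zero]

/-- A set containing the outer ray through each of its points is unbounded. -/
theorem not_isBounded_of_ray (h : IsGauge c ν S) {w : ℂ} (hw : 1 < ν (w - c)) {K : Set ℂ}
    (hK : ∀ s : ℝ, 1 ≤ s → c + s * (w - c) ∈ K) : ¬ Bornology.IsBounded K := by
  intro hb
  have hne : w - c ≠ 0 := by
    intro h0
    rw [h0, h.zero] at hw
    linarith
  have hpos : 0 < ‖w - c‖ := norm_pos_iff.mpr hne
  obtain ⟨R, hR⟩ := hb.subset_closedBall c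
  have hm := hR (hK (max 1 ((R + 1) / ‖w - c‖)) (le_max_left _ _))
  rw [Metric.mem_closedBall, dist_eq_norm, add_sub_cancel_left, norm_mul, Complex.norm_real,
    Real.norm_eq_abs] at hm
  have h1 := le_max_right 1 ((R + 1) / ‖w - c‖)
  have h2 := le_abs_self (max 1 ((R + 1) / ‖w - c‖))
  have h3 : (R + 1) / ‖w - c‖ * ‖w - c‖ = R + 1 := by field_simp
  nlinarith

theorem isPreconnected_ray (w : ℂ) :
    IsPreconnected ((fun s : ℝ => c + s * (w - c)) '' Set.Ici 1) :=
  isPreconnected_Ici.image _ (by fun_prop)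

theorem quadRegion_eq (h : IsGauge c ν (quadBoundary b₁ b₂ b₃ b₄)) :
    quadRegion b₁ b₂ b₃ b₄ = {w | ν (w - c) < 1} := by
  have hcont : Continuous fun w => ν (w - c) := h.continuous.comp (by fun_prop)
  ext w
  rw [quadRegion, Set.mem_ofPred_eq, Set.mem_ofPred_eq]
  generalize hS : quadBoundary b₁ b₂ b₃ b₄ = S at h
  have hmem : ∀ x, x ∈ Sᶜ ↔ ν (x - c) ≠ 1 := by
    intro x; rw [h.unit_sphere]; rfl
  constructor
  · rintro ⟨hw, hb⟩
    by_contra hn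
    have hw1 : 1 < ν (w - c) := lt_of_le_of_ne (not_lt.mp hn) ((hmem w).1 hw).symm
    refine h.not_isBounded_of_ray hw1 (K := connectedComponentIn Sᶜ w) ?_ hb
    have hsub := (isPreconnected_ray (c := c) w).subset_connectedComponentIn
      (x := w) (F := Sᶜ) ⟨1, by simp, by simp⟩ (by
        rintro _ ⟨s, hs, rfl⟩
        rw [hmem]
        have hs' : (1 : ℝ) ≤ s := hs
        simp only [add_sub_cancel_left]
        rw [h.homogeneous s (by linarith)]
        nlinarith)
    exact fun s hs => hsub ⟨s, hs, rfl⟩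
  · intro hw
    have hwS : w ∈ Sᶜ := (hmem w).2 hw.ne
    refine ⟨hwS, h.isBounded.subset fun x hx => ?_⟩
    by_contra hn
    have hpre : IsPreconnected (connectedComponentIn Sᶜ w) := isPreconnected_connectedComponentIn
    obtain ⟨y, hy, hy1⟩ := hpre.intermediate_value (mem_connectedComponentIn hwS) hx
      hcont.continuousOn ⟨le_of_lt hw, not_lt.mp hn⟩
    exact (hmem y).1 (connectedComponentIn_subset _ _ hy) hy1

end IsGauge

/-! ### Proper local homeomorphisms onto star-shaped domains -/

theorem bijective_of_isCoveringMap {E X : Type*} [TopologicalSpace E] [TopologicalSpace X]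
    [ConnectedSpace E] [SimplyConnectedSpace X] [LocallyPathConnectedSpace X]
    {p : E → X} (hp : IsCoveringMap p) : Function.Bijective p := by
  obtain ⟨e₀⟩ : Nonempty E := inferInstance
  obtain ⟨F, ⟨hF0, hF⟩, -⟩ := hp.existsUnique_continuousMap_lifts (ContinuousMap.id X) (p e₀) e₀ rfl
  have hpF : ∀ x, p (F x) = x := fun x => congrFun hF x
  have hFp : F ∘ p = id := hp.eq_of_comp_eq (F.continuous.comp hp.continuous) continuous_id
    (by ext x; simp [hpF]) e₀ hF0
  exact ⟨Function.LeftInverse.injective (g := F) fun x => congrFun hFp x, fun x => ⟨F x, hpF x⟩⟩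

theorem isCoveringMap_of_isProperMap {E X : Type*} [TopologicalSpace E] [TopologicalSpace X]
    [T2Space E] {p : E → X} (h : IsLocalHomeomorph p) (hp : IsProperMap p) :
    IsCoveringMap p := by
  rw [isCoveringMap_iff_isCoveringMapOn_univ]
  refine hp.isClosedMap.isCoveringMapOn_of_isLocalHomeomorphOn (fun x _ => ?_) ?_
  · refine (hp.isCompact_preimage isCompact_singleton).finite
      (.of_openPartialHomeomorph p subset_rfl fun e _ => ?_)
    obtain ⟨φ, hφ, hφ'⟩ := h e
    exact ⟨φ, hφ, hφ'.symm⟩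
  · simpa [← isLocalHomeomorph_iff_isLocalHomeomorphOn_univ] using h

/-- A local homeomorphism of an open connected set into a star-shaped open set with compact
preimages of compact sets is bijective. -/
theorem bijOn_of_local_homeomorph {f : ℂ → ℂ} {D Q : Set ℂ} {c : ℂ} (hD : IsOpen D)
    (hDc : IsConnected D) (hQ : IsOpen Q) (hQs : StarConvex ℝ c Q) (hQn : Q.Nonempty)
    (hmaps : Set.MapsTo f D Q) (hloc : IsLocalHomeomorphOn f D)
    (hprop : ∀ K ⊆ Q, IsCompact K → IsCompact (D ∩ f ⁻¹' K)) : Set.BijOn f D Q := by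
  have : ConnectedSpace D := isConnected_iff_connectedSpace.mp hDc
  have : ContractibleSpace Q := hQs.contractibleSpace hQn
  have : LocallyPathConnectedSpace Q := hQ.locallyPathConnectedSpace
  have : LocallyCompactSpace Q := hQ.locallyCompactSpace
  set p : D → Q := hmaps.restrict f D Q with hpdef
  have hcont : Continuous p := hloc.continuousOn.mapsToRestrict hmaps
  have hlocp : IsLocalHomeomorph p := by
    have h1 : IsLocalHomeomorph ((↑) : Q → ℂ) := hQ.isOpenEmbedding_subtypeVal.isLocalHomeomorph
    have h2 : IsLocalHomeomorph (((↑) : Q → ℂ) ∘ p) := by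
      have : ((↑) : Q → ℂ) ∘ p = f ∘ ((↑) : D → ℂ) := by ext x; rfl
      rw [this, isLocalHomeomorph_iff_isLocalHomeomorphOn_univ]
      exact hloc.comp (hD.isOpenEmbedding_subtypeVal.isLocalHomeomorph.isLocalHomeomorphOn)
        (fun x _ => x.2)
    exact h2.of_comp h1 hcont
  have hprp : IsProperMap p := by
    rw [isProperMap_iff_isCompact_preimage]
    refine ⟨hcont, fun K hK => ?_⟩
    have hK' : IsCompact ((↑) '' K : Set ℂ) := hK.image continuous_subtype_val
    have h3 := hprop _ (by rintro _ ⟨x, -, rfl⟩; exact x.2) hK'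
    rw [Subtype.isCompact_iff]
    convert h3 using 1
    ext x
    constructor
    · rintro ⟨y, hy, rfl⟩
      exact ⟨y.2, ⟨p y, hy, rfl⟩⟩
    · rintro ⟨hx, y, hy, hxy⟩
      refine ⟨⟨x, hx⟩, ?_, rfl⟩
      have : p ⟨x, hx⟩ = y := Subtype.ext hxy.symm
      rw [Set.mem_preimage, this]; exact hy
  have hb := bijective_of_isCoveringMap (isCoveringMap_of_isProperMap hlocp hprp)
  refine ⟨hmaps, fun x hx y hy hxy => ?_, fun w hw => ?_⟩
  · exact congrArg Subtype.val (hb.1 (a₁ := ⟨x, hx⟩) (a₂ := ⟨y, hy⟩) (Subtype.ext hxy))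
  · obtain ⟨x, hx⟩ := hb.2 ⟨w, hw⟩
    exact ⟨x, x.2, congrArg Subtype.val hx⟩

/-- If `f` is open on `D`, bounded, and tends to the unit sphere of a gauge at the frontier of
`D`, then `f` maps into the unit ball of the gauge and is proper. -/
theorem IsGauge.bijOn {c : ℂ} {ν : ℂ → ℝ} {S : Set ℂ} (h : IsGauge c ν S) {f : ℂ → ℂ} {D : Set ℂ}
    (hD : IsOpen D) (hDc : IsConnected D) (hDb : Bornology.IsBounded D)
    (hloc : IsLocalHomeomorphOn f D)
    (hb : Bornology.IsBounded (f '' D))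
    (hfr : ∀ z ∈ frontier D, Filter.Tendsto (fun x => Metric.infDist (f x) S) (𝓝[D] z) (𝓝 0)) :
    Set.BijOn f D {w | ν (w - c) < 1} := by
  have hν : Continuous fun w => ν (w - c) := h.continuous.comp (by fun_prop)
  have hSc : IsClosed S := by
    rw [h.unit_sphere]; exact isClosed_eq hν continuous_const
  have hSn : S.Nonempty := by
    have h1 : ν 1 ≠ 0 := by
      obtain ⟨M, hM, hb⟩ := h.bound
      intro h0
      have := hb 1
      rw [h0] at this
      norm_num at this
    refine ⟨c + ((ν 1)⁻¹ : ℝ) * 1, ?_⟩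
    rw [h.unit_sphere]
    change ν _ = 1
    rw [add_sub_cancel_left, h.homogeneous _ (inv_nonneg.mpr (h.nonneg 1)), inv_mul_cancel₀ h1]
  -- limits of preimages
  have hclosed : ∀ z ∈ closure D, ∀ w, w ∉ S →
      (∃ u : Filter ℂ, u.NeBot ∧ u ≤ 𝓝[D] z ∧ Filter.Tendsto f u (𝓝 w)) → z ∈ D ∧ f z = w := by
    rintro z hz w hw ⟨u, hu, hle, hlim⟩
    by_cases hzD : z ∈ D
    · refine ⟨hzD, ?_⟩
      have : Filter.Tendsto f u (𝓝 (f z)) :=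
        ((hloc.continuousOn z hzD).tendsto).mono_left hle
      exact tendsto_nhds_unique this hlim
    · exfalso
      have h1 := (hfr z ⟨hz, by rwa [hD.interior_eq]⟩).mono_left hle
      have h2 : Filter.Tendsto (fun x => Metric.infDist (f x) S) u (𝓝 (Metric.infDist w S)) :=
        ((Metric.continuous_infDist_pt S).tendsto w).comp hlim
      have h3 := tendsto_nhds_unique h1 h2
      exact hw ((hSc.mem_iff_infDist_zero hSn).mpr h3.symm)
  have hopen : IsOpen (f '' D) := by
    rw [isOpen_iff_mem_nhds]
    rintro _ ⟨z, hz, rfl⟩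
    rw [← hloc.map_nhds_eq hz]
    exact Filter.image_mem_map (hD.mem_nhds hz)
  -- the image is relatively closed off `S`
  have hrel : ∀ w ∈ closure (f '' D), w ∉ S → w ∈ f '' D := by
    intro w hw hwS
    have hne : (Filter.comap f (𝓝 w) ⊓ Filter.principal D).NeBot := by
      rw [mem_closure_iff_clusterPt, ClusterPt] at hw
      have : Filter.map f (Filter.comap f (𝓝 w) ⊓ Filter.principal D) =
          𝓝 w ⊓ Filter.principal (f '' D) := by
        rw [← Filter.map_principal, inf_comm, inf_comm (𝓝 w), Filter.push_pull]
      rw [← this] at hw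
      exact hw.of_map
    have hcpt : IsCompact (closure D) := hDb.isCompact_closure
    obtain ⟨z, hz, hzc⟩ := hcpt.exists_clusterPt
      (f := Filter.comap f (𝓝 w) ⊓ Filter.principal D)
      (inf_le_right.trans (Filter.principal_mono.mpr subset_closure))
    have := hclosed z hz w hwS ⟨𝓝 z ⊓ (Filter.comap f (𝓝 w) ⊓ Filter.principal D), hzc,
      inf_le_inf_left _ inf_le_right,
      Filter.tendsto_comap.mono_left (inf_le_right.trans inf_le_left)⟩
    exact ⟨z, this.1, this.2⟩
  have hno : ∀ w ∈ f '' D, ¬ 1 < ν (w - c) := by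
    intro w hw hgt
    have hray := isPreconnected_ray (c := c) w
    have hout : ∀ s : ℝ, 1 ≤ s → c + s * (w - c) ∉ S := by
      intro s hs hmem
      rw [h.unit_sphere] at hmem
      have : ν (c + s * (w - c) - c) = 1 := hmem
      rw [add_sub_cancel_left, h.homogeneous s (by linarith)] at this
      nlinarith
    have hsub : ((fun s : ℝ => c + s * (w - c)) '' Set.Ici 1) ⊆ f '' D := by
      refine hray.subset_of_closure_inter_subset hopen ⟨w, ⟨1, by simp, by simp⟩, hw⟩ ?_
      rintro x ⟨hx, s, hs, rfl⟩
      exact hrel _ hx (hout s hs)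
    exact h.not_isBounded_of_ray hgt (fun s hs => hsub ⟨s, hs, rfl⟩) hb
  have hmaps : Set.MapsTo f D {w | ν (w - c) < 1} := by
    intro z hz
    refine lt_of_le_of_ne (not_lt.mp (hno _ ⟨z, hz, rfl⟩)) fun heq => ?_
    have hcts : Filter.Tendsto (fun s : ℝ => c + s * (f z - c)) (𝓝[>] 1) (𝓝 (f z)) := by
      have : Continuous fun s : ℝ => c + s * (f z - c) := by fun_prop
      have h2 := (this.tendsto 1).mono_left (nhdsWithin_le_nhds (s := Set.Ioi 1))
      simpa using h2
    have hev := hcts.eventually_mem (hopen.mem_nhds ⟨z, hz, rfl⟩)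
    obtain ⟨s, hs1, hs2⟩ := (hev.and self_mem_nhdsWithin).exists
    have hs2' : (1 : ℝ) < s := hs2
    refine hno _ hs1 ?_
    rw [add_sub_cancel_left, h.homogeneous s (by linarith), heq]
    linarith
  refine bijOn_of_local_homeomorph hD hDc h.isOpen_inner h.starConvex ⟨c, h.center_mem⟩ hmaps hloc
    fun K hK hKc => ?_
  refine Metric.isCompact_of_isClosed_isBounded ?_ (hDb.subset Set.inter_subset_left)
  rw [isClosed_iff_clusterPt]
  intro z hz
  have hzD : z ∈ closure D := by
    rw [mem_closure_iff_clusterPt]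
    exact hz.mono (Filter.principal_mono.mpr Set.inter_subset_left)
  have := hz.neBot.map f
  obtain ⟨w, hwK, hwc⟩ := hKc.exists_clusterPt (f := Filter.map f
    (𝓝 z ⊓ Filter.principal (D ∩ f ⁻¹' K))) (by
      rw [Filter.le_principal_iff, Filter.mem_map]
      exact Filter.mem_inf_of_right (by simp [Set.inter_subset_right]))
  have hwS : w ∉ S := by
    intro hw
    rw [h.unit_sphere] at hw
    exact (ne_of_lt (hK hwK)) hw
  have hne : (Filter.comap f (𝓝 w) ⊓ (𝓝 z ⊓ Filter.principal (D ∩ f ⁻¹' K))).NeBot := by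
    have e : Filter.map f (Filter.comap f (𝓝 w) ⊓ (𝓝 z ⊓ Filter.principal (D ∩ f ⁻¹' K))) =
        𝓝 w ⊓ Filter.map f (𝓝 z ⊓ Filter.principal (D ∩ f ⁻¹' K)) := by
      rw [inf_comm, inf_comm (𝓝 w), Filter.push_pull]
    rw [ClusterPt, ← e] at hwc
    exact hwc.of_map
  have := hclosed z hzD w hwS ⟨_, hne, inf_le_right.trans (inf_le_inf_left _
    (Filter.principal_mono.mpr Set.inter_subset_left)), Filter.tendsto_comap.mono_left inf_le_left⟩
  exact ⟨this.1, by rw [Set.mem_preimage, this.2]; exact hwK⟩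

/-! ### The Möbius automorphism attached to a Pitot quadrilateral -/

theorem cross_mul_normSq (x y e : ℂ) :
    cross x y * Complex.normSq e =
      cross x e * (e.re * y.re + e.im * y.im) - cross y e * (e.re * x.re + e.im * x.im) := by
  simp only [cross, Complex.normSq_apply]; ring

theorem cross_eq_zero_of_norm_add {x y : ℂ} (h : ‖x + y‖ = ‖x‖ + ‖y‖) : cross x y = 0 := by
  have h1 : ‖x + y‖ ^ 2 = (‖x‖ + ‖y‖) ^ 2 := by rw [h]
  have hx := Complex.sq_norm x
  have hy := Complex.sq_norm y
  rw [Complex.sq_norm] at h1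
  simp only [Complex.normSq_apply, Complex.add_re, Complex.add_im] at h1 hx hy
  have h2 : x.re * y.re + x.im * y.im = ‖x‖ * ‖y‖ := by nlinarith
  have h3 : cross x y ^ 2 = 0 := by
    have : cross x y ^ 2 = (x.re * x.re + x.im * x.im) * (y.re * y.re + y.im * y.im)
      - (x.re * y.re + x.im * y.im) ^ 2 := by simp only [cross]; ring
    rw [this, h2, ← hx, ← hy]; ring
  exact pow_eq_zero_iff (two_ne_zero) |>.mp h3

theorem norm_add_lt_of_area_pos {d₀ d₁ d₂ d₃ : ℂ} (hsum : d₀ + d₁ + d₂ + d₃ = 0)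
    (hpit : ‖d₀‖ + ‖d₂‖ = ‖d₁‖ + ‖d₃‖) (harea : 0 < cross (d₂ + d₃) (d₃ + d₀)) :
    ‖d₀ + d₂‖ < ‖d₀‖ + ‖d₂‖ := by
  refine lt_of_le_of_ne (norm_add_le _ _) fun h => ?_
  have h13 : d₁ + d₃ = -(d₀ + d₂) := by linear_combination hsum
  have h' : ‖d₁ + d₃‖ = ‖d₁‖ + ‖d₃‖ := by rw [h13, norm_neg, h, hpit]
  have c02 := cross_eq_zero_of_norm_add h
  have c13 := cross_eq_zero_of_norm_add h'
  set e := d₀ + d₂ with he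
  have c0 : cross d₀ e = 0 := by
    have : cross d₀ e = cross d₀ d₂ := by simp [he, cross]; ring
    rw [this, c02]
  have c2 : cross d₂ e = 0 := by
    have : cross d₂ e = - cross d₀ d₂ := by simp [he, cross]; ring
    rw [this, c02, neg_zero]
  have c3 : cross d₃ e = 0 := by
    have e' : e = -(d₁ + d₃) := by rw [h13, neg_neg]
    have : cross d₃ e = cross d₁ d₃ := by rw [e']; simp [cross]; ring
    rw [this, c13]
  have key := cross_mul_normSq (d₂ + d₃) (d₃ + d₀) e
  have k1 : cross (d₂ + d₃) e = cross d₂ e + cross d₃ e := by simp [cross]; ring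
  have k2 : cross (d₃ + d₀) e = cross d₃ e + cross d₀ e := by simp [cross]; ring
  rw [k1, k2, c0, c2, c3] at key
  have hne : e ≠ 0 := by
    intro h0
    rw [h0, norm_zero] at h
    have n0 : d₀ = 0 := norm_eq_zero.mp (by linarith [norm_nonneg d₀, norm_nonneg d₂])
    have n1 : d₁ = 0 := norm_eq_zero.mp (by linarith [norm_nonneg d₁, norm_nonneg d₃])
    have n2 : d₂ = 0 := norm_eq_zero.mp (by linarith [norm_nonneg d₀, norm_nonneg d₂])
    have n3 : d₃ = 0 := norm_eq_zero.mp (by linarith [norm_nonneg d₁, norm_nonneg d₃])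
    simp [n0, n2, n3, cross] at harea
  have := mul_pos harea (Complex.normSq_pos.mpr hne)
  linarith

/-- Two chords of the unit circle through a common point `K`: the sign of their crossing is
determined by the area of the quadrilateral. -/
theorem cross_pos_of_chords {l₀ l₁ l₂ l₃ : ℝ} {K x y : ℂ}
    (h0 : 0 < l₀) (h1 : 0 < l₁) (h2 : 0 < l₂) (h3 : 0 < l₃)
    (hx : l₀ * Complex.normSq x = l₂ * (1 - Complex.normSq K))
    (hx2 : 2 * l₂ * (K.re * x.re + K.im * x.im) = (l₀ - l₂) * Complex.normSq x)
    (hy : l₁ * Complex.normSq y = l₃ * (1 - Complex.normSq K))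
    (hy2 : 2 * l₃ * (K.re * y.re + K.im * y.im) = (l₁ - l₃) * Complex.normSq y)
    (hK : 0 < 1 - Complex.normSq K)
    (hA : 0 < l₀ * (l₃ - l₁) * cross K x + l₁ * (l₀ - l₂) * cross K y
      + 2 * l₀ * l₁ * cross x y) : 0 < cross x y := by
  have hxp : 0 < Complex.normSq x := by
    have : 0 < l₀ * Complex.normSq x := by rw [hx]; positivity
    exact pos_of_mul_pos_right this h0.le
  have hyp : 0 < Complex.normSq y := by
    have : 0 < l₁ * Complex.normSq y := by rw [hy]; positivity
    exact pos_of_mul_pos_right this h1.le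
  have lag : (K.re * x.re + K.im * x.im) * cross K y - (K.re * y.re + K.im * y.im) * cross K x
      = Complex.normSq K * cross x y := by
    simp only [cross, Complex.normSq_apply]; ring
  have key : (l₀ * (l₃ - l₁) * cross K x + l₁ * (l₀ - l₂) * cross K y
      + 2 * l₀ * l₁ * cross x y) * (Complex.normSq x * Complex.normSq y)
      = 2 * l₂ * l₃ * (1 - Complex.normSq K) * cross x y := by
    set κ := Complex.normSq K
    set X := Complex.normSq x
    set Y := Complex.normSq y
    linear_combination (l₀ * X * cross K x) * hy2 + (l₁ * Y * cross K y) * (-hx2)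
      + (-2 * l₃ * (K.re * y.re + K.im * y.im) * cross K x + 2 * l₁ * Y * cross x y) * hx
      + (2 * l₂ * (K.re * x.re + K.im * x.im) * cross K y + 2 * l₂ * (1 - κ) * cross x y) * hy
      + 2 * l₂ * l₃ * (1 - κ) * lag
  have hpos := mul_pos hA (mul_pos hxp hyp)
  rw [key] at hpos
  exact pos_of_mul_pos_right hpos (by positivity)

theorem conj_eq_inv_of_norm_eq_one {z : ℂ} (h : ‖z‖ = 1) : z * conj z = 1 := by
  rw [Complex.mul_conj, Complex.normSq_eq_norm_sq, h]; simp

/-- The disk automorphism `w ↦ (w - c) / (1 - w conj c)`. -/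
def blaschke (c w : ℂ) : ℂ := (w - c) / (1 - w * conj c)

theorem one_sub_mul_conj_ne_zero {c w : ℂ} (hc : ‖c‖ < 1) (hw : ‖w‖ ≤ 1) : 1 - w * conj c ≠ 0 := by
  intro h
  have h1 : w * conj c = 1 := by linear_combination -h
  have h2 : ‖w‖ * ‖c‖ = 1 := by
    rw [← RCLike.norm_conj c, ← norm_mul, h1, norm_one]
  nlinarith [norm_nonneg w, norm_nonneg c]

theorem norm_blaschke {c w : ℂ} (hc : ‖c‖ < 1) (hw : ‖w‖ = 1) : ‖blaschke c w‖ = 1 := by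
  have hne := one_sub_mul_conj_ne_zero hc hw.le
  have e : 1 - w * conj c = w * conj (w - c) := by
    rw [map_sub]; linear_combination -(conj_eq_inv_of_norm_eq_one hw)
  have : ‖1 - w * conj c‖ = ‖w - c‖ := by
    rw [e, norm_mul, hw, one_mul, RCLike.norm_conj]
  rw [blaschke, norm_div, this, div_self]
  rw [← this]; exact norm_ne_zero_iff.mpr hne

theorem blaschke_antipodal {c K w w' : ℂ} {l l' : ℝ} (hc : ‖c‖ < 1) (hw : ‖w‖ = 1) (hw' : ‖w'‖ = 1)
    (hl : 0 < l + l') (hK : (l + l' : ℂ) * K = l * w + l' * w')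
    (hcK : (1 + c * conj c) * K = 2 * c) : blaschke c w' = - blaschke c w := by
  have hne := one_sub_mul_conj_ne_zero hc hw.le
  have hne' := one_sub_mul_conj_ne_zero hc hw'.le
  have u := conj_eq_inv_of_norm_eq_one hw
  have u' := conj_eq_inv_of_norm_eq_one hw'
  have hK2 : (l + l' : ℂ) * conj K = l * conj w + l' * conj w' := by
    have := congrArg conj hK
    simpa using this
  have hcK2 : (1 + c * conj c) * conj K = 2 * conj c := by
    have := congrArg conj hcK
    simp only [map_mul, map_add, map_one, Complex.conj_conj, map_ofNat] at this
    linear_combination this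
  have hS : (l + l' : ℂ) ≠ 0 := by exact_mod_cast hl.ne'
  have chord : w + w' = K + conj K * (w * w') := by
    apply mul_left_cancel₀ hS
    linear_combination -hK - (w * w') * hK2 - l * w' * u - l' * w * u'
  rw [blaschke, blaschke, ← neg_div, div_eq_div_iff hne' hne]
  linear_combination (1 + c * conj c) * chord + hcK + (w * w') * hcK2

theorem cross_blaschke {c K w w' : ℂ} (hc : ‖c‖ < 1) (hw : ‖w‖ = 1) (hw' : ‖w'‖ = 1)
    (hcK : (1 + c * conj c) * K = 2 * c) (h : 0 < cross (w - K) (w' - K)) :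
    0 < (blaschke c w' * conj (blaschke c w)).im := by
  have hne := one_sub_mul_conj_ne_zero hc hw.le
  have hne' := one_sub_mul_conj_ne_zero hc hw'.le
  set n : ℂ → ℂ := fun v => (v - c) * (1 - c * conj v) with hn
  have hb : ∀ v, 1 - v * conj c ≠ 0 →
      blaschke c v = ((Complex.normSq (1 - v * conj c))⁻¹ : ℝ) * n v := by
    intro v hv
    have e : conj (1 - v * conj c) = 1 - c * conj v := by simp [mul_comm]
    have : (Complex.normSq (1 - v * conj c) : ℂ) = (1 - v * conj c) * (1 - c * conj v) := by
      rw [← e, Complex.mul_conj]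
    have hv' : 1 - c * conj v ≠ 0 := by rw [← e]; exact (map_ne_zero _).mpr hv
    rw [Complex.ofReal_inv, this, blaschke, hn]
    field_simp
  have hL : ∀ v, v * conj v = 1 → n v = (v - K) + c ^ 2 * conj (v - K) := by
    intro v hv
    have hcK2 : (1 + c * conj c) * conj K = 2 * conj c := by
      have := congrArg conj hcK
      simp only [map_mul, map_add, map_one, Complex.conj_conj, map_ofNat] at this
      linear_combination this
    have h1 : (1 + c * conj c) ≠ 0 := by
      rw [Complex.mul_conj, Complex.normSq_eq_norm_sq]
      norm_cast
      positivity
    have h2 : K + c ^ 2 * conj K = 2 * c := by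
      apply mul_left_cancel₀ h1
      linear_combination hcK + c ^ 2 * hcK2
    simp only [hn, map_sub]
    linear_combination -c * hv + h2
  rw [hb w hne, hb w' hne', hL w (conj_eq_inv_of_norm_eq_one hw),
    hL w' (conj_eq_inv_of_norm_eq_one hw')]
  have p1 : 0 < (Complex.normSq (1 - w * conj c))⁻¹ := inv_pos.mpr (Complex.normSq_pos.mpr hne)
  have p2 : 0 < (Complex.normSq (1 - w' * conj c))⁻¹ := inv_pos.mpr (Complex.normSq_pos.mpr hne')
  have p3 : 0 < 1 - Complex.normSq c ^ 2 := by
    rw [Complex.normSq_eq_norm_sq]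
    nlinarith [norm_nonneg c, sq_nonneg ‖c‖, pow_le_one₀ (n := 2) (norm_nonneg c) hc.le,
      pow_lt_one₀ (norm_nonneg c) hc (two_ne_zero)]
  generalize (Complex.normSq (1 - w * conj c))⁻¹ = r at *
  generalize (Complex.normSq (1 - w' * conj c))⁻¹ = r' at *
  have : ((r' : ℂ) * ((w' - K) + c ^ 2 * conj (w' - K)) *
      conj ((r : ℂ) * ((w - K) + c ^ 2 * conj (w - K)))).im
      = r * r' * (1 - Complex.normSq c ^ 2) * cross (w - K) (w' - K) := by
    generalize w - K = u
    generalize w' - K = v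
    simp [cross, Complex.normSq_apply, pow_two]
    ring
  rw [this]
  positivity

theorem poincare_center {K : ℂ} {ρ : ℝ} (hρ : ρ ^ 2 = 1 - Complex.normSq K)
    (hne : (1 + ρ : ℂ) ≠ 0) :
    (1 + K / (1 + ρ) * conj (K / (1 + ρ))) * K = 2 * (K / (1 + ρ)) := by
  have h1 : K * conj K = 1 - (ρ : ℂ) ^ 2 := by
    rw [Complex.mul_conj]
    have : Complex.normSq K = 1 - ρ ^ 2 := by linarith
    rw [this]; push_cast; ring
  have h2 : conj (K / (1 + ρ)) = conj K / (1 + ρ) := by simp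
  rw [h2]
  field_simp
  linear_combination K * h1

theorem exists_moebius {d₀ d₁ d₂ d₃ : ℂ} (hsum : d₀ + d₁ + d₂ + d₃ = 0)
    (hpit : ‖d₀‖ + ‖d₂‖ = ‖d₁‖ + ‖d₃‖) (harea : 0 < cross (d₂ + d₃) (d₃ + d₀)) :
    (0 < ‖d₀‖ ∧ 0 < ‖d₁‖ ∧ 0 < ‖d₂‖ ∧ 0 < ‖d₃‖) ∧
    ∃ w X a : ℂ, ‖w‖ = 1 ∧ 0 < w.im ∧ ‖X‖ = 1 ∧ ‖a‖ < 1 ∧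
      X * (1 - a) * d₀ = (1 - 1 * conj a) * (-‖d₀‖) ∧
      X * (w - a) * d₁ = (1 - w * conj a) * ‖d₁‖ ∧
      X * (-1 - a) * d₂ = (1 - (-1) * conj a) * (-‖d₂‖) ∧
      X * (-w - a) * d₃ = (1 - (-w) * conj a) * ‖d₃‖ := by
  have hlt := norm_add_lt_of_area_pos hsum hpit harea
  have h13 : d₁ + d₃ = -(d₀ + d₂) := by linear_combination hsum
  have hlt' : ‖d₁ + d₃‖ < ‖d₁‖ + ‖d₃‖ := by rw [h13, norm_neg, ← hpit]; exact hlt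
  have hd0 : 0 < ‖d₀‖ := norm_pos_iff.mpr fun h => by simp [h] at hlt
  have hd1 : 0 < ‖d₁‖ := norm_pos_iff.mpr fun h => by simp [h] at hlt'
  have hd2 : 0 < ‖d₂‖ := norm_pos_iff.mpr fun h => by simp [h] at hlt
  have hd3 : 0 < ‖d₃‖ := norm_pos_iff.mpr fun h => by simp [h] at hlt'
  refine ⟨⟨hd0, hd1, hd2, hd3⟩, ?_⟩
  set l₀ := ‖d₀‖ with hl0
  set l₁ := ‖d₁‖ with hl1
  set l₂ := ‖d₂‖ with hl2
  set l₃ := ‖d₃‖ with hl3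
  have c0 : (l₀ : ℂ) ≠ 0 := by exact_mod_cast hd0.ne'
  have c1 : (l₁ : ℂ) ≠ 0 := by exact_mod_cast hd1.ne'
  have c2 : (l₂ : ℂ) ≠ 0 := by exact_mod_cast hd2.ne'
  have c3 : (l₃ : ℂ) ≠ 0 := by exact_mod_cast hd3.ne'
  -- boundary values of the Möbius map
  set η₀ := -conj d₀ / l₀ with hη0
  set η₁ := conj d₁ / l₁ with hη1
  set η₂ := -conj d₂ / l₂ with hη2
  set η₃ := conj d₃ / l₃ with hη3
  have n0 : ‖η₀‖ = 1 := by
    rw [hη0, norm_div, norm_neg, RCLike.norm_conj, Complex.norm_real, Real.norm_of_nonneg hd0.le,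
      ← hl0, div_self hd0.ne']
  have n1 : ‖η₁‖ = 1 := by
    rw [hη1, norm_div, RCLike.norm_conj, Complex.norm_real, Real.norm_of_nonneg hd1.le,
      ← hl1, div_self hd1.ne']
  have n2 : ‖η₂‖ = 1 := by
    rw [hη2, norm_div, norm_neg, RCLike.norm_conj, Complex.norm_real, Real.norm_of_nonneg hd2.le,
      ← hl2, div_self hd2.ne']
  have n3 : ‖η₃‖ = 1 := by
    rw [hη3, norm_div, RCLike.norm_conj, Complex.norm_real, Real.norm_of_nonneg hd3.le,
      ← hl3, div_self hd3.ne']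
  have s0 : η₀ * d₀ = -l₀ := by
    rw [hη0, div_mul_eq_mul_div, div_eq_iff c0, neg_mul, mul_comm, Complex.mul_conj,
      Complex.normSq_eq_norm_sq, ← hl0]; push_cast; ring
  have s1 : η₁ * d₁ = l₁ := by
    rw [hη1, div_mul_eq_mul_div, div_eq_iff c1, mul_comm, Complex.mul_conj,
      Complex.normSq_eq_norm_sq, ← hl1]; push_cast; ring
  have s2 : η₂ * d₂ = -l₂ := by
    rw [hη2, div_mul_eq_mul_div, div_eq_iff c2, neg_mul, mul_comm, Complex.mul_conj,
      Complex.normSq_eq_norm_sq, ← hl2]; push_cast; ring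
  have s3 : η₃ * d₃ = l₃ := by
    rw [hη3, div_mul_eq_mul_div, div_eq_iff c3, mul_comm, Complex.mul_conj,
      Complex.normSq_eq_norm_sq, ← hl3]; push_cast; ring
  have e0 : (l₀ : ℂ) * η₀ = -conj d₀ := by rw [hη0]; field_simp
  have e1 : (l₁ : ℂ) * η₁ = conj d₁ := by rw [hη1]; field_simp
  have e2 : (l₂ : ℂ) * η₂ = -conj d₂ := by rw [hη2]; field_simp
  have e3 : (l₃ : ℂ) * η₃ = conj d₃ := by rw [hη3]; field_simp
  have hSpos : 0 < l₀ + l₂ := by positivity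
  have hS : (l₀ + l₂ : ℂ) ≠ 0 := by exact_mod_cast hSpos.ne'
  have hS' : (l₁ + l₃ : ℂ) = l₀ + l₂ := by exact_mod_cast hpit.symm
  set K : ℂ := -conj (d₀ + d₂) / (l₀ + l₂) with hK
  have hK02 : (l₀ + l₂ : ℂ) * K = l₀ * η₀ + l₂ * η₂ := by
    rw [e0, e2, hK, mul_div_cancel₀ _ hS, map_add]; ring
  have hK13 : (l₁ + l₃ : ℂ) * K = l₁ * η₁ + l₃ * η₃ := by
    rw [e1, e3, hS', hK, mul_div_cancel₀ _ hS, ← map_neg, ← h13, map_add]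
  have hKn : ‖K‖ < 1 := by
    rw [hK, norm_div, norm_neg, RCLike.norm_conj]
    have : ‖(l₀ + l₂ : ℂ)‖ = l₀ + l₂ := by
      rw [← Complex.ofReal_add, Complex.norm_real, Real.norm_of_nonneg hSpos.le]
    rw [this, div_lt_one hSpos]; exact hlt
  have hKsq : 0 < 1 - Complex.normSq K := by
    rw [Complex.normSq_eq_norm_sq]
    nlinarith [norm_nonneg K]
  -- the hyperbolic crossing point of the chords
  set ρ := √(1 - Complex.normSq K) with hρ
  have hρ0 : 0 < ρ := Real.sqrt_pos.mpr hKsq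
  have hρ2 : ρ ^ 2 = 1 - Complex.normSq K := Real.sq_sqrt hKsq.le
  have hρc : (1 + ρ : ℂ) ≠ 0 := by
    have : (1 + ρ : ℝ) ≠ 0 := by positivity
    exact_mod_cast this
  set c : ℂ := K / (1 + ρ) with hcdef
  have hcn : ‖c‖ < 1 := by
    rw [hcdef, norm_div]
    have : ‖(1 + ρ : ℂ)‖ = 1 + ρ := by
      rw [← Complex.ofReal_one, ← Complex.ofReal_add, Complex.norm_real,
        Real.norm_of_nonneg (by positivity)]
    rw [this, div_lt_one (by positivity)]
    linarith
  have hcK := poincare_center (K := K) hρ2 hρc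
  rw [← hcdef] at hcK
  have anti02 := blaschke_antipodal hcn n0 n2 hSpos hK02 hcK
  have anti13 := blaschke_antipodal hcn n1 n3 (by positivity) hK13 hcK
  -- orientation
  have hxy : 0 < cross (η₀ - K) (η₁ - K) := by
    have q0 := Complex.normSq_eq_norm_sq η₀
    have q1 := Complex.normSq_eq_norm_sq η₁
    have q2 := Complex.normSq_eq_norm_sq η₂
    have q3 := Complex.normSq_eq_norm_sq η₃
    rw [n0] at q0
    rw [n1] at q1
    rw [n2] at q2
    rw [n3] at q3
    set x := η₀ - K with hx
    set y := η₁ - K with hy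
    have z0 : η₀ = K + x := by rw [hx]; ring
    have z1 : η₁ = K + y := by rw [hy]; ring
    have z2 : (l₂ : ℂ) * η₂ = l₂ * K - l₀ * x := by rw [hx]; linear_combination -hK02
    have z3 : (l₃ : ℂ) * η₃ = l₃ * K - l₁ * y := by rw [hy]; linear_combination -hK13
    have q2' : Complex.normSq (l₂ * K - l₀ * x) = l₂ ^ 2 := by
      rw [← z2, map_mul, q2, Complex.normSq_ofReal]; ring
    have q3' : Complex.normSq (l₃ * K - l₁ * y) = l₃ ^ 2 := by
      rw [← z3, map_mul, q3, Complex.normSq_ofReal]; ring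
    rw [z0] at q0
    rw [z1] at q1
    have f0 : d₀ = conj (-(l₀ : ℂ) * (K + x)) := by
      rw [← z0, neg_mul, e0]; simp
    have f2 : d₂ = conj (-(l₂ : ℂ) * K + l₀ * x) := by
      have : -(l₂ : ℂ) * K + l₀ * x = conj d₂ := by linear_combination -e2 + z2
      rw [this]; simp
    have f3 : d₃ = conj ((l₃ : ℂ) * K - l₁ * y) := by
      rw [← z3, e3]; simp
    have hA : cross (d₂ + d₃) (d₃ + d₀) = l₀ * (l₃ - l₁) * cross K x + l₁ * (l₀ - l₂) * cross K y
      + 2 * l₀ * l₁ * cross x y := by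
      rw [f0, f2, f3]
      simp only [cross, map_add, map_sub, map_mul, map_neg, Complex.conj_ofReal, Complex.add_re,
        Complex.sub_re, Complex.mul_re, Complex.add_im, Complex.sub_im, Complex.mul_im,
        Complex.neg_re, Complex.neg_im, Complex.ofReal_re, Complex.ofReal_im, Complex.conj_re,
        Complex.conj_im]
      linear_combination -(l₀ * (K.re * x.im - K.im * x.re)) * hpit
    clear_value x y η₀ η₁ η₂ η₃ K l₀ l₁ l₂ l₃
    simp only [Complex.normSq_apply, Complex.add_re, Complex.add_im, Complex.sub_re, Complex.sub_im,
      Complex.mul_re, Complex.mul_im, Complex.ofReal_re, Complex.ofReal_im] at q0 q1 q2' q3'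
    have r1 : l₀ * Complex.normSq x = l₂ * (1 - Complex.normSq K) := by
      apply mul_left_cancel₀ hSpos.ne'
      simp only [Complex.normSq_apply]
      linear_combination l₀ * l₂ * q0 + q2'
    have r2 : l₁ * Complex.normSq y = l₃ * (1 - Complex.normSq K) := by
      apply mul_left_cancel₀ (show l₁ + l₃ ≠ 0 by positivity)
      simp only [Complex.normSq_apply]
      linear_combination l₁ * l₃ * q1 + q3'
    refine cross_pos_of_chords hd0 hd1 hd2 hd3 r1 ?_ r2 ?_ hKsq (hA ▸ harea)
    · simp only [Complex.normSq_apply] at r1 ⊢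
      linear_combination l₂ * q0 - r1
    · simp only [Complex.normSq_apply] at r2 ⊢
      linear_combination l₃ * q1 - r2
  have him := cross_blaschke hcn n0 n1 hcK hxy
  set X := blaschke c η₀ with hX
  have nX : ‖X‖ = 1 := norm_blaschke hcn n0
  have uX := conj_eq_inv_of_norm_eq_one nX
  have hfin : ∀ η, ‖η‖ = 1 → X * (blaschke c η * conj X - -(c * conj X)) =
      η * (1 - (blaschke c η * conj X) * conj (-(c * conj X))) := by
    intro η hη
    have hb : blaschke c η * (1 - η * conj c) = η - c :=
      div_mul_cancel₀ _ (one_sub_mul_conj_ne_zero hcn hη.le)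
    simp only [map_neg, map_mul, Complex.conj_conj]
    linear_combination (blaschke c η + c - η * blaschke c η * conj c) * uX + hb
  refine ⟨blaschke c η₁ * conj X, X, -(c * conj X), ?_, him, nX, ?_, ?_, ?_, ?_, ?_⟩
  · rw [norm_mul, RCLike.norm_conj, nX, norm_blaschke hcn n1, one_mul]
  · rw [norm_neg, norm_mul, RCLike.norm_conj, nX, mul_one]; exact hcn
  · have := hfin η₀ n0
    rw [← hX, uX] at this
    rw [this]
    linear_combination (1 - 1 * conj (-(c * conj X))) * s0
  · rw [hfin η₁ n1]
    linear_combination (1 - (blaschke c η₁ * conj X) * conj (-(c * conj X))) * s1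
  · have := hfin η₂ n2
    rw [anti02, neg_mul, uX] at this
    rw [this]
    linear_combination (1 - (-1) * conj (-(c * conj X))) * s2
  · have := hfin η₃ n3
    rw [anti13, neg_mul] at this
    rw [this]
    linear_combination (1 - (-(blaschke c η₁ * conj X)) * conj (-(c * conj X))) * s3

/-! ### Rational functions with poles at `1, w, -1, -w` -/

/-- The rational function with simple poles at `1, w, -1, -w`. -/
def poleSum (w e₀ e₁ e₂ e₃ z : ℂ) : ℂ :=
  1 / (2 * Real.pi * Complex.I) * (e₀ / (1 - z) + e₁ / (w - z) + e₂ / (-1 - z) + e₃ / (-w - z))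

/-- The primitive of `poleSum` vanishing at the origin. -/
def logSum (w e₀ e₁ e₂ e₃ z : ℂ) : ℂ :=
  -(1 / (2 * Real.pi * Complex.I)) * (e₀ * Complex.log (1 - z / 1) + e₁ * Complex.log (1 - z / w)
    + e₂ * Complex.log (1 - z / (-1)) + e₃ * Complex.log (1 - z / (-w)))

theorem mem_disk {z : ℂ} : z ∈ disk ↔ ‖z‖ < 1 := by simp [disk]

theorem isOpen_disk : IsOpen disk := Metric.isOpen_ball

theorem one_sub_div_mem_slitPlane {z ζ : ℂ} (hz : z ∈ disk) (hζ : ‖ζ‖ = 1) :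
    1 - z / ζ ∈ Complex.slitPlane := by
  rw [mem_disk] at hz
  refine Or.inl ?_
  have h1 : (z / ζ).re ≤ ‖z / ζ‖ := Complex.re_le_norm _
  rw [norm_div, hζ, div_one] at h1
  rw [Complex.sub_re, Complex.one_re]
  linarith

theorem sub_ne_zero_of_mem_disk {z ζ : ℂ} (hz : z ∈ disk) (hζ : ‖ζ‖ = 1) : ζ - z ≠ 0 := by
  rw [mem_disk] at hz
  intro h
  rw [sub_eq_zero] at h
  rw [h] at hζ
  linarith

theorem hasDerivAt_log_one_sub_div {z ζ : ℂ} (hz : z ∈ disk) (hζ : ‖ζ‖ = 1) :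
    HasDerivAt (fun z => Complex.log (1 - z / ζ)) (-(1 / (ζ - z))) z := by
  have h1 : HasDerivAt (fun z : ℂ => 1 - z / ζ) (-(1 / ζ)) z :=
    ((hasDerivAt_id z).div_const ζ).const_sub 1
  convert h1.clog (one_sub_div_mem_slitPlane hz hζ) using 1
  have h2 := sub_ne_zero_of_mem_disk hz hζ
  have h3 : ζ ≠ 0 := fun h => by simp [h] at hζ
  have h4 : 1 - z / ζ ≠ 0 := Complex.slitPlane_ne_zero (one_sub_div_mem_slitPlane hz hζ)
  field_simp

theorem hasDerivAt_logSum {w : ℂ} (hw : ‖w‖ = 1) (e₀ e₁ e₂ e₃ : ℂ) {z : ℂ} (hz : z ∈ disk) :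
    HasDerivAt (logSum w e₀ e₁ e₂ e₃) (poleSum w e₀ e₁ e₂ e₃ z) z := by
  have h0 := (hasDerivAt_log_one_sub_div hz (ζ := 1) (by simp)).const_mul e₀
  have h1 := (hasDerivAt_log_one_sub_div hz hw).const_mul e₁
  have h2 := (hasDerivAt_log_one_sub_div hz (ζ := -1) (by simp)).const_mul e₂
  have h3 := (hasDerivAt_log_one_sub_div hz (ζ := -w) (by simpa using hw)).const_mul e₃
  have h := (((h0.add h1).add h2).add h3).const_mul (-(1 / (2 * Real.pi * Complex.I)))
  refine h.congr_deriv ?_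
  rw [poleSum]; ring

theorem logSum_zero (w e₀ e₁ e₂ e₃ : ℂ) : logSum w e₀ e₁ e₂ e₃ 0 = 0 := by
  simp [logSum]

/-- The numerator of `poleSum` for residues with vanishing sum. -/
def poleNum (w e₀ e₁ e₂ e₃ z : ℂ) : ℂ :=
  ((e₂ - e₀) + w * (e₃ - e₁)) * z ^ 2 + (e₀ + e₂) * (w ^ 2 - 1) * z
    - ((e₂ - e₀) * w ^ 2 + w * (e₃ - e₁))

theorem poleSum_eq {w e₀ e₁ e₂ e₃ z : ℂ} (hw : ‖w‖ = 1) (hz : z ∈ disk)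
    (hsum : e₀ + e₁ + e₂ + e₃ = 0) :
    poleSum w e₀ e₁ e₂ e₃ z = poleNum w e₀ e₁ e₂ e₃ z *
      (1 / (2 * Real.pi * Complex.I) / ((1 - z) * (w - z) * (-1 - z) * (-w - z))) := by
  have h0 := sub_ne_zero_of_mem_disk hz (ζ := 1) (by simp)
  have h1 := sub_ne_zero_of_mem_disk hz hw
  have h2 := sub_ne_zero_of_mem_disk hz (ζ := -1) (by simp)
  have h3 := sub_ne_zero_of_mem_disk hz (ζ := -w) (by simpa using hw)
  rw [poleSum, poleNum, mul_div_assoc', mul_comm _ (1 / (2 * Real.pi * Complex.I)),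
    mul_div_assoc]
  congr 1
  obtain rfl : e₃ = -(e₀ + e₁ + e₂) := by linear_combination hsum
  rw [div_add_div _ _ h0 h1, div_add_div _ _ (mul_ne_zero h0 h1) h2,
    div_add_div _ _ (mul_ne_zero (mul_ne_zero h0 h1) h2) h3]
  congr 1
  ring

/-- A cubic polynomial vanishing at `1, w, -1, -w` vanishes. -/
theorem cubic_eq_zero {w c₀ c₁ c₂ c₃ : ℂ} (hw0 : w ≠ 0) (hw : w ^ 2 ≠ 1)
    (h0 : c₀ + c₁ * 1 + c₂ * 1 ^ 2 + c₃ * 1 ^ 3 = 0)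
    (h1 : c₀ + c₁ * w + c₂ * w ^ 2 + c₃ * w ^ 3 = 0)
    (h2 : c₀ + c₁ * (-1) + c₂ * (-1) ^ 2 + c₃ * (-1) ^ 3 = 0)
    (h3 : c₀ + c₁ * (-w) + c₂ * (-w) ^ 2 + c₃ * (-w) ^ 3 = 0) (z : ℂ) :
    c₀ + c₁ * z + c₂ * z ^ 2 + c₃ * z ^ 3 = 0 := by
  have hne : w ^ 2 - 1 ≠ 0 := sub_ne_zero.mpr hw
  have k2 : c₂ = 0 := by
    have : c₂ * (w ^ 2 - 1) = 0 := by linear_combination (h1 + h3) / 2 - (h0 + h2) / 2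
    exact (mul_eq_zero.mp this).resolve_right hne
  have k3 : c₃ = 0 := by
    have : c₃ * (w * (w ^ 2 - 1)) = 0 := by
      linear_combination (h1 - h3) / 2 - w * (h0 - h2) / 2
    exact (mul_eq_zero.mp this).resolve_right (mul_ne_zero hw0 hne)
  have k0 : c₀ = 0 := by linear_combination (h0 + h2) / 2 - k2
  have k1 : c₁ = 0 := by linear_combination (h0 - h2) / 2 - k3
  rw [k0, k1, k2, k3]; ring

/-- If the Möbius map `X (z - a) / (1 - a' z)` takes the value `r_k / e_k` at the poles, it is the
quotient of the two rational functions. -/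
theorem moebius_mul_poleNum {w X a a' e₀ e₁ e₂ e₃ r₀ r₁ r₂ r₃ : ℂ} (hw0 : w ≠ 0) (hw : w ^ 2 ≠ 1)
    (he : e₀ + e₁ + e₂ + e₃ = 0) (hr : r₀ + r₁ + r₂ + r₃ = 0)
    (h0 : X * (1 - a) * e₀ = (1 - 1 * a') * r₀)
    (h1 : X * (w - a) * e₁ = (1 - w * a') * r₁)
    (h2 : X * (-1 - a) * e₂ = (1 - (-1) * a') * r₂)
    (h3 : X * (-w - a) * e₃ = (1 - (-w) * a') * r₃) (z : ℂ) :
    X * (z - a) * poleNum w e₀ e₁ e₂ e₃ z = (1 - z * a') * poleNum w r₀ r₁ r₂ r₃ z := by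
  obtain rfl : e₃ = -(e₀ + e₁ + e₂) := by linear_combination he
  obtain rfl : r₃ = -(r₀ + r₁ + r₂) := by linear_combination hr
  set e₃ := -(e₀ + e₁ + e₂)
  set r₃ := -(r₀ + r₁ + r₂)
  set E₂ := (e₂ - e₀) + w * (e₃ - e₁) with hE2
  set E₁ := (e₀ + e₂) * (w ^ 2 - 1) with hE1
  set E₀ := -((e₂ - e₀) * w ^ 2 + w * (e₃ - e₁)) with hE0
  set R₂ := (r₂ - r₀) + w * (r₃ - r₁) with hR2
  set R₁ := (r₀ + r₂) * (w ^ 2 - 1) with hR1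
  set R₀ := -((r₂ - r₀) * w ^ 2 + w * (r₃ - r₁)) with hR0
  have key := cubic_eq_zero (c₀ := -X * a * E₀ - R₀) (c₁ := X * E₀ - X * a * E₁ - R₁ + a' * R₀)
    (c₂ := X * E₁ - X * a * E₂ - R₂ + a' * R₁) (c₃ := X * E₂ + a' * R₂) hw0 hw
    (by simp only [hE2, hE1, hE0, hR2, hR1, hR0, e₃, r₃]
        linear_combination 2 * (w ^ 2 - 1) * h0)
    (by simp only [hE2, hE1, hE0, hR2, hR1, hR0, e₃, r₃]
        linear_combination (-2 * w) * (w ^ 2 - 1) * h1)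
    (by simp only [hE2, hE1, hE0, hR2, hR1, hR0, e₃, r₃]
        linear_combination -2 * (w ^ 2 - 1) * h2)
    (by simp only [hE2, hE1, hE0, hR2, hR1, hR0, e₃, r₃]
        linear_combination (2 * w) * (w ^ 2 - 1) * h3) z
  simp only [poleNum]
  rw [← hE2, ← hE1, ← hR2, ← hR1]
  linear_combination key

/-- Cancellation of a linear factor from an identity of continuous functions. -/
theorem cancel_linear_factor {a : ℂ} {F G : ℂ → ℂ} (hF : Continuous F) (hG : Continuous G)
    (h : ∀ z, (z - a) * F z = (z - a) * G z) : F = G := by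
  refine hF.ext_on (dense_compl_singleton a) hG fun z hz => ?_
  exact mul_left_cancel₀ (sub_ne_zero.mpr hz) (h z)

theorem quadratic_factor {A B C a : ℂ} (h : A * a ^ 2 + B * a + C = 0) (z : ℂ) :
    A * z ^ 2 + B * z + C = (z - a) * (A * (z + a) + B) := by
  linear_combination h

/-- The shape of quadratic polynomials related by powers of a disk automorphism. -/
theorem quadratic_moebius {X a a' A B C A' B' C' A'' B'' C'' : ℂ}
    (ha : 1 - a * a' ≠ 0)
    (h1 : ∀ z, X * (z - a) * (A * z ^ 2 + B * z + C) = (1 - z * a') * (A' * z ^ 2 + B' * z + C'))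
    (h2 : ∀ z, X * (z - a) * (A' * z ^ 2 + B' * z + C') =
      (1 - z * a') * (A'' * z ^ 2 + B'' * z + C'')) (z : ℂ) :
    X ^ 2 * (A * z ^ 2 + B * z + C) = A'' * (1 - z * a') ^ 2 := by
  have k1 : A' * a ^ 2 + B' * a + C' = 0 := by
    have := h1 a
    rw [sub_self, mul_zero, zero_mul] at this
    exact (mul_eq_zero.mp this.symm).resolve_left ha
  have k2 : A'' * a ^ 2 + B'' * a + C'' = 0 := by
    have := h2 a
    rw [sub_self, mul_zero, zero_mul] at this
    exact (mul_eq_zero.mp this.symm).resolve_left ha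
  have k3 := cancel_linear_factor (a := a)
    (F := fun z => X * (A' * z ^ 2 + B' * z + C')) (G := fun z => (1 - z * a') * (A'' * (z + a) + B''))
    (by fun_prop) (by fun_prop) (fun z => by
      have := h2 z
      rw [quadratic_factor k2] at this
      linear_combination this)
  have k4 : A'' * (a + a) + B'' = 0 := by
    have := congrFun k3 a
    simp only [k1, mul_zero] at this
    exact (mul_eq_zero.mp this.symm).resolve_left ha
  have k5 : ∀ z, A'' * z ^ 2 + B'' * z + C'' = A'' * (z - a) ^ 2 := by
    intro z
    rw [quadratic_factor k2]
    linear_combination (z - a) * k4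
  have k6 := cancel_linear_factor (a := a)
    (F := fun z => (z - a) * (X ^ 2 * (A * z ^ 2 + B * z + C)))
    (G := fun z => (z - a) * (A'' * (1 - z * a') ^ 2))
    (by fun_prop) (by fun_prop) (fun z => by
      have e2 := h2 z
      rw [k5] at e2
      linear_combination X * (z - a) * h1 z + (1 - z * a') * e2)
  have k7 := cancel_linear_factor (a := a)
    (F := fun z => X ^ 2 * (A * z ^ 2 + B * z + C)) (G := fun z => A'' * (1 - z * a') ^ 2)
    (by fun_prop) (by fun_prop) (fun z => congrFun k6 z)
  exact congrFun k7 z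

/-- A Möbius boundary relation with real target also holds for the conjugate residue. -/
theorem moebius_relation_conj {M N d : ℂ} {m : ℝ} (hm : m ≠ 0) (hmd : m ^ 2 = ‖d‖ ^ 2)
    (h : M * d = N * m) : M * m = N * conj d := by
  have hm' : (m : ℂ) ≠ 0 := by exact_mod_cast hm
  have hd : d * conj d = (m : ℂ) ^ 2 := by
    rw [Complex.mul_conj, Complex.normSq_eq_norm_sq, ← hmd]; push_cast; rfl
  apply mul_left_cancel₀ hm'
  linear_combination conj d * h - M * hd

/-- The Weierstrass data: the three rational functions are `H`, `q H`, `q² H`, and `H ≠ 0`. -/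
theorem weierstrass_data {w X a d₀ d₁ d₂ d₃ : ℂ} {m₀ m₁ m₂ m₃ : ℝ}
    (hw : ‖w‖ = 1) (hw2 : w ^ 2 ≠ 1) (hX : ‖X‖ = 1) (ha : ‖a‖ < 1)
    (hd : d₀ + d₁ + d₂ + d₃ = 0) (hm : m₀ + m₁ + m₂ + m₃ = 0)
    (hm0 : m₀ ≠ 0) (hm1 : m₁ ≠ 0) (hm2 : m₂ ≠ 0) (hm3 : m₃ ≠ 0)
    (hn0 : m₀ ^ 2 = ‖d₀‖ ^ 2) (hn1 : m₁ ^ 2 = ‖d₁‖ ^ 2)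
    (hn2 : m₂ ^ 2 = ‖d₂‖ ^ 2) (hn3 : m₃ ^ 2 = ‖d₃‖ ^ 2)
    (h0 : X * (1 - a) * d₀ = (1 - 1 * conj a) * m₀)
    (h1 : X * (w - a) * d₁ = (1 - w * conj a) * m₁)
    (h2 : X * (-1 - a) * d₂ = (1 - (-1) * conj a) * m₂)
    (h3 : X * (-w - a) * d₃ = (1 - (-w) * conj a) * m₃) {z : ℂ} (hz : z ∈ disk) :
    poleSum w d₀ d₁ d₂ d₃ z ≠ 0 ∧
    X * ((z - a) / (1 - z * conj a)) * poleSum w d₀ d₁ d₂ d₃ z = poleSum w m₀ m₁ m₂ m₃ z ∧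
    X * ((z - a) / (1 - z * conj a)) * poleSum w m₀ m₁ m₂ m₃ z =
      poleSum w (conj d₀) (conj d₁) (conj d₂) (conj d₃) z := by
  have hw0 : w ≠ 0 := fun h => by simp [h] at hw
  have hX0 : X ≠ 0 := fun h => by simp [h] at hX
  have hz' : ‖z‖ ≤ 1 := (mem_disk.mp hz).le
  have hmc : (m₀ : ℂ) + m₁ + m₂ + m₃ = 0 := by exact_mod_cast hm
  have hdc : conj d₀ + conj d₁ + conj d₂ + conj d₃ = 0 := by
    rw [← map_add, ← map_add, ← map_add, hd, map_zero]
  have r1 := moebius_mul_poleNum hw0 hw2 hd hmc h0 h1 h2 h3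
  have r2 := moebius_mul_poleNum hw0 hw2 hmc hdc (moebius_relation_conj hm0 hn0 h0)
    (moebius_relation_conj hm1 hn1 h1) (moebius_relation_conj hm2 hn2 h2)
    (moebius_relation_conj hm3 hn3 h3)
  have hne := one_sub_mul_conj_ne_zero ha hz'
  have hd0 : d₀ ≠ 0 := by
    intro h
    rw [h, norm_zero] at hn0
    exact hm0 (by simpa using hn0)
  refine ⟨?_, ?_, ?_⟩
  · rw [poleSum_eq hw hz hd]
    have q0 := sub_ne_zero_of_mem_disk hz (ζ := 1) (by simp)
    have q1 := sub_ne_zero_of_mem_disk hz hw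
    have q2 := sub_ne_zero_of_mem_disk hz (ζ := -1) (by simp)
    have q3 := sub_ne_zero_of_mem_disk hz (ζ := -w) (by simpa using hw)
    have hpi : (Real.pi : ℂ) ≠ 0 := by exact_mod_cast Real.pi_ne_zero
    refine mul_ne_zero ?_ (div_ne_zero (by simp [hpi]) (by simp [q0, q1, q2, q3]))
    have shape := quadratic_moebius (X := X)
      (one_sub_mul_conj_ne_zero ha ha.le)
      (A := ((d₂ - d₀) + w * (d₃ - d₁))) (B := (d₀ + d₂) * (w ^ 2 - 1))
      (C := -((d₂ - d₀) * w ^ 2 + w * (d₃ - d₁)))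
      (fun z => by have := r1 z; simp only [poleNum, sub_eq_add_neg _ (_ * _ + _)] at this; exact this)
      (fun z => by have := r2 z; simp only [poleNum, sub_eq_add_neg _ (_ * _ + _)] at this; exact this)
    intro hzero
    have s1 := shape z
    have e : ∀ z, poleNum w d₀ d₁ d₂ d₃ z = ((d₂ - d₀) + w * (d₃ - d₁)) * z ^ 2 +
      (d₀ + d₂) * (w ^ 2 - 1) * z + -((d₂ - d₀) * w ^ 2 + w * (d₃ - d₁)) := fun z => by
        rw [poleNum, sub_eq_add_neg]
    rw [← e, hzero, mul_zero] at s1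
    have hA := (mul_eq_zero.mp s1.symm).resolve_right (pow_ne_zero 2 hne)
    have s2 := shape 1
    rw [← e, hA, zero_mul] at s2
    have s3 := (mul_eq_zero.mp s2).resolve_left (pow_ne_zero 2 hX0)
    have s4 : poleNum w d₀ d₁ d₂ d₃ 1 = 2 * (w ^ 2 - 1) * d₀ := by
      obtain rfl : d₃ = -(d₀ + d₁ + d₂) := by linear_combination hd
      rw [poleNum]; ring
    rw [s4] at s3
    exact mul_ne_zero (mul_ne_zero two_ne_zero (sub_ne_zero.mpr hw2)) hd0 s3
  · rw [poleSum_eq hw hz hd, poleSum_eq hw hz hmc, ← mul_assoc]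
    congr 1
    rw [mul_div_assoc', div_mul_eq_mul_div, div_eq_iff hne, r1]; ring
  · rw [poleSum_eq hw hz hdc, poleSum_eq hw hz hmc, ← mul_assoc]
    congr 1
    rw [mul_div_assoc', div_mul_eq_mul_div, div_eq_iff hne, r2]; ring

/-! ### Poisson integrals of step functions -/

/-- The Poisson kernel on the unit circle, in the angular variable. -/
def diskKernel (z : ℂ) (θ : ℝ) : ℝ := (1 - ‖z‖ ^ 2) / ‖Complex.exp (Complex.I * θ) - z‖ ^ 2

theorem norm_exp_I_mul (θ : ℝ) : ‖Complex.exp (Complex.I * θ)‖ = 1 := by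
  rw [mul_comm]; exact Complex.norm_exp_ofReal_mul_I θ

theorem exp_sub_ne_zero {z : ℂ} (hz : z ∈ disk) (θ : ℝ) : Complex.exp (Complex.I * θ) - z ≠ 0 :=
  sub_ne_zero_of_mem_disk hz (norm_exp_I_mul θ)

theorem continuous_diskKernel {z : ℂ} (hz : z ∈ disk) : Continuous (diskKernel z) := by
  unfold diskKernel
  refine continuous_const.div (by fun_prop) fun θ => ?_
  exact pow_ne_zero 2 (norm_ne_zero_iff.mpr (exp_sub_ne_zero hz θ))

theorem diskKernel_nonneg {z : ℂ} (hz : z ∈ disk) (θ : ℝ) : 0 ≤ diskKernel z θ := by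
  rw [mem_disk] at hz
  refine div_nonneg ?_ (by positivity)
  nlinarith [norm_nonneg z]

/-- A primitive of the Poisson kernel. -/
def kernelPrimitive (z : ℂ) (θ : ℝ) : ℝ :=
  θ + 2 * (Complex.log (1 - z / Complex.exp (Complex.I * θ))).im

theorem hasDerivAt_kernelPrimitive {z : ℂ} (hz : z ∈ disk) (θ : ℝ) :
    HasDerivAt (kernelPrimitive z) (diskKernel z θ) θ := by
  set E := Complex.exp (Complex.I * θ) with hE
  have hE0 : E ≠ 0 := Complex.exp_ne_zero _
  have hEz : E - z ≠ 0 := exp_sub_ne_zero hz θ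
  have d1 : HasDerivAt (fun t : ℝ => Complex.exp (Complex.I * t)) (E * Complex.I) θ := by
    have := ((hasDerivAt_id (θ : ℂ)).const_mul Complex.I).cexp
    have h2 := HasDerivAt.comp_ofReal this
    simpa [hE] using h2
  have d2 : HasDerivAt (fun t : ℝ => 1 - z / Complex.exp (Complex.I * t))
      (Complex.I * z / E) θ := by
    have := ((d1.fun_inv hE0).const_mul z).const_sub 1
    simp only [← div_eq_mul_inv] at this
    refine this.congr_deriv ?_
    rw [← hE]
    field_simp
  have hslit := one_sub_div_mem_slitPlane hz (norm_exp_I_mul θ)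
  have d3 := d2.clog_real hslit
  have d4 : HasDerivAt (fun t : ℝ => (Complex.log (1 - z / Complex.exp (Complex.I * t))).im)
      (Complex.I * z / E / (1 - z / E)).im θ := by
    exact (Complex.imCLM.hasFDerivAt.comp_hasDerivAt θ d3)
  have d5 := (hasDerivAt_id θ).add (d4.const_mul 2)
  refine d5.congr_deriv ?_
  have hs : 1 - z / E ≠ 0 := Complex.slitPlane_ne_zero hslit
  have e1 : Complex.I * z / E / (1 - z / E) = Complex.I * z / (E - z) := by
    field_simp
  have hnE : Complex.normSq E = 1 := by
    rw [Complex.normSq_eq_norm_sq, norm_exp_I_mul]; norm_num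
  have hpos : 0 < Complex.normSq (E - z) := Complex.normSq_pos.mpr hEz
  rw [e1, diskKernel, ← hE, Complex.sq_norm, Complex.sq_norm, Complex.div_im]
  field_simp
  simp only [Complex.normSq_apply, Complex.sub_re, Complex.sub_im, Complex.mul_re, Complex.mul_im,
    Complex.I_re, Complex.I_im] at hnE ⊢
  linear_combination hnE

/-- Harmonic measure of the arc of angles between `α` and `β`, seen from `z`. -/
def arcMeasure (z : ℂ) (α β : ℝ) : ℝ := 1 / (2 * Real.pi) * ∫ θ in α..β, diskKernel z θ

theorem arcMeasure_eq {z : ℂ} (hz : z ∈ disk) (α β : ℝ) :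
    arcMeasure z α β = 1 / (2 * Real.pi) * (kernelPrimitive z β - kernelPrimitive z α) := by
  rw [arcMeasure, intervalIntegral.integral_eq_sub_of_hasDerivAt
    (fun θ _ => hasDerivAt_kernelPrimitive hz θ)
    ((continuous_diskKernel hz).intervalIntegrable _ _)]

theorem arcMeasure_nonneg {z : ℂ} (hz : z ∈ disk) {α β : ℝ} (h : α ≤ β) :
    0 ≤ arcMeasure z α β :=
  mul_nonneg (by positivity)
    (intervalIntegral.integral_nonneg h fun θ _ => diskKernel_nonneg hz θ)

theorem arcMeasure_add {z : ℂ} (hz : z ∈ disk) (α β γ : ℝ) :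
    arcMeasure z α β + arcMeasure z β γ = arcMeasure z α γ := by
  simp only [arcMeasure_eq hz]; ring

theorem arcMeasure_two_pi {z : ℂ} (hz : z ∈ disk) : arcMeasure z 0 (2 * Real.pi) = 1 := by
  have h : Complex.exp (Complex.I * ((2 * Real.pi : ℝ) : ℂ)) = 1 := by
    rw [mul_comm]; push_cast; exact Complex.exp_two_pi_mul_I
  rw [arcMeasure_eq hz, kernelPrimitive, kernelPrimitive, h]
  simp only [Complex.ofReal_zero, mul_zero, Complex.exp_zero]
  field_simp
  ring

/-- Harmonic measure of an arc tends to zero off the arc. -/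
theorem tendsto_arcMeasure {ζ : ℂ} (hζ : ‖ζ‖ = 1) {α β : ℝ} (hαβ : α ≤ β)
    (h : ∀ θ ∈ Set.Icc α β, Complex.exp (Complex.I * θ) ≠ ζ) :
    Filter.Tendsto (fun z => arcMeasure z α β) (𝓝[disk] ζ) (𝓝 0) := by
  obtain ⟨δ, hδ, hδ'⟩ : ∃ δ > 0, ∀ θ ∈ Set.Icc α β, δ ≤ ‖Complex.exp (Complex.I * θ) - ζ‖ := by
    obtain ⟨θ₀, hθ₀, hmin⟩ := (isCompact_Icc (a := α) (b := β)).exists_isMinOn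
      (Set.nonempty_Icc.mpr hαβ)
      (f := fun θ : ℝ => ‖Complex.exp (Complex.I * θ) - ζ‖) (by fun_prop)
    exact ⟨_, norm_pos_iff.mpr (sub_ne_zero.mpr (h θ₀ hθ₀)), fun θ hθ => hmin hθ⟩
  have hupper : Filter.Tendsto
      (fun z : ℂ => 1 / (2 * Real.pi) * ((1 - ‖z‖ ^ 2) / (δ / 2) ^ 2 * (β - α)))
      (𝓝[disk] ζ) (𝓝 0) := by
    have hc : Continuous fun z : ℂ =>
        1 / (2 * Real.pi) * ((1 - ‖z‖ ^ 2) / (δ / 2) ^ 2 * (β - α)) := by fun_prop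
    have := (hc.tendsto ζ).mono_left (nhdsWithin_le_nhds (s := disk))
    simpa [hζ] using this
  refine tendsto_of_tendsto_of_tendsto_of_le_of_le' tendsto_const_nhds hupper ?_ ?_
  · filter_upwards [self_mem_nhdsWithin] with z hz using arcMeasure_nonneg hz hαβ
  · filter_upwards [self_mem_nhdsWithin,
      mem_nhdsWithin_of_mem_nhds (Metric.ball_mem_nhds ζ (half_pos hδ))] with z hz hzb
    refine mul_le_mul_of_nonneg_left ?_ (by positivity)
    have hz1 : 0 ≤ 1 - ‖z‖ ^ 2 := by
      rw [mem_disk] at hz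
      nlinarith [norm_nonneg z]
    have hbound : ∀ θ ∈ Set.Icc α β, diskKernel z θ ≤ (1 - ‖z‖ ^ 2) / (δ / 2) ^ 2 := by
      intro θ hθ
      refine div_le_div_of_nonneg_left hz1 (by positivity) ?_
      have h1 := hδ' θ hθ
      have h2 : ‖z - ζ‖ < δ / 2 := by simpa [dist_eq_norm] using hzb
      have h3 : ‖Complex.exp (Complex.I * θ) - ζ‖ ≤
          ‖Complex.exp (Complex.I * θ) - z‖ + ‖z - ζ‖ := norm_sub_le_norm_sub_add_norm_sub _ _ _
      exact pow_le_pow_left₀ (by positivity) (by linarith) 2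
    calc ∫ θ in α..β, diskKernel z θ
        ≤ ∫ _ in α..β, (1 - ‖z‖ ^ 2) / (δ / 2) ^ 2 :=
          intervalIntegral.integral_mono_on hαβ ((continuous_diskKernel hz).intervalIntegrable _ _)
            intervalIntegrable_const hbound
      _ = (1 - ‖z‖ ^ 2) / (δ / 2) ^ 2 * (β - α) := by
          rw [intervalIntegral.integral_const, smul_eq_mul, mul_comm]

theorem intervalIntegral_piece {z : ℂ} (hz : z ∈ disk) {F : ℝ → ℂ} {c : ℂ} {α β : ℝ} (h : α ≤ β)
    (hF : ∀ θ ∈ Set.Ioo α β, F θ = c) :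
    IntervalIntegrable (fun θ => diskKernel z θ • F θ) MeasureTheory.volume α β ∧
    ∫ θ in α..β, diskKernel z θ • F θ = (2 * Real.pi * arcMeasure z α β : ℝ) • c := by
  have hcont : Continuous fun θ => diskKernel z θ • c := (continuous_diskKernel hz).smul continuous_const
  have hEq : Set.EqOn (fun θ => diskKernel z θ • c) (fun θ => diskKernel z θ • F θ)
      (Set.Ioo α β) := fun θ hθ => by simp only [hF θ hθ]
  constructor
  · rw [intervalIntegrable_iff_integrableOn_Ioo_of_le h]
    refine MeasureTheory.IntegrableOn.congr_fun ?_ hEq measurableSet_Ioo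
    rw [← intervalIntegrable_iff_integrableOn_Ioo_of_le h]
    exact hcont.intervalIntegrable _ _
  · rw [intervalIntegral.integral_of_le h, MeasureTheory.integral_Ioc_eq_integral_Ioo,
      ← MeasureTheory.setIntegral_congr_fun measurableSet_Ioo hEq,
      ← MeasureTheory.integral_Ioc_eq_integral_Ioo, ← intervalIntegral.integral_of_le h,
      intervalIntegral.integral_smul_const, arcMeasure]
    congr 1
    field_simp

variable {b₁ b₂ b₃ b₄ : ℂ} {p : ℝ}

theorem poissonExtension_stepFunction (hp : p ∈ Set.Ioo 0 Real.pi) {z : ℂ} (hz : z ∈ disk) :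
    poissonExtension (stepFunction b₁ b₂ b₃ b₄ p) z =
      arcMeasure z 0 p * b₄ + arcMeasure z p Real.pi * b₁ +
      arcMeasure z Real.pi (Real.pi + p) * b₂ +
      arcMeasure z (Real.pi + p) (2 * Real.pi) * b₃ := by
  obtain ⟨hp0, hp1⟩ := hp
  have i0 := intervalIntegral_piece hz (F := stepFunction b₁ b₂ b₃ b₄ p) (c := b₄) hp0.le
    (fun θ hθ => by rw [stepFunction, if_pos hθ.2])
  have i1 := intervalIntegral_piece hz (F := stepFunction b₁ b₂ b₃ b₄ p) (c := b₁) hp1.le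
    (fun θ hθ => by rw [stepFunction, if_neg (not_lt.mpr hθ.1.le), if_pos hθ.2])
  have i2 := intervalIntegral_piece hz (F := stepFunction b₁ b₂ b₃ b₄ p) (c := b₂)
    (α := Real.pi) (β := Real.pi + p) (by linarith)
    (fun θ hθ => by rw [stepFunction, if_neg (not_lt.mpr (hp1.trans hθ.1).le),
      if_neg (not_lt.mpr hθ.1.le), if_pos hθ.2])
  have i3 := intervalIntegral_piece hz (F := stepFunction b₁ b₂ b₃ b₄ p) (c := b₃)
    (α := Real.pi + p) (β := 2 * Real.pi) (by linarith)
    (fun θ hθ => by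
      have h1 : Real.pi ≤ θ := by linarith [hθ.1]
      rw [stepFunction, if_neg (not_lt.mpr (hp1.le.trans h1)),
        if_neg (not_lt.mpr h1), if_neg (not_lt.mpr hθ.1.le)])
  have hsplit : ∫ θ in (0 : ℝ)..(2 * Real.pi), diskKernel z θ • stepFunction b₁ b₂ b₃ b₄ p θ =
      (2 * Real.pi * arcMeasure z 0 p : ℝ) • b₄ + (2 * Real.pi * arcMeasure z p Real.pi : ℝ) • b₁ +
      (2 * Real.pi * arcMeasure z Real.pi (Real.pi + p) : ℝ) • b₂ +
      (2 * Real.pi * arcMeasure z (Real.pi + p) (2 * Real.pi) : ℝ) • b₃ := by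
    rw [← i0.2, ← i1.2, ← i2.2, ← i3.2, intervalIntegral.integral_add_adjacent_intervals i0.1 i1.1,
      intervalIntegral.integral_add_adjacent_intervals (i0.1.trans i1.1) i2.1,
      intervalIntegral.integral_add_adjacent_intervals ((i0.1.trans i1.1).trans i2.1) i3.1]
  change (1 / (2 * Real.pi) : ℝ) •
    ∫ θ in (0 : ℝ)..(2 * Real.pi), diskKernel z θ • stepFunction b₁ b₂ b₃ b₄ p θ = _
  rw [hsplit]
  have hpi : (Real.pi : ℂ) ≠ 0 := by exact_mod_cast Real.pi_ne_zero
  simp only [Complex.real_smul]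
  push_cast
  field_simp

/-- The mean value of the step function. -/
def stepMean (b₁ b₂ b₃ b₄ : ℂ) (p : ℝ) : ℂ :=
  1 / (2 * Real.pi) * (p * b₄ + (Real.pi - p) * b₁ + p * b₂ + (Real.pi - p) * b₃)

/-- The canonical decomposition of the Poisson extension. -/
theorem poissonExtension_eq_logSum (hp : p ∈ Set.Ioo 0 Real.pi) {z : ℂ} (hz : z ∈ disk) :
    poissonExtension (stepFunction b₁ b₂ b₃ b₄ p) z =
      stepMean b₁ b₂ b₃ b₄ p +
      logSum (Complex.exp (Complex.I * p)) (b₄ - b₃) (b₁ - b₄) (b₂ - b₁) (b₃ - b₂) z +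
      conj (logSum (Complex.exp (Complex.I * p)) (conj (b₄ - b₃)) (conj (b₁ - b₄))
        (conj (b₂ - b₁)) (conj (b₃ - b₂)) z) := by
  rw [poissonExtension_stepFunction hp hz]
  simp only [arcMeasure_eq hz, kernelPrimitive]
  have h0 : Complex.exp (Complex.I * ((0 : ℝ) : ℂ)) = 1 := by simp
  have h2 : Complex.exp (Complex.I * (Real.pi : ℂ)) = -1 := by
    rw [mul_comm]; exact Complex.exp_pi_mul_I
  have h3 : Complex.exp (Complex.I * ((Real.pi + p : ℝ) : ℂ)) =
      -Complex.exp (Complex.I * (p : ℂ)) := by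
    push_cast
    rw [mul_add, Complex.exp_add, h2]; ring
  have h4 : Complex.exp (Complex.I * ((2 * Real.pi : ℝ) : ℂ)) = 1 := by
    rw [mul_comm]; push_cast; exact Complex.exp_two_pi_mul_I
  rw [h0, h2, h3, h4]
  simp only [logSum, stepMean]
  generalize Complex.log (1 - z / 1) = L₀
  generalize Complex.log (1 - z / Complex.exp (Complex.I * (p : ℂ))) = L₁
  generalize Complex.log (1 - z / -1) = L₂
  generalize Complex.log (1 - z / -Complex.exp (Complex.I * (p : ℂ))) = L₃
  have him : ∀ L : ℂ, ((L.im : ℝ) : ℂ) = (L - conj L) / (2 * Complex.I) := fun L => by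
    rw [Complex.im_eq_sub_conj]
  have hpi : (Real.pi : ℂ) ≠ 0 := by exact_mod_cast Real.pi_ne_zero
  push_cast
  simp only [him, map_mul, map_add, map_sub, map_neg, map_div₀, map_one, Complex.conj_conj,
    Complex.conj_I, Complex.conj_ofReal, map_ofNat]
  field_simp
  ring

/-! ### Boundary behaviour of the Poisson extension -/

/-- A convex combination of four points with two vanishing weights tends to a segment. -/
theorem tendsto_infDist_segment {l : Filter ℂ} {μ₀ μ₁ μ₂ μ₃ : ℂ → ℝ} {f : ℂ → ℂ} {v₀ v₁ v₂ v₃ : ℂ}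
    (h0 : ∀ᶠ z in l, 0 ≤ μ₀ z) (h1 : ∀ᶠ z in l, 0 ≤ μ₁ z) (h2 : ∀ᶠ z in l, 0 ≤ μ₂ z)
    (h3 : ∀ᶠ z in l, 0 ≤ μ₃ z)
    (hsum : ∀ᶠ z in l, μ₀ z + μ₁ z + μ₂ z + μ₃ z = 1)
    (hf : ∀ᶠ z in l, f z = μ₀ z * v₀ + μ₁ z * v₁ + μ₂ z * v₂ + μ₃ z * v₃)
    (t2 : Filter.Tendsto μ₂ l (𝓝 0)) (t3 : Filter.Tendsto μ₃ l (𝓝 0)) :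
    Filter.Tendsto (fun z => Metric.infDist (f z) (segment ℝ v₀ v₁)) l (𝓝 0) := by
  have hup : Filter.Tendsto (fun z => μ₂ z * ‖v₂ - v₁‖ + μ₃ z * ‖v₃ - v₁‖) l (𝓝 0) := by
    simpa using (t2.mul_const ‖v₂ - v₁‖).add (t3.mul_const ‖v₃ - v₁‖)
  refine tendsto_of_tendsto_of_tendsto_of_le_of_le' tendsto_const_nhds hup
    (Filter.Eventually.of_forall fun _ => Metric.infDist_nonneg) ?_
  filter_upwards [h0, h1, h2, h3, hsum, hf] with z p0 p1 p2 p3 ps pf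
  have hmem : (μ₀ z : ℂ) * v₀ + (1 - μ₀ z : ℝ) * v₁ ∈ segment ℝ v₀ v₁ :=
    ⟨μ₀ z, 1 - μ₀ z, p0, by linarith, by ring, by simp⟩
  refine (Metric.infDist_le_dist_of_mem hmem).trans ?_
  rw [dist_eq_norm, pf]
  have e : (μ₀ z : ℂ) * v₀ + μ₁ z * v₁ + μ₂ z * v₂ + μ₃ z * v₃ -
      ((μ₀ z : ℂ) * v₀ + (1 - μ₀ z : ℝ) * v₁) = μ₂ z * (v₂ - v₁) + μ₃ z * (v₃ - v₁) := by
    have : (μ₀ z : ℂ) + μ₁ z + μ₂ z + μ₃ z = 1 := by exact_mod_cast ps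
    push_cast
    linear_combination v₁ * this
  rw [e]
  refine (norm_add_le _ _).trans_eq ?_
  rw [norm_mul, norm_mul, Complex.norm_real, Complex.norm_real, Real.norm_of_nonneg p2,
    Real.norm_of_nonneg p3]

theorem exp_ne_of_notMem {t α β : ℝ} (ht : t ∈ Set.Ico 0 (2 * Real.pi)) (hα : 0 ≤ α)
    (hβ : β ≤ 2 * Real.pi) (hoff : t ∉ Set.Icc α β) (hend : β < 2 * Real.pi ∨ t ≠ 0) :
    ∀ θ ∈ Set.Icc α β, Complex.exp (Complex.I * θ) ≠ Complex.exp (Complex.I * t) := by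
  intro θ hθ h
  obtain ⟨n, hn⟩ := Complex.exp_eq_exp_iff_exists_int.mp h
  have hreal : θ = t + n * (2 * Real.pi) := by
    have h2 : Complex.I * (θ : ℂ) = Complex.I * ((t + n * (2 * Real.pi) : ℝ) : ℂ) := by
      rw [hn]; push_cast; ring
    exact_mod_cast mul_left_cancel₀ Complex.I_ne_zero h2
  have hpi := Real.pi_pos
  have hn0 : n ≠ 0 := by
    rintro rfl
    rw [Int.cast_zero, zero_mul, add_zero] at hreal
    exact hoff (hreal ▸ hθ)
  rcases lt_or_gt_of_ne hn0 with hneg | hpos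
  · have : (n : ℝ) ≤ -1 := by exact_mod_cast Int.le_sub_one_of_lt hneg
    nlinarith [ht.2, hθ.1]
  · have : (1 : ℝ) ≤ n := by exact_mod_cast hpos
    have h3 : t + 2 * Real.pi ≤ θ := by nlinarith
    rcases hend with he | he
    · linarith [ht.1, hθ.2]
    · exact he (le_antisymm (by linarith [hθ.2]) ht.1)

variable {b₁ b₂ b₃ b₄ : ℂ} {p : ℝ}

/-- At a point of the circle, the Poisson extension tends to a side; the point is the
corresponding jump point unless there are two such sides. -/
theorem poissonExtension_boundary (hp : p ∈ Set.Ioo 0 Real.pi) {ζ : ℂ} (hζ : ‖ζ‖ = 1) :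
    let f := poissonExtension (stepFunction b₁ b₂ b₃ b₄ p)
    let R := fun S : Set ℂ => Filter.Tendsto (fun z => Metric.infDist (f z) S) (𝓝[disk] ζ) (𝓝 0)
    (ζ = 1 ∧ R (segment ℝ b₃ b₄)) ∨ (ζ = Complex.exp (Complex.I * p) ∧ R (segment ℝ b₄ b₁)) ∨
    (ζ = -1 ∧ R (segment ℝ b₁ b₂)) ∨ (ζ = -Complex.exp (Complex.I * p) ∧ R (segment ℝ b₂ b₃)) ∨
    (R (segment ℝ b₃ b₄) ∧ R (segment ℝ b₄ b₁)) ∨ (R (segment ℝ b₄ b₁) ∧ R (segment ℝ b₁ b₂)) ∨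
    (R (segment ℝ b₁ b₂) ∧ R (segment ℝ b₂ b₃)) ∨ (R (segment ℝ b₂ b₃) ∧ R (segment ℝ b₃ b₄)) := by
  intro f R
  obtain ⟨hp0, hp1⟩ := hp
  have hpi := Real.pi_pos
  have le0 : (0 : ℝ) ≤ p := hp0.le
  have le2 : Real.pi ≤ Real.pi + p := by linarith
  have le3 : Real.pi + p ≤ 2 * Real.pi := by linarith
  have hD : ∀ᶠ z in 𝓝[disk] ζ, z ∈ disk := self_mem_nhdsWithin
  have n0 : ∀ᶠ z in 𝓝[disk] ζ, 0 ≤ arcMeasure z 0 p := hD.mono fun z hz => arcMeasure_nonneg hz le0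
  have n1 : ∀ᶠ z in 𝓝[disk] ζ, 0 ≤ arcMeasure z p Real.pi :=
    hD.mono fun z hz => arcMeasure_nonneg hz hp1.le
  have n2 : ∀ᶠ z in 𝓝[disk] ζ, 0 ≤ arcMeasure z Real.pi (Real.pi + p) :=
    hD.mono fun z hz => arcMeasure_nonneg hz le2
  have n3 : ∀ᶠ z in 𝓝[disk] ζ, 0 ≤ arcMeasure z (Real.pi + p) (2 * Real.pi) :=
    hD.mono fun z hz => arcMeasure_nonneg hz le3
  have hs : ∀ᶠ z in 𝓝[disk] ζ, arcMeasure z 0 p + arcMeasure z p Real.pi +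
      arcMeasure z Real.pi (Real.pi + p) + arcMeasure z (Real.pi + p) (2 * Real.pi) = 1 :=
    hD.mono fun z hz => by
      rw [arcMeasure_add hz, arcMeasure_add hz, arcMeasure_add hz, arcMeasure_two_pi hz]
  have hf : ∀ᶠ z in 𝓝[disk] ζ, f z = arcMeasure z 0 p * b₄ + arcMeasure z p Real.pi * b₁ +
      arcMeasure z Real.pi (Real.pi + p) * b₂ +
      arcMeasure z (Real.pi + p) (2 * Real.pi) * b₃ :=
    hD.mono fun z hz => poissonExtension_stepFunction ⟨hp0, hp1⟩ hz
  have r0 : (∀ θ ∈ Set.Icc p Real.pi, Complex.exp (Complex.I * θ) ≠ ζ) →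
      (∀ θ ∈ Set.Icc Real.pi (Real.pi + p), Complex.exp (Complex.I * θ) ≠ ζ) →
      R (segment ℝ b₃ b₄) := fun o1 o2 =>
    tendsto_infDist_segment (v₂ := b₁) (v₃ := b₂) n3 n0 n1 n2 (hs.mono fun z h => by linarith)
      (hf.mono fun z h => by rw [h]; ring)
      (tendsto_arcMeasure hζ hp1.le o1) (tendsto_arcMeasure hζ le2 o2)
  have r1 : (∀ θ ∈ Set.Icc Real.pi (Real.pi + p), Complex.exp (Complex.I * θ) ≠ ζ) →
      (∀ θ ∈ Set.Icc (Real.pi + p) (2 * Real.pi), Complex.exp (Complex.I * θ) ≠ ζ) →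
      R (segment ℝ b₄ b₁) := fun o2 o3 =>
    tendsto_infDist_segment (v₂ := b₂) (v₃ := b₃) n0 n1 n2 n3 (hs.mono fun z h => by linarith)
      (hf.mono fun z h => by rw [h])
      (tendsto_arcMeasure hζ le2 o2) (tendsto_arcMeasure hζ le3 o3)
  have r2 : (∀ θ ∈ Set.Icc (Real.pi + p) (2 * Real.pi), Complex.exp (Complex.I * θ) ≠ ζ) →
      (∀ θ ∈ Set.Icc 0 p, Complex.exp (Complex.I * θ) ≠ ζ) →
      R (segment ℝ b₁ b₂) := fun o3 o0 =>
    tendsto_infDist_segment (v₂ := b₃) (v₃ := b₄) n1 n2 n3 n0 (hs.mono fun z h => by linarith)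
      (hf.mono fun z h => by rw [h]; ring)
      (tendsto_arcMeasure hζ le3 o3) (tendsto_arcMeasure hζ le0 o0)
  have r3 : (∀ θ ∈ Set.Icc 0 p, Complex.exp (Complex.I * θ) ≠ ζ) →
      (∀ θ ∈ Set.Icc p Real.pi, Complex.exp (Complex.I * θ) ≠ ζ) →
      R (segment ℝ b₂ b₃) := fun o0 o1 =>
    tendsto_infDist_segment (v₂ := b₄) (v₃ := b₁) n2 n3 n0 n1 (hs.mono fun z h => by linarith)
      (hf.mono fun z h => by rw [h]; ring)
      (tendsto_arcMeasure hζ le0 o0) (tendsto_arcMeasure hζ hp1.le o1)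
  obtain ⟨t, ht, hte⟩ : ∃ t ∈ Set.Ico 0 (2 * Real.pi), Complex.exp (Complex.I * t) = ζ := by
    refine ⟨toIcoMod Real.two_pi_pos 0 ζ.arg, ?_, ?_⟩
    · simpa using toIcoMod_mem_Ico Real.two_pi_pos 0 ζ.arg
    · have h1 := Complex.norm_mul_exp_arg_mul_I ζ
      rw [hζ, Complex.ofReal_one, one_mul] at h1
      rw [toIcoMod]
      rw [← h1]
      refine Complex.exp_eq_exp_iff_exists_int.mpr
        ⟨-(toIcoDiv Real.two_pi_pos 0 (Complex.exp (ζ.arg * Complex.I)).arg), ?_⟩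
      rw [h1]
      push_cast
      simp only [zsmul_eq_mul]
      ring
  have off : ∀ α β : ℝ, 0 ≤ α → β ≤ 2 * Real.pi → t ∉ Set.Icc α β → (β < 2 * Real.pi ∨ t ≠ 0) →
      ∀ θ ∈ Set.Icc α β, Complex.exp (Complex.I * θ) ≠ ζ := by
    intro α β h1 h2 h3 h4
    rw [← hte]
    exact exp_ne_of_notMem ht h1 h2 h3 h4
  have off0 : p < t → ∀ θ ∈ Set.Icc 0 p, Complex.exp (Complex.I * θ) ≠ ζ := fun h =>
    off 0 p le_rfl (by linarith) (fun h' => by linarith [h'.2]) (Or.inl (by linarith))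
  have off1 : t < p ∨ Real.pi < t → ∀ θ ∈ Set.Icc p Real.pi, Complex.exp (Complex.I * θ) ≠ ζ :=
    fun h => off p Real.pi le0 (by linarith)
      (fun h' => by rcases h with h | h <;> linarith [h'.1, h'.2]) (Or.inl (by linarith))
  have off2 : t < Real.pi ∨ Real.pi + p < t →
      ∀ θ ∈ Set.Icc Real.pi (Real.pi + p), Complex.exp (Complex.I * θ) ≠ ζ :=
    fun h => off Real.pi (Real.pi + p) hpi.le le3
      (fun h' => by rcases h with h | h <;> linarith [h'.1, h'.2]) (Or.inl (by linarith))
  have off3 : t < Real.pi + p → t ≠ 0 →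
      ∀ θ ∈ Set.Icc (Real.pi + p) (2 * Real.pi), Complex.exp (Complex.I * θ) ≠ ζ :=
    fun h h0 => off (Real.pi + p) (2 * Real.pi) (by linarith) le_rfl
      (fun h' => by linarith [h'.1]) (Or.inr h0)
  have hexpπ : Complex.exp (Complex.I * (Real.pi : ℂ)) = -1 := by
    rw [mul_comm]; exact Complex.exp_pi_mul_I
  rcases eq_or_lt_of_le ht.1 with h0 | h0
  · refine Or.inl ⟨?_, r0 (off1 (Or.inl (by linarith))) (off2 (Or.inl (by linarith)))⟩
    rw [← hte, ← h0]; simp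
  rcases lt_trichotomy t p with h | h | h
  · have a1 := off1 (Or.inl h)
    have a2 := off2 (Or.inl (by linarith))
    have a3 := off3 (by linarith) h0.ne'
    exact Or.inr (Or.inr (Or.inr (Or.inr (Or.inl ⟨r0 a1 a2, r1 a2 a3⟩))))
  · refine Or.inr (Or.inl ⟨by rw [← hte, h], r1 (off2 (Or.inl (by linarith))) (off3 (by linarith) h0.ne')⟩)
  have a0 := off0 h
  rcases lt_trichotomy t Real.pi with h' | h' | h'
  · have a2 := off2 (Or.inl h')
    have a3 := off3 (by linarith) h0.ne'
    exact Or.inr (Or.inr (Or.inr (Or.inr (Or.inr (Or.inl ⟨r1 a2 a3, r2 a3 a0⟩)))))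
  · exact Or.inr (Or.inr (Or.inl ⟨by rw [← hte, h', hexpπ], r2 (off3 (by linarith) h0.ne') a0⟩))
  have a1 := off1 (Or.inr h')
  rcases lt_trichotomy t (Real.pi + p) with k | k | k
  · have a3 := off3 k h0.ne'
    exact Or.inr (Or.inr (Or.inr (Or.inr (Or.inr (Or.inr (Or.inl ⟨r2 a3 a0, r3 a0 a1⟩))))))
  · refine Or.inr (Or.inr (Or.inr (Or.inl ⟨?_, r3 a0 a1⟩)))
    rw [← hte, k]
    push_cast
    rw [mul_add, Complex.exp_add, hexpπ]; ring
  · have a2 := off2 (Or.inr k)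
    exact Or.inr (Or.inr (Or.inr (Or.inr (Or.inr (Or.inr (Or.inr ⟨r3 a0 a1, r0 a1 a2⟩))))))

theorem poissonExtension_tendsto_quadBoundary (hp : p ∈ Set.Ioo 0 Real.pi) {ζ : ℂ}
    (hζ : ‖ζ‖ = 1) :
    Filter.Tendsto (fun z => Metric.infDist (poissonExtension (stepFunction b₁ b₂ b₃ b₄ p) z)
      (quadBoundary b₁ b₂ b₃ b₄)) (𝓝[disk] ζ) (𝓝 0) := by
  have mono : ∀ u v : ℂ, segment ℝ u v ⊆ quadBoundary b₁ b₂ b₃ b₄ →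
      Filter.Tendsto (fun z => Metric.infDist (poissonExtension (stepFunction b₁ b₂ b₃ b₄ p) z)
        (segment ℝ u v)) (𝓝[disk] ζ) (𝓝 0) →
      Filter.Tendsto (fun z => Metric.infDist (poissonExtension (stepFunction b₁ b₂ b₃ b₄ p) z)
        (quadBoundary b₁ b₂ b₃ b₄)) (𝓝[disk] ζ) (𝓝 0) := fun u v hsub h =>
    tendsto_of_tendsto_of_tendsto_of_le_of_le tendsto_const_nhds h
      (fun _ => Metric.infDist_nonneg)
      (fun _ => Metric.infDist_le_infDist_of_subset hsub ⟨u, left_mem_segment ℝ u v⟩)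
  have s0 : segment ℝ b₃ b₄ ⊆ quadBoundary b₁ b₂ b₃ b₄ := by
    rw [quadBoundary_eq]; exact fun x hx => Or.inl (Or.inr hx)
  have s1 : segment ℝ b₄ b₁ ⊆ quadBoundary b₁ b₂ b₃ b₄ := by
    rw [quadBoundary_eq]; exact fun x hx => Or.inr hx
  have s2 : segment ℝ b₁ b₂ ⊆ quadBoundary b₁ b₂ b₃ b₄ := by
    rw [quadBoundary_eq]; exact fun x hx => Or.inl (Or.inl (Or.inl hx))
  have s3 : segment ℝ b₂ b₃ ⊆ quadBoundary b₁ b₂ b₃ b₄ := by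
    rw [quadBoundary_eq]; exact fun x hx => Or.inl (Or.inl (Or.inr hx))
  rcases poissonExtension_boundary (b₁ := b₁) (b₂ := b₂) (b₃ := b₃) (b₄ := b₄) hp hζ with
    h | h | h | h | h | h | h | h
  · exact mono _ _ s0 h.2
  · exact mono _ _ s1 h.2
  · exact mono _ _ s2 h.2
  · exact mono _ _ s3 h.2
  · exact mono _ _ s0 h.1
  · exact mono _ _ s1 h.1
  · exact mono _ _ s2 h.1
  · exact mono _ _ s3 h.1

theorem isBounded_image_poissonExtension (hp : p ∈ Set.Ioo 0 Real.pi) :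
    Bornology.IsBounded (poissonExtension (stepFunction b₁ b₂ b₃ b₄ p) '' disk) := by
  refine (Metric.isBounded_closedBall (x := (0 : ℂ))
    (r := ‖b₄‖ + ‖b₁‖ + ‖b₂‖ + ‖b₃‖)).subset ?_
  rintro _ ⟨z, hz, rfl⟩
  obtain ⟨hp0, hp1⟩ := hp
  have hpi := Real.pi_pos
  rw [mem_closedBall_zero_iff, poissonExtension_stepFunction ⟨hp0, hp1⟩ hz]
  have n0 := arcMeasure_nonneg hz hp0.le
  have n1 := arcMeasure_nonneg hz hp1.le
  have n2 := arcMeasure_nonneg hz (show Real.pi ≤ Real.pi + p by linarith)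
  have n3 := arcMeasure_nonneg hz (show Real.pi + p ≤ 2 * Real.pi by linarith)
  have hs : arcMeasure z 0 p + arcMeasure z p Real.pi + arcMeasure z Real.pi (Real.pi + p) +
      arcMeasure z (Real.pi + p) (2 * Real.pi) = 1 := by
    rw [arcMeasure_add hz, arcMeasure_add hz, arcMeasure_add hz, arcMeasure_two_pi hz]
  have hterm : ∀ (m : ℝ) (v : ℂ), 0 ≤ m → m ≤ 1 → ‖(m : ℂ) * v‖ ≤ ‖v‖ := fun m v h0 h1 => by
    rw [norm_mul, Complex.norm_real, Real.norm_of_nonneg h0]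
    exact mul_le_of_le_one_left (norm_nonneg v) h1
  refine (norm_add_le _ _).trans (add_le_add ((norm_add_le _ _).trans (add_le_add
    ((norm_add_le _ _).trans (add_le_add ?_ ?_)) ?_)) ?_) <;>
  exact hterm _ _ (by assumption) (by linarith)

/-! ### Minimal graphs from Weierstrass data -/

/-- Weierstrass data on the disk: `f = h + conj g`, `g' = q² h'`, `T = 2 Im W`, `W' = q h'`. -/
structure IsWeierstrassData (f h g q W : ℂ → ℂ) (T : ℂ → ℝ) : Prop where
  h_holo : DifferentiableOn ℂ h disk
  g_holo : DifferentiableOn ℂ g disk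
  q_holo : DifferentiableOn ℂ q disk
  f_eq : ∀ z ∈ disk, f z = h z + conj (g z)
  h_ne : ∀ z ∈ disk, deriv h z ≠ 0
  g_deriv : ∀ z ∈ disk, deriv g z = q z ^ 2 * deriv h z
  q_lt : ∀ z ∈ disk, ‖q z‖ < 1
  W_deriv : ∀ z ∈ disk, HasDerivAt W (deriv h z * q z) z
  T_eq : ∀ z ∈ disk, T z = 2 * (W z).im

/-- The real-linear map `ζ ↦ α ζ + conj (β ζ)`. -/
def harmonicLinear (α β : ℂ) : ℂ →L[ℝ] ℂ :=
  ContinuousLinearMap.mul ℝ ℂ α +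
    (Complex.conjCLE : ℂ →L[ℝ] ℂ).comp (ContinuousLinearMap.mul ℝ ℂ β)

theorem harmonicLinear_apply (α β ζ : ℂ) : harmonicLinear α β ζ = α * ζ + conj (β * ζ) := by
  simp [harmonicLinear]

theorem exists_equiv_harmonicLinear {α β : ℂ} (h : ‖β‖ < ‖α‖) :
    ∃ e : ℂ ≃L[ℝ] ℂ, (e : ℂ →L[ℝ] ℂ) = harmonicLinear α β := by
  have hinj : Function.Injective (harmonicLinear α β : ℂ →ₗ[ℝ] ℂ) := by
    rw [injective_iff_map_eq_zero]
    intro ζ hζ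
    have h1 : α * ζ + conj (β * ζ) = 0 := by rw [← harmonicLinear_apply]; exact hζ
    by_contra hne
    have h2 : ‖α * ζ‖ = ‖β * ζ‖ := by
      rw [eq_neg_of_add_eq_zero_left h1, norm_neg, RCLike.norm_conj]
    rw [norm_mul, norm_mul] at h2
    exact h.ne (mul_right_cancel₀ (norm_ne_zero_iff.mpr hne) h2).symm
  refine ⟨(LinearEquiv.ofInjectiveEndo _ hinj).toContinuousLinearEquiv, ?_⟩
  ext ζ
  all_goals rfl

namespace IsWeierstrassData

variable {f h g q W : ℂ → ℂ} {T : ℂ → ℝ} (H : IsWeierstrassData f h g q W T)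
include H

theorem eventuallyEq {z : ℂ} (hz : z ∈ disk) : f =ᶠ[𝓝 z] fun x => h x + conj (g x) := by
  filter_upwards [isOpen_disk.mem_nhds hz] with x hx using H.f_eq x hx

theorem norm_deriv_lt {z : ℂ} (hz : z ∈ disk) : ‖deriv g z‖ < ‖deriv h z‖ := by
  rw [H.g_deriv z hz, norm_mul, norm_pow]
  have h1 := norm_pos_iff.mpr (H.h_ne z hz)
  have h2 : ‖q z‖ ^ 2 < 1 := pow_lt_one₀ (norm_nonneg _) (H.q_lt z hz) two_ne_zero
  nlinarith

theorem hasFDerivAt {z : ℂ} (hz : z ∈ disk) :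
    HasFDerivAt f (harmonicLinear (deriv h z) (deriv g z)) z := by
  have dh := (H.h_holo.differentiableAt (isOpen_disk.mem_nhds hz)).hasDerivAt
  have dg := (H.g_holo.differentiableAt (isOpen_disk.mem_nhds hz)).hasDerivAt
  have d1 := dh.hasFDerivAt.restrictScalars ℝ
  have d2 := (Complex.conjCLE : ℂ →L[ℝ] ℂ).hasFDerivAt.comp z (dg.hasFDerivAt.restrictScalars ℝ)
  have d3 := (d1.add d2).congr_of_eventuallyEq (H.eventuallyEq hz)
  refine d3.congr_fderiv ?_
  ext ζ
  all_goals simp [harmonicLinear_apply]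
  all_goals ring

theorem contDiffAt {z : ℂ} (hz : z ∈ disk) : ContDiffAt ℝ ∞ f z := by
  have c1 : ContDiffAt ℝ ∞ h z :=
    ((H.h_holo.contDiffOn isOpen_disk).contDiffAt (isOpen_disk.mem_nhds hz)).restrict_scalars ℝ
  have c2 : ContDiffAt ℝ ∞ g z :=
    ((H.g_holo.contDiffOn isOpen_disk).contDiffAt (isOpen_disk.mem_nhds hz)).restrict_scalars ℝ
  have c3 : ContDiffAt ℝ ∞ (fun x => conj (g x)) z :=
    Complex.conjCLE.contDiff.contDiffAt.comp z c2
  exact (c1.add c3).congr_of_eventuallyEq (H.eventuallyEq hz)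

theorem contDiffAt_height {z : ℂ} (hz : z ∈ disk) : ContDiffAt ℝ ∞ T z := by
  have hW : DifferentiableOn ℂ W disk := fun x hx =>
    (H.W_deriv x hx).differentiableAt.differentiableWithinAt
  have c1 : ContDiffAt ℝ ∞ W z :=
    ((hW.contDiffOn isOpen_disk).contDiffAt (isOpen_disk.mem_nhds hz)).restrict_scalars ℝ
  have c2 : ContDiffAt ℝ ∞ (fun x => 2 * (W x).im) z :=
    contDiffAt_const.mul (Complex.imCLM.contDiff.contDiffAt.comp z c1)
  refine c2.congr_of_eventuallyEq ?_
  filter_upwards [isOpen_disk.mem_nhds hz] with x hx using H.T_eq x hx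

/-- The local inverse at a point of the disk. -/
theorem exists_local_inverse {z : ℂ} (hz : z ∈ disk) :
    ∃ e : OpenPartialHomeomorph ℂ ℂ, z ∈ e.source ∧ ⇑e = f ∧ ContDiffAt ℝ ∞ e.symm (f z) := by
  obtain ⟨e', he'⟩ := exists_equiv_harmonicLinear (H.norm_deriv_lt hz)
  have hd : HasFDerivAt f (e' : ℂ →L[ℝ] ℂ) z := by rw [he']; exact H.hasFDerivAt hz
  have hs : HasStrictFDerivAt f (e' : ℂ →L[ℝ] ℂ) z :=
    (H.contDiffAt hz).hasStrictFDerivAt' hd (by simp)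
  refine ⟨hs.toOpenPartialHomeomorph f, hs.mem_toOpenPartialHomeomorph_source, rfl, ?_⟩
  have hleft : (hs.toOpenPartialHomeomorph f).symm (f z) = z :=
    (hs.toOpenPartialHomeomorph f).left_inv hs.mem_toOpenPartialHomeomorph_source
  refine OpenPartialHomeomorph.contDiffAt_symm _ hs.image_mem_toOpenPartialHomeomorph_target
    (f₀' := e') ?_ ?_
  · rw [hleft]; exact hd
  · rw [hleft]; exact H.contDiffAt hz

theorem isLocalHomeomorphOn : IsLocalHomeomorphOn f disk := by
  intro z hz
  obtain ⟨e, he, hef, -⟩ := H.exists_local_inverse hz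
  exact ⟨e, he, hef.symm⟩

theorem contDiffAt_inverse {Q : Set ℂ} {ψ : ℂ → ℂ}
    (hψ : Set.InvOn ψ f disk Q) {z : ℂ} (hz : z ∈ disk) : ContDiffAt ℝ ∞ ψ (f z) := by
  obtain ⟨e, he, hef, hc⟩ := H.exists_local_inverse hz
  refine hc.congr_of_eventuallyEq ?_
  have ht : f z ∈ e.target := by rw [← hef]; exact e.map_source he
  have hcont := e.continuousAt_symm ht
  have hinv : e.symm (f z) = z := by rw [← hef]; exact e.left_inv he
  have h1 : ∀ᶠ w in 𝓝 (f z), e.symm w ∈ disk :=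
    hcont (by rw [hinv]; exact isOpen_disk.mem_nhds hz)
  filter_upwards [h1, e.open_target.mem_nhds ht] with w hw1 hw2
  have h2 : f (e.symm w) = w := by rw [← hef]; exact e.right_inv hw2
  conv_lhs => rw [← h2]
  exact hψ.1 hw1

/-- Directional derivatives of a function on the image, computed in the disk. -/
theorem fderiv_apply {φ Φ : ℂ → ℝ} {z ζ : ℂ} {m : ℝ} (hz : z ∈ disk)
    (hφ : DifferentiableAt ℝ φ (f z)) (heq : ∀ x ∈ disk, φ (f x) = Φ x)
    (hm : HasDerivAt (fun t : ℝ => Φ (z + t * ζ)) m 0) :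
    fderiv ℝ φ (f z) (deriv h z * ζ + conj (deriv g z * ζ)) = m := by
  have hc : HasDerivAt (fun t : ℝ => z + t * ζ) ζ 0 := by
    have := ((Complex.ofRealCLM.hasDerivAt (x := (0 : ℝ))).mul_const ζ).const_add z
    simpa using this
  have hc0 : z + ((0 : ℝ) : ℂ) * ζ = z := by simp
  have h1 : HasDerivAt (fun t : ℝ => φ (f (z + t * ζ)))
      (fderiv ℝ φ (f z) (harmonicLinear (deriv h z) (deriv g z) ζ)) 0 := by
    have h2 := (H.hasFDerivAt hz).comp_hasDerivAt_of_eq (0 : ℝ) hc hc0.symm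
    exact hφ.hasFDerivAt.comp_hasDerivAt_of_eq (0 : ℝ) h2 (by simp)
  have h5 : (fun t : ℝ => φ (f (z + t * ζ))) =ᶠ[𝓝 0] fun t : ℝ => Φ (z + t * ζ) := by
    have : ∀ᶠ t : ℝ in 𝓝 0, z + t * ζ ∈ disk :=
      hc.continuousAt (by rw [hc0]; exact isOpen_disk.mem_nhds hz)
    filter_upwards [this] with t ht using heq _ ht
  rw [← harmonicLinear_apply]
  exact h1.unique (hm.congr_of_eventuallyEq h5)

/-- The preimage of a direction under the derivative of `f`. -/
theorem fderiv_apply_direction {φ Φ : ℂ → ℝ} {z : ℂ} (v : ℂ) {m : ℝ} (hz : z ∈ disk)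
    (hφ : DifferentiableAt ℝ φ (f z)) (heq : ∀ x ∈ disk, φ (f x) = Φ x)
    (hm : HasDerivAt (fun t : ℝ => Φ (z + t * ((v - conj (q z) ^ 2 * conj v) /
      ((1 - ‖q z‖ ^ 4 : ℝ) * deriv h z)))) m 0) :
    fderiv ℝ φ (f z) v = m := by
  rw [← H.fderiv_apply hz hφ heq hm]
  congr 1
  have hh := H.h_ne z hz
  have hq : (1 - ‖q z‖ ^ 4 : ℝ) ≠ 0 := by
    have : ‖q z‖ ^ 4 < 1 := pow_lt_one₀ (norm_nonneg _) (H.q_lt z hz) (by norm_num)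
    linarith
  have hn : ((1 - ‖q z‖ ^ 4 : ℝ) : ℂ) = 1 - q z ^ 2 * conj (q z) ^ 2 := by
    rw [← mul_pow, Complex.mul_conj, Complex.normSq_eq_norm_sq]; push_cast; ring
  have hqc : ((1 - ‖q z‖ ^ 4 : ℝ) : ℂ) ≠ 0 := by exact_mod_cast hq
  rw [H.g_deriv z hz]
  have e1 : deriv h z * ((v - conj (q z) ^ 2 * conj v) / ((1 - ‖q z‖ ^ 4 : ℝ) * deriv h z)) =
      (v - conj (q z) ^ 2 * conj v) / (1 - ‖q z‖ ^ 4 : ℝ) := by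
    field_simp
  rw [mul_assoc, e1, map_mul, map_div₀, Complex.conj_ofReal, map_sub, map_mul, map_pow, map_pow,
    Complex.conj_conj, Complex.conj_conj, mul_div_assoc', ← add_div, eq_div_iff hqc, hn]
  ring

/-- The first partial derivatives of the graph function. -/
theorem partial_eq {k : ℂ → ℝ} (hk : ∀ z ∈ disk, k (f z) = T z) {z : ℂ} (hz : z ∈ disk)
    (hd : DifferentiableAt ℝ k (f z)) :
    partialU k (f z) = 2 * (q z).im / (1 - ((q z).re ^ 2 + (q z).im ^ 2)) ∧
    partialV k (f z) = 2 * (q z).re / (1 - ((q z).re ^ 2 + (q z).im ^ 2)) := by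
  have hder : ∀ ζ : ℂ, HasDerivAt (fun t : ℝ => 2 * (W (z + t * ζ)).im)
      (2 * (deriv h z * q z * ζ).im) 0 := by
    intro ζ
    have hc : HasDerivAt (fun t : ℂ => z + t * ζ) ζ ((0 : ℝ) : ℂ) := by
      simpa using ((hasDerivAt_id (((0 : ℝ) : ℂ))).mul_const ζ).const_add z
    have hW := H.W_deriv z hz
    have h0 : z = z + ((0 : ℝ) : ℂ) * ζ := by simp
    rw [h0] at hW
    have h1 := (HasDerivAt.comp (((0 : ℝ) : ℂ)) hW hc).comp_ofReal
    rw [← h0] at h1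
    exact ((Complex.imCLM.hasFDerivAt.comp_hasDerivAt (0 : ℝ) h1)).const_mul 2
  have hk' : ∀ x ∈ disk, k (f x) = 2 * (W x).im := fun x hx => by rw [hk x hx, H.T_eq x hx]
  have hh := H.h_ne z hz
  have hq4 : ‖q z‖ ^ 4 = ((q z).re ^ 2 + (q z).im ^ 2) ^ 2 := by
    have : ‖q z‖ ^ 2 = (q z).re ^ 2 + (q z).im ^ 2 := by
      rw [Complex.sq_norm, Complex.normSq_apply]; ring
    rw [← this]; ring
  have hlt : (q z).re ^ 2 + (q z).im ^ 2 < 1 := by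
    have : ‖q z‖ ^ 2 = (q z).re ^ 2 + (q z).im ^ 2 := by
      rw [Complex.sq_norm, Complex.normSq_apply]; ring
    rw [← this]
    exact pow_lt_one₀ (norm_nonneg _) (H.q_lt z hz) two_ne_zero
  have n1 : 1 - ((q z).re ^ 2 + (q z).im ^ 2) ≠ 0 := by linarith
  have n2 : 1 - ((q z).re ^ 2 + (q z).im ^ 2) ^ 2 ≠ 0 := by nlinarith [sq_nonneg (q z).re, sq_nonneg (q z).im]
  have hsimp : ∀ v : ℂ, deriv h z * q z * ((v - conj (q z) ^ 2 * conj v) /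
      ((1 - ‖q z‖ ^ 4 : ℝ) * deriv h z)) =
      ((1 - ((q z).re ^ 2 + (q z).im ^ 2) ^ 2)⁻¹ : ℝ) * (q z * (v - conj (q z) ^ 2 * conj v)) := by
    intro v
    rw [hq4, Complex.ofReal_inv]
    have : ((1 - ((q z).re ^ 2 + (q z).im ^ 2) ^ 2 : ℝ) : ℂ) ≠ 0 := by exact_mod_cast n2
    generalize ((1 - ((q z).re ^ 2 + (q z).im ^ 2) ^ 2 : ℝ) : ℂ) = r at *
    field_simp
  constructor
  · rw [partialU, H.fderiv_apply_direction 1 hz hd hk' (hder _), hsimp,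
      Complex.im_ofReal_mul]
    simp [pow_two]
    field_simp
    ring
  · rw [partialV, H.fderiv_apply_direction Complex.I hz hd hk' (hder _), hsimp,
      Complex.im_ofReal_mul]
    simp [pow_two]
    field_simp
    ring

end IsWeierstrassData

/-- The Gauss map in terms of the partial derivatives given by a point of the disk. -/
theorem upwardNormal_eq {k : ℂ → ℝ} {w q : ℂ} (hq : ‖q‖ < 1)
    (hU : partialU k w = 2 * q.im / (1 - (q.re ^ 2 + q.im ^ 2)))
    (hV : partialV k w = 2 * q.re / (1 - (q.re ^ 2 + q.im ^ 2))) :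
    upwardNormal k w = invStereo (-Complex.I * conj q) := by
  have hn : ‖q‖ ^ 2 = q.re ^ 2 + q.im ^ 2 := by
    rw [Complex.sq_norm, Complex.normSq_apply]; ring
  have hlt : q.re ^ 2 + q.im ^ 2 < 1 := by
    rw [← hn]; exact pow_lt_one₀ (norm_nonneg _) hq two_ne_zero
  have n1 : 0 < 1 - (q.re ^ 2 + q.im ^ 2) := by linarith
  have n2 : 0 < 1 + (q.re ^ 2 + q.im ^ 2) := by positivity
  have hs : √(1 + partialU k w ^ 2 + partialV k w ^ 2) =
      (1 + (q.re ^ 2 + q.im ^ 2)) / (1 - (q.re ^ 2 + q.im ^ 2)) := by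
    rw [hU, hV, Real.sqrt_eq_iff_mul_self_eq (by positivity) (by positivity)]
    field_simp
    ring
  have hnorm : ‖-Complex.I * conj q‖ ^ 2 = q.re ^ 2 + q.im ^ 2 := by
    rw [norm_mul, norm_neg, Complex.norm_I, one_mul, RCLike.norm_conj, hn]
  rw [upwardNormal, invStereo, hs, hU, hV, hnorm]
  ext i
  fin_cases i
  · simp; field_simp
  · simp; field_simp
  · simp; field_simp

/-- The stereographic coordinate of a point of the sphere. -/
def stereo (n : EuclideanSpace ℝ (Fin 3)) : ℂ := ⟨n 0 / (1 + n 2), n 1 / (1 + n 2)⟩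

theorem norm_stereo_sq (n : EuclideanSpace ℝ (Fin 3)) :
    ‖stereo n‖ ^ 2 = (n 0 ^ 2 + n 1 ^ 2) / (1 + n 2) ^ 2 := by
  rw [Complex.sq_norm, Complex.normSq_apply, stereo, ← pow_two, ← pow_two, div_pow, div_pow,
    ← add_div]

theorem norm_sq_three (n : EuclideanSpace ℝ (Fin 3)) : ‖n‖ ^ 2 = n 0 ^ 2 + n 1 ^ 2 + n 2 ^ 2 := by
  rw [EuclideanSpace.norm_sq_eq, Fin.sum_univ_three]
  simp only [Real.norm_eq_abs, sq_abs]

theorem norm_stereo_lt {n : EuclideanSpace ℝ (Fin 3)} (hn : n ∈ upperHemisphere) :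
    ‖stereo n‖ < 1 := by
  obtain ⟨h1, h2⟩ := hn
  have h3 := norm_sq_three n
  rw [h1] at h3
  have h4 := norm_stereo_sq n
  have h5 : ‖stereo n‖ ^ 2 < 1 := by
    rw [h4, div_lt_one (by positivity)]
    nlinarith
  exact (sq_lt_one_iff₀ (norm_nonneg _)).mp h5

theorem invStereo_stereo {n : EuclideanSpace ℝ (Fin 3)} (hn : n ∈ upperHemisphere) :
    invStereo (stereo n) = n := by
  have h4 := norm_stereo_sq n
  obtain ⟨h1, h2⟩ := hn
  have h3 := norm_sq_three n
  rw [h1] at h3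
  have hp : 0 < 1 + n 2 := by linarith
  have h5 : ‖stereo n‖ ^ 2 = (1 - n 2) / (1 + n 2) := by
    rw [h4, div_eq_div_iff (by positivity) (by positivity)]
    linear_combination -(1 + n 2) * h3
  rw [invStereo, h5]
  have e1 : 1 + (1 - n 2) / (1 + n 2) = 2 / (1 + n 2) := by field_simp; ring
  have e2 : 1 - (1 - n 2) / (1 + n 2) = 2 * n 2 / (1 + n 2) := by field_simp; ring
  rw [e1, e2]
  ext i
  fin_cases i
  · simp [stereo]; field_simp
  · simp [stereo]; field_simp
  · simp; field_simp

theorem invStereo_apply (ζ : ℂ) : invStereo ζ 0 = 2 * ζ.re / (1 + ‖ζ‖ ^ 2) ∧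
    invStereo ζ 1 = 2 * ζ.im / (1 + ‖ζ‖ ^ 2) ∧
    invStereo ζ 2 = (1 - ‖ζ‖ ^ 2) / (1 + ‖ζ‖ ^ 2) := by
  refine ⟨?_, ?_, ?_⟩ <;> simp [invStereo] <;> ring

theorem stereo_invStereo (ζ : ℂ) : stereo (invStereo ζ) = ζ := by
  obtain ⟨h0, h1, h2⟩ := invStereo_apply ζ
  have hp : 0 < 1 + ‖ζ‖ ^ 2 := by positivity
  have e : 1 + (1 - ‖ζ‖ ^ 2) / (1 + ‖ζ‖ ^ 2) = 2 / (1 + ‖ζ‖ ^ 2) := by field_simp; ring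
  rw [stereo, h0, h1, h2, e]
  apply Complex.ext
  · simp only; field_simp
  · simp only; field_simp

theorem invStereo_mem {ζ : ℂ} (h : ‖ζ‖ < 1) : invStereo ζ ∈ upperHemisphere := by
  obtain ⟨h0, h1, h2⟩ := invStereo_apply ζ
  have hp : 0 < 1 + ‖ζ‖ ^ 2 := by positivity
  have hlt : ‖ζ‖ ^ 2 < 1 := pow_lt_one₀ (norm_nonneg _) h two_ne_zero
  have hn : ‖ζ‖ ^ 2 = ζ.re ^ 2 + ζ.im ^ 2 := by
    rw [Complex.sq_norm, Complex.normSq_apply]; ring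
  constructor
  · have h3 := norm_sq_three (invStereo ζ)
    have h4 : ‖invStereo ζ‖ ^ 2 = 1 := by
      rw [h3, h0, h1, h2, hn]
      rw [hn] at hp
      field_simp
      ring
    nlinarith [norm_nonneg (invStereo ζ)]
  · rw [h2]
    exact div_pos (by linarith) hp

theorem contDiffOn_complex_mk {E : Type*} [NormedAddCommGroup E] [NormedSpace ℝ E] {s : Set E}
    {a b : E → ℝ} (ha : ContDiffOn ℝ ∞ a s) (hb : ContDiffOn ℝ ∞ b s) :
    ContDiffOn ℝ ∞ (fun x => (⟨a x, b x⟩ : ℂ)) s := by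
  simp only [Complex.mk_eq_add_mul_I]
  exact (Complex.ofRealCLM.contDiff.comp_contDiffOn ha).add
    ((Complex.ofRealCLM.contDiff.comp_contDiffOn hb).mul contDiffOn_const)

theorem contDiffOn_stereo :
    ContDiffOn ℝ ∞ stereo {n : EuclideanSpace ℝ (Fin 3) | 0 < 1 + n 2} := by
  have hc : ∀ i : Fin 3, ContDiff ℝ ∞ fun n : EuclideanSpace ℝ (Fin 3) => n i := fun i =>
    contDiff_piLp_apply (p := 2) (E := fun _ : Fin 3 => ℝ)
  have h2 : ContDiffOn ℝ ∞ (fun n : EuclideanSpace ℝ (Fin 3) => 1 + n 2)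
      {n : EuclideanSpace ℝ (Fin 3) | 0 < 1 + n 2} := (contDiff_const.add (hc 2)).contDiffOn
  have hre := ((hc 0).contDiffOn (s := {n : EuclideanSpace ℝ (Fin 3) | 0 < 1 + n 2})).div h2
    (fun n hn => ne_of_gt hn)
  have him := ((hc 1).contDiffOn (s := {n : EuclideanSpace ℝ (Fin 3) | 0 < 1 + n 2})).div h2
    (fun n hn => ne_of_gt hn)
  exact contDiffOn_complex_mk hre him

theorem contDiffOn_vec {E : Type*} [NormedAddCommGroup E] [NormedSpace ℝ E] {s : Set E}
    {a b c : E → ℝ} (ha : ContDiffOn ℝ ∞ a s) (hb : ContDiffOn ℝ ∞ b s) (hc : ContDiffOn ℝ ∞ c s) :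
    ContDiffOn ℝ ∞ (fun x => (!₂[a x, b x, c x] : EuclideanSpace ℝ (Fin 3))) s := by
  rw [contDiffOn_euclidean]
  intro i
  fin_cases i
  · simpa using ha
  · simpa using hb
  · simpa using hc

/-- The pure algebra behind the minimal surface equation. -/
theorem minimal_surface_identity {x y a b n : ℝ} (hn : n = 1 - (x ^ 2 + y ^ 2)) (h0 : n ≠ 0)
    {x₁ y₁ x₂ y₂ : ℝ}
    (hx₁ : x₁ = a * (1 - x ^ 2 + y ^ 2) - b * (2 * x * y))
    (hy₁ : y₁ = a * (2 * x * y) + b * (1 - x ^ 2 + y ^ 2))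
    (hx₂ : x₂ = a * (2 * x * y) - b * (1 + x ^ 2 - y ^ 2))
    (hy₂ : y₂ = a * (1 + x ^ 2 - y ^ 2) + b * (2 * x * y)) :
    (1 + (2 * x / n) ^ 2) * ((2 * y₁ * n + 2 * y * (2 * x * x₁ + 2 * y * y₁)) / n ^ 2)
      - 2 * (2 * y / n) * (2 * x / n) * ((2 * y₂ * n + 2 * y * (2 * x * x₂ + 2 * y * y₂)) / n ^ 2)
      + (1 + (2 * y / n) ^ 2) * ((2 * x₂ * n + 2 * x * (2 * x * x₂ + 2 * y * y₂)) / n ^ 2) = 0 := by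
  have e : (1 + (2 * x / n) ^ 2) * ((2 * y₁ * n + 2 * y * (2 * x * x₁ + 2 * y * y₁)) / n ^ 2)
      - 2 * (2 * y / n) * (2 * x / n) * ((2 * y₂ * n + 2 * y * (2 * x * x₂ + 2 * y * y₂)) / n ^ 2)
      + (1 + (2 * y / n) ^ 2) * ((2 * x₂ * n + 2 * x * (2 * x * x₂ + 2 * y * y₂)) / n ^ 2)
      = ((n ^ 2 + (2 * x) ^ 2) * (2 * y₁ * n + 2 * y * (2 * x * x₁ + 2 * y * y₁))
      - 2 * (2 * y) * (2 * x) * (2 * y₂ * n + 2 * y * (2 * x * x₂ + 2 * y * y₂))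
      + (n ^ 2 + (2 * y) ^ 2) * (2 * x₂ * n + 2 * x * (2 * x * x₂ + 2 * y * y₂))) / n ^ 4 := by
    field_simp
  rw [e, div_eq_zero_iff]
  left
  rw [hx₁, hy₁, hx₂, hy₂, hn]
  ring

theorem parametrizedSurface_eq {f : ℂ → ℂ} {T k : ℂ → ℝ} {Q : Set ℂ}
    (hb : Set.BijOn f disk Q) (hk : ∀ z ∈ disk, k (f z) = T z) :
    parametrizedSurface f T = graphOver k Q := by
  rw [parametrizedSurface, graphOver, ← hb.image_eq, Set.image_image]
  exact Set.image_congr fun z hz => by rw [hk z hz]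

namespace IsWeierstrassData

variable {f h g q W : ℂ → ℂ} {T : ℂ → ℝ} (H : IsWeierstrassData f h g q W T)
  {Q : Set ℂ} (hb : Set.BijOn f disk Q) (hQ : IsOpen Q)
include H hb hQ

omit hQ in
theorem contDiffOn_graph {k : ℂ → ℝ} (hk : ∀ z ∈ disk, k (f z) = T z) : ContDiffOn ℝ ∞ k Q := by
  intro w hw
  obtain ⟨z, hz, rfl⟩ := hb.surjOn hw
  have hinv := hb.invOn_invFunOn
  have c1 := H.contDiffAt_inverse hinv hz
  have e : Function.invFunOn f disk (f z) = z := hinv.1 hz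
  have c2 : ContDiffAt ℝ ∞ (T ∘ Function.invFunOn f disk) (f z) := by
    refine ContDiffAt.comp (f z) ?_ c1
    rw [e]; exact H.contDiffAt_height hz
  refine c2.contDiffWithinAt.congr_of_mem (fun w' hw' => ?_) hw
  obtain ⟨z', hz', rfl⟩ := hb.surjOn hw'
  rw [hk z' hz', Function.comp_apply, hinv.1 hz']

theorem isMinimalGraph {k : ℂ → ℝ} (hk : ∀ z ∈ disk, k (f z) = T z) : IsMinimalGraph k Q where
  isOpen := hQ
  smooth := H.contDiffOn_graph hb hk
  equation := by
    have hks := H.contDiffOn_graph hb hk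
    have hfd : ContDiffOn ℝ ∞ (fun w => fderiv ℝ k w) Q :=
      hks.fderiv_of_isOpen hQ (by simp)
    have hUs : ContDiffOn ℝ ∞ (partialU k) Q := hfd.clm_apply contDiffOn_const
    have hVs : ContDiffOn ℝ ∞ (partialV k) Q := hfd.clm_apply contDiffOn_const
    have hdk : ∀ z ∈ disk, DifferentiableAt ℝ k (f z) := fun z hz =>
      (hks.contDiffAt (hQ.mem_nhds (hb.mapsTo hz))).differentiableAt (by simp)
    intro w hw
    obtain ⟨z, hz, rfl⟩ := hb.surjOn hw
    have hdU : DifferentiableAt ℝ (partialU k) (f z) :=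
      (hUs.contDiffAt (hQ.mem_nhds hw)).differentiableAt (by simp)
    have hdV : DifferentiableAt ℝ (partialV k) (f z) :=
      (hVs.contDiffAt (hQ.mem_nhds hw)).differentiableAt (by simp)
    have hq : HasDerivAt q (deriv q z) z :=
      (H.q_holo.differentiableAt (isOpen_disk.mem_nhds hz)).hasDerivAt
    have hn4 : ‖q z‖ ^ 2 = (q z).re ^ 2 + (q z).im ^ 2 := by
      rw [Complex.sq_norm, Complex.normSq_apply]; ring
    have hlt : (q z).re ^ 2 + (q z).im ^ 2 < 1 := by
      rw [← hn4]; exact pow_lt_one₀ (norm_nonneg _) (H.q_lt z hz) two_ne_zero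
    have n0 : 1 - ((q z).re ^ 2 + (q z).im ^ 2) ≠ 0 := by linarith
    have hqre : ∀ ζ : ℂ, HasDerivAt (fun t : ℝ => (q (z + t * ζ)).re) (deriv q z * ζ).re 0 ∧
        HasDerivAt (fun t : ℝ => (q (z + t * ζ)).im) (deriv q z * ζ).im 0 := by
      intro ζ
      have hc : HasDerivAt (fun t : ℂ => z + t * ζ) ζ ((0 : ℝ) : ℂ) := by
        simpa using ((hasDerivAt_id (((0 : ℝ) : ℂ))).mul_const ζ).const_add z
      have h1 := (HasDerivAt.comp_of_eq (((0 : ℝ) : ℂ)) hq hc (by simp)).comp_ofReal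
      exact ⟨Complex.reCLM.hasFDerivAt.comp_hasDerivAt (0 : ℝ) h1,
        Complex.imCLM.hasFDerivAt.comp_hasDerivAt (0 : ℝ) h1⟩
    have hden : ∀ ζ : ℂ, HasDerivAt
        (fun t : ℝ => 1 - ((q (z + t * ζ)).re ^ 2 + (q (z + t * ζ)).im ^ 2))
        (-(2 * (q z).re * (deriv q z * ζ).re + 2 * (q z).im * (deriv q z * ζ).im)) 0 := by
      intro ζ
      have h1 := (((hqre ζ).1.fun_pow 2).add ((hqre ζ).2.fun_pow 2)).const_sub 1
      refine h1.congr_deriv ?_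
      simp
    have hUd : ∀ ζ : ℂ, HasDerivAt (fun t : ℝ => 2 * (q (z + t * ζ)).im /
        (1 - ((q (z + t * ζ)).re ^ 2 + (q (z + t * ζ)).im ^ 2)))
        ((2 * (deriv q z * ζ).im * (1 - ((q z).re ^ 2 + (q z).im ^ 2)) + 2 * (q z).im *
          (2 * (q z).re * (deriv q z * ζ).re + 2 * (q z).im * (deriv q z * ζ).im)) /
          (1 - ((q z).re ^ 2 + (q z).im ^ 2)) ^ 2) 0 := by
      intro ζ
      have h1 := ((hqre ζ).2.const_mul 2).fun_div (hden ζ) (by simpa using n0)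
      refine h1.congr_deriv ?_
      simp
      ring
    have hVd : ∀ ζ : ℂ, HasDerivAt (fun t : ℝ => 2 * (q (z + t * ζ)).re /
        (1 - ((q (z + t * ζ)).re ^ 2 + (q (z + t * ζ)).im ^ 2)))
        ((2 * (deriv q z * ζ).re * (1 - ((q z).re ^ 2 + (q z).im ^ 2)) + 2 * (q z).re *
          (2 * (q z).re * (deriv q z * ζ).re + 2 * (q z).im * (deriv q z * ζ).im)) /
          (1 - ((q z).re ^ 2 + (q z).im ^ 2)) ^ 2) 0 := by
      intro ζ
      have h1 := ((hqre ζ).1.const_mul 2).fun_div (hden ζ) (by simpa using n0)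
      refine h1.congr_deriv ?_
      simp
      ring
    have eU : ∀ x ∈ disk, partialU k (f x) = 2 * (q x).im / (1 - ((q x).re ^ 2 + (q x).im ^ 2)) :=
      fun x hx => (H.partial_eq hk hx (hdk x hx)).1
    have eV : ∀ x ∈ disk, partialV k (f x) = 2 * (q x).re / (1 - ((q x).re ^ 2 + (q x).im ^ 2)) :=
      fun x hx => (H.partial_eq hk hx (hdk x hx)).2
    have pUU : partialU (partialU k) (f z) = _ :=
      H.fderiv_apply_direction 1 hz hdU eU (hUd _)
    have pVU : partialV (partialU k) (f z) = _ :=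
      H.fderiv_apply_direction Complex.I hz hdU eU (hUd _)
    have pVV : partialV (partialV k) (f z) = _ :=
      H.fderiv_apply_direction Complex.I hz hdV eV (hVd _)
    rw [pUU, pVU, pVV, eU z hz, eV z hz]
    have hs : ∀ v : ℂ, deriv q z * ((v - conj (q z) ^ 2 * conj v) /
        ((1 - ‖q z‖ ^ 4 : ℝ) * deriv h z)) =
        deriv q z / ((1 - ‖q z‖ ^ 4 : ℝ) * deriv h z) * (v - conj (q z) ^ 2 * conj v) :=
      fun v => by ring
    rw [hs, hs]
    generalize deriv q z / ((1 - ‖q z‖ ^ 4 : ℝ) * deriv h z) = s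
    refine minimal_surface_identity (a := s.re) (b := s.im) rfl n0 ?_ ?_ ?_ ?_ <;>
    · simp [pow_two]
      ring

theorem upwardNormal_eq {k : ℂ → ℝ} (hk : ∀ z ∈ disk, k (f z) = T z) {z : ℂ} (hz : z ∈ disk) :
    upwardNormal k (f z) = invStereo (-Complex.I * conj (q z)) := by
  have hd : DifferentiableAt ℝ k (f z) :=
    ((H.contDiffOn_graph hb hk).contDiffAt (hQ.mem_nhds (hb.mapsTo hz))).differentiableAt (by simp)
  obtain ⟨hU, hV⟩ := H.partial_eq hk hz hd
  exact PitotGraph.upwardNormal_eq (H.q_lt z hz) hU hV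

theorem isDiffeomorphismOnto : IsDiffeomorphismOnto f disk Q := by
  refine ⟨Function.invFunOn f disk, hb.mapsTo, ?_, hb.invOn_invFunOn, ?_, ?_⟩
  · exact hb.surjOn.mapsTo_invFunOn
  · exact fun z hz => ⟨disk, isOpen_disk, hz, f,
      fun x hx => (H.contDiffAt hx).contDiffWithinAt, fun _ _ => rfl⟩
  · refine fun w hw => ⟨Q, hQ, hw, Function.invFunOn f disk, fun w' hw' => ?_, fun _ _ => rfl⟩
    obtain ⟨z, hz, rfl⟩ := hb.surjOn hw'
    exact (H.contDiffAt_inverse hb.invOn_invFunOn hz).contDiffWithinAt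

theorem gaussMap_isDiffeomorphismOnto {k : ℂ → ℝ} (hk : ∀ z ∈ disk, k (f z) = T z)
    {r : ℂ → ℂ} (hr : ContDiffOn ℝ ∞ r disk) (hrm : Set.MapsTo r disk disk)
    (hqr : ∀ w ∈ disk, q (r w) = w) (hrq : ∀ z ∈ disk, r (q z) = z) :
    IsDiffeomorphismOnto (gaussMap k) (parametrizedSurface f T) upperHemisphere := by
  set lift : ℂ → EuclideanSpace ℝ (Fin 3) := fun z => !₂[(f z).re, (f z).im, T z] with hlift
  set back : EuclideanSpace ℝ (Fin 3) → ℂ := fun n => r (-Complex.I * conj (stereo n)) with hback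
  have hG : ∀ z ∈ disk, gaussMap k (lift z) = invStereo (-Complex.I * conj (q z)) := fun z hz => by
    rw [← H.upwardNormal_eq hb hQ hk hz]; rfl
  have hnorm : ∀ ζ : ℂ, ‖-Complex.I * conj ζ‖ = ‖ζ‖ := fun ζ => by simp
  have hinvol : ∀ ζ : ℂ, -Complex.I * conj (-Complex.I * conj ζ) = ζ := fun ζ => by
    simp only [map_mul, map_neg, Complex.conj_I, Complex.conj_conj]
    linear_combination -ζ * Complex.I_mul_I
  have hbm : ∀ n ∈ upperHemisphere, -Complex.I * conj (stereo n) ∈ disk := fun n hn => by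
    rw [mem_disk, hnorm]; exact norm_stereo_lt hn
  refine ⟨lift ∘ back, ?_, ?_, ⟨?_, ?_⟩, ?_, ?_⟩
  · rintro _ ⟨z, hz, rfl⟩
    rw [show gaussMap k _ = _ from hG z hz]
    exact invStereo_mem (by rw [hnorm]; exact H.q_lt z hz)
  · exact fun n hn => ⟨back n, hrm (hbm n hn), rfl⟩
  · rintro _ ⟨z, hz, rfl⟩
    rw [show gaussMap k _ = _ from hG z hz, Function.comp_apply, hback]
    simp only
    rw [stereo_invStereo, hinvol, hrq z hz]
  · intro n hn
    rw [Function.comp_apply, hG _ (hrm (hbm n hn)), hqr _ (hbm n hn), hinvol, invStereo_stereo hn]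
  · have hks := H.contDiffOn_graph hb hk
    have hfd : ContDiffOn ℝ ∞ (fun w => fderiv ℝ k w) Q := hks.fderiv_of_isOpen hQ (by simp)
    have hUs : ContDiffOn ℝ ∞ (partialU k) Q := hfd.clm_apply contDiffOn_const
    have hVs : ContDiffOn ℝ ∞ (partialV k) Q := hfd.clm_apply contDiffOn_const
    have hpr : ContDiff ℝ ∞ fun x : EuclideanSpace ℝ (Fin 3) => (⟨x 0, x 1⟩ : ℂ) := by
      have hc : ∀ i : Fin 3, ContDiff ℝ ∞ fun n : EuclideanSpace ℝ (Fin 3) => n i := fun i =>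
        contDiff_piLp_apply (p := 2) (E := fun _ : Fin 3 => ℝ)
      exact contDiffOn_univ.mp (contDiffOn_complex_mk (hc 0).contDiffOn (hc 1).contDiffOn)
    have hN : ContDiffOn ℝ ∞ (upwardNormal k) Q := by
      have hpos : ∀ w, 0 < 1 + partialU k w ^ 2 + partialV k w ^ 2 := fun w => by positivity
      refine ContDiffOn.smul (ContDiffOn.div contDiffOn_const (ContDiffOn.sqrt
        ((contDiffOn_const.add (hUs.pow 2)).add (hVs.pow 2)) fun w _ => (hpos w).ne') fun w _ =>
        (Real.sqrt_pos.mpr (hpos w)).ne') ?_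
      exact contDiffOn_vec hUs.neg hVs.neg contDiffOn_const
    rintro _ ⟨z, hz, rfl⟩
    refine ⟨(fun x : EuclideanSpace ℝ (Fin 3) => (⟨x 0, x 1⟩ : ℂ)) ⁻¹' Q,
      hQ.preimage hpr.continuous, ?_, gaussMap k, ?_, fun _ _ => rfl⟩
    · exact hb.mapsTo hz
    · exact hN.comp hpr.contDiffOn fun x hx => hx
  · have hl : ContDiffOn ℝ ∞ lift disk := by
      have hf : ContDiffOn ℝ ∞ f disk := fun x hx => (H.contDiffAt hx).contDiffWithinAt
      exact contDiffOn_vec (Complex.reCLM.contDiff.comp_contDiffOn hf)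
        (Complex.imCLM.contDiff.comp_contDiffOn hf)
        fun x hx => (H.contDiffAt_height hx).contDiffWithinAt
    have hopen : IsOpen {n : EuclideanSpace ℝ (Fin 3) | 0 < 1 + n 2} :=
      isOpen_lt continuous_const (by fun_prop)
    have hst : ContDiffOn ℝ ∞ (fun n => -Complex.I * conj (stereo n))
        {n : EuclideanSpace ℝ (Fin 3) | 0 < 1 + n 2} :=
      contDiffOn_const.mul (Complex.conjCLE.contDiff.comp_contDiffOn contDiffOn_stereo)
    intro n hn
    refine ⟨{n : EuclideanSpace ℝ (Fin 3) | 0 < 1 + n 2} ∩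
      (fun n => -Complex.I * conj (stereo n)) ⁻¹' disk,
      hst.continuousOn.isOpen_inter_preimage hopen isOpen_disk,
      ⟨?_, hbm n hn⟩, lift ∘ back, ?_, fun _ _ => rfl⟩
    · have := hn.2
      change 0 < 1 + n 2
      linarith
    · have hbk : ContDiffOn ℝ ∞ back ({n : EuclideanSpace ℝ (Fin 3) | 0 < 1 + n 2} ∩
          (fun n => -Complex.I * conj (stereo n)) ⁻¹' disk) :=
        hr.comp (hst.mono Set.inter_subset_left) fun n hn => hn.2
      exact hl.comp hbk fun n hn => hrm hn.2

end IsWeierstrassData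

/-! ### Disk automorphisms -/

theorem norm_blaschke_lt {c z : ℂ} (hc : ‖c‖ < 1) (hz : ‖z‖ < 1) : ‖blaschke c z‖ < 1 := by
  have hne := one_sub_mul_conj_ne_zero hc hz.le
  rw [blaschke, norm_div, div_lt_one (norm_pos_iff.mpr hne)]
  refine lt_of_pow_lt_pow_left₀ 2 (norm_nonneg _) ?_
  have h1 : ‖c‖ ^ 2 < 1 := pow_lt_one₀ (norm_nonneg _) hc two_ne_zero
  have h2 : ‖z‖ ^ 2 < 1 := pow_lt_one₀ (norm_nonneg _) hz two_ne_zero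
  have key : ‖1 - z * conj c‖ ^ 2 - ‖z - c‖ ^ 2 = (1 - ‖c‖ ^ 2) * (1 - ‖z‖ ^ 2) := by
    simp only [Complex.sq_norm, Complex.normSq_apply]
    simp
    ring
  nlinarith [mul_pos (sub_pos.mpr h1) (sub_pos.mpr h2)]

theorem blaschke_blaschke_neg {c z : ℂ} (hc : ‖c‖ < 1) (hz : ‖z‖ < 1) :
    blaschke c (blaschke (-c) z) = z := by
  have hc' : ‖-c‖ < 1 := by rwa [norm_neg]
  have h1 := one_sub_mul_conj_ne_zero hc' hz.le
  have h2 := one_sub_mul_conj_ne_zero hc (norm_blaschke_lt hc' hz).le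
  have h3 : blaschke (-c) z * (1 - z * conj (-c)) = z - -c := div_mul_cancel₀ _ h1
  rw [blaschke, div_eq_iff h2]
  rw [map_neg] at h3
  generalize blaschke (-c) z = u at *
  linear_combination h3

theorem differentiableOn_blaschke {c : ℂ} (hc : ‖c‖ < 1) : DifferentiableOn ℂ (blaschke c) disk := by
  intro z hz
  have hne := one_sub_mul_conj_ne_zero hc (mem_disk.mp hz).le
  refine DifferentiableAt.differentiableWithinAt ?_
  exact DifferentiableAt.div (by fun_prop) (by fun_prop) hne

/-! ### Boundary behaviour of the height -/

theorem logSum_im {w : ℂ} (m₀ m₁ m₂ m₃ : ℝ) (z : ℂ) :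
    2 * (logSum w m₀ m₁ m₂ m₃ z).im = 1 / Real.pi * (m₀ * Real.log ‖1 - z / 1‖
      + m₁ * Real.log ‖1 - z / w‖ + m₂ * Real.log ‖1 - z / (-1)‖
      + m₃ * Real.log ‖1 - z / (-w)‖) := by
  have hI : -(1 / (2 * Real.pi * Complex.I)) = ((1 / (2 * Real.pi) : ℝ) : ℂ) * Complex.I := by
    have hpi : (Real.pi : ℂ) ≠ 0 := by exact_mod_cast Real.pi_ne_zero
    push_cast
    field_simp
    linear_combination -Complex.I_sq
  rw [logSum, hI]
  simp only [Complex.mul_im, Complex.mul_re, Complex.add_re, Complex.ofReal_re,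
    Complex.ofReal_im, Complex.I_re, Complex.I_im, Complex.log_re]
  field_simp
  ring

theorem tendsto_log_norm_atBot {ζ : ℂ} (hζ : ‖ζ‖ = 1) :
    Filter.Tendsto (fun z => Real.log ‖1 - z / ζ‖) (𝓝[disk] ζ) Filter.atBot := by
  refine Real.tendsto_log_nhdsGT_zero.comp (tendsto_nhdsWithin_iff.mpr ⟨?_, ?_⟩)
  · have hc : Continuous fun z : ℂ => ‖1 - z / ζ‖ := by fun_prop
    have := (hc.tendsto ζ).mono_left (nhdsWithin_le_nhds (s := disk))
    have h0 : ζ ≠ 0 := fun h => by simp [h] at hζ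
    simpa [div_self h0] using this
  · filter_upwards [self_mem_nhdsWithin] with z hz
    exact norm_pos_iff.mpr (Complex.slitPlane_ne_zero (one_sub_div_mem_slitPlane hz hζ))

theorem tendsto_log_norm_nhds {ζ ξ : ℂ} (hξ : ξ ≠ 0) (h : ζ ≠ ξ) :
    Filter.Tendsto (fun z => Real.log ‖1 - z / ξ‖) (𝓝[disk] ζ) (𝓝 (Real.log ‖1 - ζ / ξ‖)) := by
  have hc : Continuous fun z : ℂ => ‖1 - z / ξ‖ := by fun_prop
  refine ((hc.tendsto ζ).mono_left nhdsWithin_le_nhds).log ?_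
  rw [norm_ne_zero_iff, sub_ne_zero]
  intro h1
  exact h ((div_eq_one_iff_eq hξ).mp h1.symm)

theorem tendsto_log_combination {ζ ξ₁ ξ₂ ξ₃ : ℂ} {m m₁ m₂ m₃ : ℝ} (hζ : ‖ζ‖ = 1) (hm : m < 0)
    (h1 : ξ₁ ≠ 0 ∧ ζ ≠ ξ₁) (h2 : ξ₂ ≠ 0 ∧ ζ ≠ ξ₂) (h3 : ξ₃ ≠ 0 ∧ ζ ≠ ξ₃) :
    Filter.Tendsto (fun z => 1 / Real.pi * (m * Real.log ‖1 - z / ζ‖ + (m₁ * Real.log ‖1 - z / ξ₁‖ +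
      m₂ * Real.log ‖1 - z / ξ₂‖ + m₃ * Real.log ‖1 - z / ξ₃‖))) (𝓝[disk] ζ) Filter.atTop := by
  refine Filter.Tendsto.const_mul_atTop (by positivity) ?_
  refine Filter.Tendsto.atTop_add ((tendsto_log_norm_atBot hζ).const_mul_atBot_of_neg hm)
    ((((tendsto_log_norm_nhds h1.1 h1.2).const_mul m₁).add
      ((tendsto_log_norm_nhds h2.1 h2.2).const_mul m₂)).add
      ((tendsto_log_norm_nhds h3.1 h3.2).const_mul m₃))

theorem tendsto_logSum_im {w : ℂ} (hw : ‖w‖ = 1) (hw2 : w ^ 2 ≠ 1) (m₀ m₁ m₂ m₃ : ℝ) :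
    (m₀ < 0 → Filter.Tendsto (fun z => 2 * (logSum w m₀ m₁ m₂ m₃ z).im) (𝓝[disk] 1) Filter.atTop) ∧
    (m₁ < 0 → Filter.Tendsto (fun z => 2 * (logSum w m₀ m₁ m₂ m₃ z).im) (𝓝[disk] w) Filter.atTop) ∧
    (m₂ < 0 →
      Filter.Tendsto (fun z => 2 * (logSum w m₀ m₁ m₂ m₃ z).im) (𝓝[disk] (-1)) Filter.atTop) ∧
    (m₃ < 0 →
      Filter.Tendsto (fun z => 2 * (logSum w m₀ m₁ m₂ m₃ z).im) (𝓝[disk] (-w)) Filter.atTop) := by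
  have hw0 : w ≠ 0 := fun h => by simp [h] at hw
  have n1 : (1 : ℂ) ≠ w := fun h => hw2 (by rw [← h]; ring)
  have n2 : -1 ≠ w := fun h => hw2 (by rw [← h]; ring)
  have n3 : (1 : ℂ) ≠ -1 := by norm_num
  have n4 : w ≠ -w := fun h => hw0 (by linear_combination h / 2)
  have n5 : (1 : ℂ) ≠ -w := fun h => n2 (by linear_combination -h)
  have n6 : -1 ≠ -w := fun h => n1 (neg_injective h)
  have z1 : (1 : ℂ) ≠ 0 := one_ne_zero
  have z2 : (-1 : ℂ) ≠ 0 := neg_ne_zero.mpr z1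
  have z3 : -w ≠ 0 := neg_ne_zero.mpr hw0
  refine ⟨fun h => ?_, fun h => ?_, fun h => ?_, fun h => ?_⟩
  · refine (tendsto_log_combination (m₁ := m₁) (m₂ := m₂) (m₃ := m₃) norm_one h ⟨hw0, n1⟩ ⟨z2, n3⟩
      ⟨z3, n5⟩).congr fun z => ?_
    rw [logSum_im]; ring
  · refine (tendsto_log_combination (m₁ := m₀) (m₂ := m₂) (m₃ := m₃) hw h ⟨z1, n1.symm⟩ ⟨z2, n2.symm⟩
      ⟨z3, n4⟩).congr fun z => ?_
    rw [logSum_im]; ring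
  · refine (tendsto_log_combination (m₁ := m₀) (m₂ := m₁) (m₃ := m₃) (by simp) h ⟨z1, n3.symm⟩
      ⟨hw0, n2⟩ ⟨z3, n6⟩).congr fun z => ?_
    rw [logSum_im]; ring
  · refine (tendsto_log_combination (m₁ := m₀) (m₂ := m₁) (m₃ := m₂) (by simpa using hw) h
      ⟨z1, n5.symm⟩ ⟨hw0, n4.symm⟩ ⟨z2, n6.symm⟩).congr fun z => ?_
    rw [logSum_im]; ring

theorem logSum_im_neg {w : ℂ} (m₀ m₁ m₂ m₃ : ℝ) (z : ℂ) :
    2 * (logSum w (-m₀ : ℝ) (-m₁ : ℝ) (-m₂ : ℝ) (-m₃ : ℝ) z).im =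
      -(2 * (logSum w m₀ m₁ m₂ m₃ z).im) := by
  rw [logSum_im, logSum_im]; ring

/-- If `f` has boundary limits away from `w` except at `ζ`, then its inverse tends to `ζ` at `w`. -/
theorem tendsto_inverse {f ψ : ℂ → ℂ} {Q : Set ℂ} {w ζ : ℂ} (hb : Set.BijOn f disk Q)
    (hf : ContinuousOn f disk) (hψ : Set.InvOn ψ f disk Q) (hw : w ∉ Q)
    (h : ∀ z, ‖z‖ = 1 → z ≠ ζ → ∃ u v, w ∉ segment ℝ u v ∧
      Filter.Tendsto (fun x => Metric.infDist (f x) (segment ℝ u v)) (𝓝[disk] z) (𝓝 0)) :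
    Filter.Tendsto ψ (𝓝[Q] w) (𝓝[disk] ζ) := by
  have hmaps : ∀ᶠ y in 𝓝[Q] w, ψ y ∈ disk := by
    filter_upwards [self_mem_nhdsWithin] with y hy
    obtain ⟨z, hz, rfl⟩ := hb.surjOn hy
    rw [hψ.1 hz]; exact hz
  refine tendsto_nhdsWithin_iff.mpr ⟨?_, hmaps⟩
  have hcpt : IsCompact (Metric.closedBall (0 : ℂ) 1) := isCompact_closedBall 0 1
  refine hcpt.tendsto_nhds_of_unique_mapClusterPt
    (hmaps.mono fun y hy => Metric.ball_subset_closedBall hy) fun z hz hzc => ?_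
  by_contra hne
  have hu : (𝓝 z ⊓ Filter.map ψ (𝓝[Q] w)).NeBot := hzc
  have hle : 𝓝 z ⊓ Filter.map ψ (𝓝[Q] w) ≤ 𝓝[disk] z :=
    inf_le_inf_left _ (Filter.le_principal_iff.mpr hmaps)
  have hlim : Filter.Tendsto f (𝓝 z ⊓ Filter.map ψ (𝓝[Q] w)) (𝓝 w) := by
    refine Filter.Tendsto.mono_left ?_ inf_le_right
    rw [Filter.tendsto_map'_iff]
    refine (Filter.tendsto_id.mono_left nhdsWithin_le_nhds).congr' ?_
    filter_upwards [self_mem_nhdsWithin] with y hy using (hψ.2 hy).symm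
  by_cases hzd : z ∈ disk
  · have h1 := (hf z hzd).tendsto.mono_left hle
    rw [tendsto_nhds_unique hlim h1] at hw
    exact hw (hb.mapsTo hzd)
  · have hz1 : ‖z‖ = 1 := le_antisymm (by simpa using hz) (by simpa [mem_disk] using hzd)
    obtain ⟨u, v, hwn, ht⟩ := h z hz1 hne
    have h2 := ((Metric.continuous_infDist_pt (segment ℝ u v)).tendsto w).comp hlim
    have h3 := tendsto_nhds_unique h2 (ht.mono_left hle)
    have hcl : IsClosed (segment ℝ u v) := by
      rw [segment_eq_image_lineMap]
      exact (isCompact_Icc.image (AffineMap.lineMap_continuous)).isClosed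
    exact hwn ((hcl.mem_iff_infDist_zero ⟨u, left_mem_segment ℝ u v⟩).mpr h3)

/-- The height integral in terms of a primitive. -/
theorem weierstrassHeight_eq {p q W : ℂ → ℂ} (hW : ∀ z ∈ disk, HasDerivAt W (p z * q z) z)
    (hW0 : W 0 = 0) {z : ℂ} (hz : z ∈ disk) : weierstrassHeight p q z = 2 * (W z).im := by
  have hWd : DifferentiableOn ℂ W disk := fun x hx => (hW x hx).differentiableAt.differentiableWithinAt
  have hmem : ∀ t ∈ Set.uIcc (0 : ℝ) 1, (t : ℂ) * z ∈ disk := by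
    intro t ht
    rw [Set.uIcc_of_le zero_le_one] at ht
    rw [mem_disk] at hz ⊢
    rw [norm_mul, Complex.norm_real, Real.norm_of_nonneg ht.1]
    nlinarith [norm_nonneg z, ht.1, ht.2]
  have hder : ∀ t ∈ Set.uIcc (0 : ℝ) 1,
      HasDerivAt (fun t : ℝ => W (t * z)) (p (t * z) * q (t * z) * z) t := by
    intro t ht
    have h1 : HasDerivAt (fun s : ℂ => s * z) z (t : ℂ) := by
      simpa using (hasDerivAt_id (t : ℂ)).mul_const z
    exact (HasDerivAt.comp (t : ℂ) (hW _ (hmem t ht)) h1).comp_ofReal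
  have hint : IntervalIntegrable (fun t : ℝ => p (t * z) * q (t * z) * z) MeasureTheory.volume 0 1 := by
    have h1 : ContinuousOn (fun t : ℝ => deriv W (t * z) * z) (Set.uIcc 0 1) := by
      refine ContinuousOn.mul ?_ continuousOn_const
      exact (hWd.deriv isOpen_disk).continuousOn.comp (by fun_prop) hmem
    refine (h1.congr fun t ht => ?_).intervalIntegrable
    rw [(hW _ (hmem t ht)).deriv]
  rw [weierstrassHeight, intervalIntegral.integral_eq_sub_of_hasDerivAt hder hint]
  simp [hW0]

theorem exists_angle {w : ℂ} (hw : ‖w‖ = 1) (him : 0 < w.im) :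
    ∃ p ∈ Set.Ioo 0 Real.pi, Complex.exp (Complex.I * p) = w := by
  have h1 := Complex.norm_mul_exp_arg_mul_I w
  rw [hw, Complex.ofReal_one, one_mul, mul_comm] at h1
  have hs : Real.sin w.arg = w.im := by rw [Complex.sin_arg, hw, div_one]
  refine ⟨w.arg, ⟨?_, ?_⟩, h1⟩
  · by_contra h
    have := Real.sin_nonpos_of_nonpos_of_neg_pi_le (not_lt.mp h) (Complex.neg_pi_lt_arg w).le
    linarith
  · refine lt_of_le_of_ne (Complex.arg_le_pi w) fun h => ?_
    rw [h, Real.sin_pi] at hs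
    linarith

/-- The angle `p` and the Möbius data of a Pitot quadrilateral. -/
theorem IsPitotQuadrilateral.exists_data {b₁ b₂ b₃ b₄ : ℂ}
    (hQ : IsPitotQuadrilateral b₁ b₂ b₃ b₄) :
    ∃ p ∈ Set.Ioo 0 Real.pi, ∃ w X a : ℂ, Complex.exp (Complex.I * p) = w ∧ ‖w‖ = 1 ∧
      w ^ 2 ≠ 1 ∧ ‖X‖ = 1 ∧ ‖a‖ < 1 ∧
      (0 < ‖b₄ - b₃‖ ∧ 0 < ‖b₁ - b₄‖ ∧ 0 < ‖b₂ - b₁‖ ∧ 0 < ‖b₃ - b₂‖) ∧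
      ∀ z ∈ disk,
        poleSum w (b₄ - b₃) (b₁ - b₄) (b₂ - b₁) (b₃ - b₂) z ≠ 0 ∧
        X * blaschke a z * poleSum w (b₄ - b₃) (b₁ - b₄) (b₂ - b₁) (b₃ - b₂) z =
          poleSum w (-‖b₄ - b₃‖ : ℝ) ‖b₁ - b₄‖ (-‖b₂ - b₁‖ : ℝ) ‖b₃ - b₂‖ z ∧
        X * blaschke a z * poleSum w (-‖b₄ - b₃‖ : ℝ) ‖b₁ - b₄‖ (-‖b₂ - b₁‖ : ℝ) ‖b₃ - b₂‖ z =
          poleSum w (conj (b₄ - b₃)) (conj (b₁ - b₄)) (conj (b₂ - b₁)) (conj (b₃ - b₂)) z := by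
  have hsum : (b₄ - b₃) + (b₁ - b₄) + (b₂ - b₁) + (b₃ - b₂) = 0 := by ring
  have hpit : ‖b₄ - b₃‖ + ‖b₂ - b₁‖ = ‖b₁ - b₄‖ + ‖b₃ - b₂‖ := by
    have := hQ.side_condition
    rw [dist_comm b₁ b₂, dist_comm b₃ b₄, dist_comm b₂ b₃, dist_comm b₄ b₁] at this
    simp only [dist_eq_norm] at this
    linarith
  have harea : 0 < cross ((b₂ - b₁) + (b₃ - b₂)) ((b₃ - b₂) + (b₄ - b₃)) := by
    have := hQ.counterclockwise
    simp only [conj_mul_im] at this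
    have e : cross ((b₂ - b₁) + (b₃ - b₂)) ((b₃ - b₂) + (b₄ - b₃)) =
        cross b₁ b₂ + cross b₂ b₃ + cross b₃ b₄ + cross b₄ b₁ := by
      simp [cross]; ring
    rw [e]; exact this
  obtain ⟨hl, w, X, a, hw, him, hX, ha, q0, q1, q2, q3⟩ := exists_moebius hsum hpit harea
  obtain ⟨p, hp, hpw⟩ := exists_angle hw him
  have hw2 : w ^ 2 ≠ 1 := by
    intro h
    have h1 : (w - 1) * (w + 1) = 0 := by linear_combination h
    rcases mul_eq_zero.mp h1 with h2 | h2
    · rw [sub_eq_zero.mp h2] at him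
      simp at him
    · rw [eq_neg_of_add_eq_zero_left h2] at him
      simp at him
  refine ⟨p, hp, w, X, a, hpw, hw, hw2, hX, ha, hl, fun z hz => ?_⟩
  exact weierstrass_data hw hw2 hX ha hsum (by linarith) (neg_ne_zero.mpr hl.1.ne') hl.2.1.ne'
    (neg_ne_zero.mpr hl.2.2.1.ne') hl.2.2.2.ne' (neg_sq _) rfl (neg_sq _) rfl
    (by rw [q0]; push_cast; rfl) q1 (by rw [q2]; push_cast; rfl) q3 hz

/-- Near an open side, the inverse of the Poisson extension tends to the jump point. -/
theorem tendsto_inverse_poissonExtension {b₁ b₂ b₃ b₄ : ℂ} {p : ℝ} (hp : p ∈ Set.Ioo 0 Real.pi)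
    {ψ : ℂ → ℂ} {Q : Set ℂ} {v ζ : ℂ}
    (hb : Set.BijOn (poissonExtension (stepFunction b₁ b₂ b₃ b₄ p)) disk Q)
    (hf : ContinuousOn (poissonExtension (stepFunction b₁ b₂ b₃ b₄ p)) disk)
    (hψ : Set.InvOn ψ (poissonExtension (stepFunction b₁ b₂ b₃ b₄ p)) disk Q) (hv : v ∉ Q)
    (h0 : ζ ≠ 1 → v ∉ segment ℝ b₃ b₄)
    (h1 : ζ ≠ Complex.exp (Complex.I * p) → v ∉ segment ℝ b₄ b₁)
    (h2 : ζ ≠ -1 → v ∉ segment ℝ b₁ b₂)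
    (h3 : ζ ≠ -Complex.exp (Complex.I * p) → v ∉ segment ℝ b₂ b₃)
    (hw2 : Complex.exp (Complex.I * p) ^ 2 ≠ 1) :
    Filter.Tendsto ψ (𝓝[Q] v) (𝓝[disk] ζ) := by
  refine tendsto_inverse hb hf hψ hv fun z hz hne => ?_
  set w := Complex.exp (Complex.I * p)
  have n1 : (1 : ℂ) ≠ w := fun h => hw2 (by rw [← h]; ring)
  have n2 : -1 ≠ w := fun h => hw2 (by rw [← h]; ring)
  have n3 : -w ≠ w := fun h => by
    have : w = 0 := by linear_combination -h / 2
    exact Complex.exp_ne_zero _ this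
  have n4 : (1 : ℂ) ≠ -1 := by norm_num
  have o01 : ζ ≠ 1 ∨ ζ ≠ w := by
    by_contra! hc; exact n1 (hc.1.symm.trans hc.2)
  have o12 : ζ ≠ w ∨ ζ ≠ -1 := by
    by_contra! hc; exact n2 (hc.2.symm.trans hc.1)
  have o23 : ζ ≠ -1 ∨ ζ ≠ -w := by
    by_contra! hc; exact n1 (neg_injective (hc.1.symm.trans hc.2))
  have o30 : ζ ≠ -w ∨ ζ ≠ 1 := by
    by_contra! hc
    exact n2 (by linear_combination -(hc.2.symm.trans hc.1))
  rcases poissonExtension_boundary (b₁ := b₁) (b₂ := b₂) (b₃ := b₃) (b₄ := b₄) hp hz with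
    h | h | h | h | h | h | h | h
  · exact ⟨_, _, h0 fun e => hne (h.1.trans e.symm), h.2⟩
  · exact ⟨_, _, h1 fun e => hne (h.1.trans e.symm), h.2⟩
  · exact ⟨_, _, h2 fun e => hne (h.1.trans e.symm), h.2⟩
  · exact ⟨_, _, h3 fun e => hne (h.1.trans e.symm), h.2⟩
  · rcases o01 with o | o
    exacts [⟨_, _, h0 o, h.1⟩, ⟨_, _, h1 o, h.2⟩]
  · rcases o12 with o | o
    exacts [⟨_, _, h1 o, h.1⟩, ⟨_, _, h2 o, h.2⟩]
  · rcases o23 with o | o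
    exacts [⟨_, _, h2 o, h.1⟩, ⟨_, _, h3 o, h.2⟩]
  · rcases o30 with o | o
    exacts [⟨_, _, h3 o, h.1⟩, ⟨_, _, h0 o, h.2⟩]

theorem not_mem_quadRegion {b₁ b₂ b₃ b₄ v : ℂ} (h : v ∈ openSegment ℝ b₁ b₂ ∪ openSegment ℝ b₂ b₃ ∪
    openSegment ℝ b₃ b₄ ∪ openSegment ℝ b₄ b₁) : v ∉ quadRegion b₁ b₂ b₃ b₄ := fun hv => hv.1 <| by
  rw [quadBoundary_eq]
  exact Set.union_subset_union (Set.union_subset_union (Set.union_subset_union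
    (openSegment_subset_segment ℝ _ _) (openSegment_subset_segment ℝ _ _))
    (openSegment_subset_segment ℝ _ _)) (openSegment_subset_segment ℝ _ _) h

end PitotGraph

end

theorem theorem2 (b₁ b₂ b₃ b₄ : ℂ) (hQ : PitotGraph.IsPitotQuadrilateral b₁ b₂ b₃ b₄) :
    ∃ (p : ℝ) (f h g q : ℂ → ℂ) (T : ℂ → ℝ) (k : ℂ → ℝ),
      -- the harmonic diffeomorphism `f = P[F] = h + conj g` of the disk onto `Q`
      p ∈ Set.Ioo 0 Real.pi ∧
      f = PitotGraph.poissonExtension (PitotGraph.stepFunction b₁ b₂ b₃ b₄ p) ∧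
      PitotGraph.IsCanonicalDecomposition f h g ∧
      PitotGraph.IsDiffeomorphismOnto f PitotGraph.disk (PitotGraph.quadRegion b₁ b₂ b₃ b₄) ∧
      -- the Weierstrass data `(h', q)` with `q = √(g' / h')` a Möbius automorphism
      PitotGraph.IsDiskAutomorphism q ∧
      (∀ z ∈ PitotGraph.disk, deriv h z ≠ 0 ∧ q z ^ 2 = deriv g z / deriv h z) ∧
      T = PitotGraph.weierstrassHeight (deriv h) q ∧
      -- the surface is the graph over `Q` of the minimal graph function `k = T ∘ f⁻¹`
      (∀ z ∈ PitotGraph.disk, k (f z) = T z) ∧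
      PitotGraph.IsMinimalGraph k (PitotGraph.quadRegion b₁ b₂ b₃ b₄) ∧
      PitotGraph.parametrizedSurface f T =
        PitotGraph.graphOver k (PitotGraph.quadRegion b₁ b₂ b₃ b₄) ∧
      -- the unit normal at `(f z, T z)` is given by `q z`
      (∀ z ∈ PitotGraph.disk,
        PitotGraph.upwardNormal k (f z) = PitotGraph.invStereo (-Complex.I * conj (q z))) ∧
      -- the Gauss map is a diffeomorphism onto the open upper hemisphere
      PitotGraph.IsDiffeomorphismOnto (PitotGraph.gaussMap k)
        (PitotGraph.parametrizedSurface f T) PitotGraph.upperHemisphere ∧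
      -- Scherk-type asymptotics on the open sides
      (∀ ζ ∈ openSegment ℝ b₁ b₂ ∪ openSegment ℝ b₃ b₄,
        Filter.Tendsto k (𝓝[PitotGraph.quadRegion b₁ b₂ b₃ b₄] ζ) Filter.atTop) ∧
      (∀ ζ ∈ openSegment ℝ b₄ b₁ ∪ openSegment ℝ b₂ b₃,
        Filter.Tendsto k (𝓝[PitotGraph.quadRegion b₁ b₂ b₃ b₄] ζ) Filter.atBot) := by
  obtain ⟨p, hp, w, X, a, hpw, hw, hw2, hX, ha, ⟨l0, l1, l2, l3⟩, hdata⟩ := hQ.exists_data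
  set m₀ : ℝ := -‖b₄ - b₃‖ with hm₀
  set m₁ : ℝ := ‖b₁ - b₄‖ with hm₁
  set m₂ : ℝ := -‖b₂ - b₁‖ with hm₂
  set m₃ : ℝ := ‖b₃ - b₂‖ with hm₃
  set f := PitotGraph.poissonExtension (PitotGraph.stepFunction b₁ b₂ b₃ b₄ p) with hf
  set h : ℂ → ℂ := fun z => PitotGraph.stepMean b₁ b₂ b₃ b₄ p +
    PitotGraph.logSum w (b₄ - b₃) (b₁ - b₄) (b₂ - b₁) (b₃ - b₂) z with hh
  set g : ℂ → ℂ := PitotGraph.logSum w (conj (b₄ - b₃)) (conj (b₁ - b₄)) (conj (b₂ - b₁))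
    (conj (b₃ - b₂)) with hg
  set q : ℂ → ℂ := fun z => X * PitotGraph.blaschke a z with hq
  set W : ℂ → ℂ := PitotGraph.logSum w m₀ m₁ m₂ m₃ with hW
  set T := PitotGraph.weierstrassHeight (deriv h) q with hT
  have hhd : ∀ z ∈ PitotGraph.disk, HasDerivAt h
      (PitotGraph.poleSum w (b₄ - b₃) (b₁ - b₄) (b₂ - b₁) (b₃ - b₂) z) z :=
    fun z hz => (PitotGraph.hasDerivAt_logSum hw _ _ _ _ hz).const_add _
  have hgd : ∀ z ∈ PitotGraph.disk, HasDerivAt g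
      (PitotGraph.poleSum w (conj (b₄ - b₃)) (conj (b₁ - b₄)) (conj (b₂ - b₁))
        (conj (b₃ - b₂)) z) z :=
    fun z hz => PitotGraph.hasDerivAt_logSum hw _ _ _ _ hz
  have hWd : ∀ z ∈ PitotGraph.disk, HasDerivAt W (deriv h z * q z) z := fun z hz => by
    rw [(hhd z hz).deriv, mul_comm, show q z * _ = _ from (hdata z hz).2.1]
    exact PitotGraph.hasDerivAt_logSum hw _ _ _ _ hz
  have hWT : ∀ z ∈ PitotGraph.disk, T z = 2 * (W z).im := fun z hz =>
    PitotGraph.weierstrassHeight_eq hWd (PitotGraph.logSum_zero _ _ _ _ _) hz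
  have hfe : ∀ z ∈ PitotGraph.disk, f z = h z + conj (g z) := fun z hz => by
    rw [hf, PitotGraph.poissonExtension_eq_logSum hp hz, hpw]
  have hgq : ∀ z ∈ PitotGraph.disk, deriv g z = q z ^ 2 * deriv h z := fun z hz => by
    rw [(hgd z hz).deriv, (hhd z hz).deriv, pow_two, mul_assoc,
      show q z * PitotGraph.poleSum w _ _ _ _ z = _ from (hdata z hz).2.1]
    exact (hdata z hz).2.2.symm
  have hql : ∀ z ∈ PitotGraph.disk, ‖q z‖ < 1 := fun z hz => by
    rw [hq, norm_mul, hX, one_mul]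
    exact PitotGraph.norm_blaschke_lt ha (PitotGraph.mem_disk.mp hz)
  have H : PitotGraph.IsWeierstrassData f h g q W T :=
    { h_holo := fun z hz => (hhd z hz).differentiableAt.differentiableWithinAt
      g_holo := fun z hz => (hgd z hz).differentiableAt.differentiableWithinAt
      q_holo := (PitotGraph.differentiableOn_blaschke ha).const_mul X
      f_eq := hfe
      h_ne := fun z hz => by rw [(hhd z hz).deriv]; exact (hdata z hz).1
      g_deriv := hgq
      q_lt := hql
      W_deriv := hWd
      T_eq := hWT }
  obtain ⟨c, ν, hν⟩ := hQ.exists_isGauge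
  have hreg := hν.quadRegion_eq
  have hQo : IsOpen (PitotGraph.quadRegion b₁ b₂ b₃ b₄) := by rw [hreg]; exact hν.isOpen_inner
  have hb : Set.BijOn f PitotGraph.disk (PitotGraph.quadRegion b₁ b₂ b₃ b₄) := by
    rw [hreg]
    refine hν.bijOn PitotGraph.isOpen_disk ?_ Metric.isBounded_ball H.isLocalHomeomorphOn
      (PitotGraph.isBounded_image_poissonExtension hp) fun z hz =>
        PitotGraph.poissonExtension_tendsto_quadBoundary hp ?_
    · exact (convex_ball (0 : ℂ) 1).isConnected ⟨0, by simp⟩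
    · have : z ∈ Metric.sphere (0 : ℂ) 1 := by
        rw [← frontier_ball (0 : ℂ) one_ne_zero]; exact hz
      simpa using this
  have hinv := hb.invOn_invFunOn
  set k : ℂ → ℝ := fun y => T (Function.invFunOn f PitotGraph.disk y) with hk
  have hkT : ∀ z ∈ PitotGraph.disk, k (f z) = T z := fun z hz => by
    simp only [hk]; rw [hinv.1 hz]
  have L := PitotGraph.tendsto_logSum_im hw hw2 m₀ m₁ m₂ m₃
  have L' := PitotGraph.tendsto_logSum_im hw hw2 (-m₀) (-m₁) (-m₂) (-m₃)
  have hlim : ∀ {v ζ : ℂ} {l : Filter ℝ}, v ∈ openSegment ℝ b₁ b₂ ∪ openSegment ℝ b₂ b₃ ∪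
      openSegment ℝ b₃ b₄ ∪ openSegment ℝ b₄ b₁ → (ζ ≠ 1 → v ∉ segment ℝ b₃ b₄) →
      (ζ ≠ w → v ∉ segment ℝ b₄ b₁) → (ζ ≠ -1 → v ∉ segment ℝ b₁ b₂) →
      (ζ ≠ -w → v ∉ segment ℝ b₂ b₃) →
      Filter.Tendsto (fun z => 2 * (W z).im) (𝓝[PitotGraph.disk] ζ) l →
      Filter.Tendsto k (𝓝[PitotGraph.quadRegion b₁ b₂ b₃ b₄] v) l := by
    intro v ζ l hv h0 h1 h2 h3 hl
    have hTl : Filter.Tendsto T (𝓝[PitotGraph.disk] ζ) l := hl.congr' <| by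
      filter_upwards [self_mem_nhdsWithin] with z hz using (hWT z hz).symm
    subst hpw
    exact hTl.comp (PitotGraph.tendsto_inverse_poissonExtension hp hb
      H.isLocalHomeomorphOn.continuousOn hinv (PitotGraph.not_mem_quadRegion hv) h0 h1 h2 h3 hw2)
  refine ⟨p, f, h, g, q, T, k, hp, rfl,
    ⟨H.h_holo, H.g_holo, PitotGraph.logSum_zero _ _ _ _ _, hfe⟩,
    H.isDiffeomorphismOnto hb hQo, ⟨X, a, hX, ha, fun z _ => rfl⟩, fun z hz => ⟨H.h_ne z hz, ?_⟩,
    rfl, hkT, H.isMinimalGraph hb hQo hkT, PitotGraph.parametrizedSurface_eq hb hkT,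
    fun z hz => H.upwardNormal_eq hb hQo hkT hz, ?_, ?_, ?_⟩
  · rw [hgq z hz, mul_div_cancel_right₀ _ (H.h_ne z hz)]
  · have hXc := PitotGraph.conj_eq_inv_of_norm_eq_one hX
    have ha' : ‖-a‖ < 1 := by rwa [norm_neg]
    have hXm : ∀ z ∈ PitotGraph.disk, conj X * z ∈ PitotGraph.disk := fun z hz => by
      rw [PitotGraph.mem_disk, norm_mul, RCLike.norm_conj, hX, one_mul]
      exact PitotGraph.mem_disk.mp hz
    refine H.gaussMap_isDiffeomorphismOnto hb hQo hkT
      (r := fun z => PitotGraph.blaschke (-a) (conj X * z)) ?_ ?_ ?_ ?_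
    · exact (((PitotGraph.differentiableOn_blaschke ha').comp (by fun_prop) hXm).contDiffOn
        PitotGraph.isOpen_disk).restrict_scalars ℝ
    · exact fun z hz => PitotGraph.mem_disk.mpr
        (PitotGraph.norm_blaschke_lt ha' (PitotGraph.mem_disk.mp (hXm z hz)))
    · intro z hz
      simp only [hq]
      rw [PitotGraph.blaschke_blaschke_neg ha (PitotGraph.mem_disk.mp (hXm z hz))]
      linear_combination z * hXc
    · intro z hz
      simp only [hq]
      have e : conj X * (X * PitotGraph.blaschke a z) = PitotGraph.blaschke a z := by
        linear_combination PitotGraph.blaschke a z * hXc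
      rw [e]
      have := PitotGraph.blaschke_blaschke_neg ha' (PitotGraph.mem_disk.mp hz)
      rwa [neg_neg] at this
  · rintro v (hv | hv)
    · obtain ⟨d1, d2, d3⟩ := hQ.rotate.openSegment_disjoint v hv
      exact hlim (by simp [hv]) (fun _ => d2) (fun _ => d3) (fun e => (e rfl).elim) (fun _ => d1)
        (L.2.2.1 (by simpa [hm₂] using l2))
    · obtain ⟨d1, d2, d3⟩ := hQ.rotate.rotate.rotate.openSegment_disjoint v hv
      exact hlim (by simp [hv]) (fun e => (e rfl).elim) (fun _ => d1) (fun _ => d2) (fun _ => d3)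
        (L.1 (by simpa [hm₀] using l0))
  · rintro v (hv | hv)
    · obtain ⟨d1, d2, d3⟩ := hQ.openSegment_disjoint v hv
      refine hlim (by simp [hv]) (fun _ => d3) (fun e => (e rfl).elim) (fun _ => d1) (fun _ => d2) ?_
      rw [← Filter.tendsto_neg_atTop_iff]
      simpa only [PitotGraph.logSum_im_neg] using L'.2.1 (by simpa [hm₁] using l1)
    · obtain ⟨d1, d2, d3⟩ := hQ.rotate.rotate.openSegment_disjoint v hv
      refine hlim (by simp [hv]) (fun _ => d1) (fun _ => d2) (fun _ => d3) (fun e => (e rfl).elim) ?_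
      rw [← Filter.tendsto_neg_atTop_iff]
      simpa only [PitotGraph.logSum_im_neg] using L'.2.2.2 (by simpa [hm₃] using l3)
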